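/- Let $K\in\mathbb{R}$ and let $\mathbb{X}_K$ be the simply connected complete surface of constant curvature $K$. Put $\sin_K(x)=\frac{1}{\sqrt K}\sin(\sqrt K\,x)$ if $K>0$, $\sin_0(x)=x$, and $\sin_K(x)=\frac{1}{\sqrt{-K}}\sinh(\sqrt{-K}\,x)$ if $K<0$. Let $\mathcal{G}^K$ be the set of (unoriented, complete) geodesics of $\mathbb{X}_K$ and let $\mu_K$ be the isometry-invariant measure on $\mathcal{G}^K$ normalized so that $d\mu_K=\sin\alpha\,dl\,d\alpha$, where $l$ is the arc-length position and $\alpha$ the angle at which a geodesic crosses a fixed geodesic; equivalently $d\mu_K=(\sin_K)'(w)\,dw\,d\eta$ in polar coordinates, where $w$ is the distance from a base point to the geodesic ($0\le w$, and $w\le\frac{\pi}{2\sqrt K}$ if $K>0$) and $\eta\in[0,2\pi)$ is the direction of the perpendicular dropped from the base point. Let $D\subset\mathbb{X}_K$ be compact with non-empty interior and geodesically convex (any two points of $D$ are joined by a shortest geodesic segment contained in $D$), and suppose that $\partial D$ is a simple closed geodesic polygon with edges $a_1,\dots,a_n$, consecutive edges lying on different geodesics (so that every vertex is a true corner). Let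 $|a_i|$ be the length of $a_i$, and let $\mathcal{G}^K_D$ be the set of geodesics meeting $D$. For $\gamma\in\mathcal{G}^K_D$ let $\rho_K(\gamma)$ be the length of the chord $\gamma\cap D$, and for $\mu_K$-almost every such $\gamma$ let $\alpha_1(\gamma),\alpha_2(\gamma)\in(0,\pi)$ be the two angles, at the two endpoints of the chord, between the chord and $\partial D$ that lie on the same side of $\gamma$ (the product $\cot\alpha_1\cot\alpha_2$ does not depend on the side). Then for every $f\in C^1(\mathbb{R};\mathbb{R})$ the functions $f\circ\rho_K$ and $(f'\circ\rho_K)\,\sin_K(\rho_K)\cot\alpha_1\cot\alpha_2$ are $\mu_K$-integrable on $\mathcal{G}^K_D$, and $$\int_{\mathcal{G}^K_D}(f\circ\rho_K)\,d\mu_K=\int_{\mathcal{G}^K_D}(f'\circ\rho_K)\,\sin_K(\rho_K)\cot\alpha_1\cot\alpha_2\,d\mu_K+\sum_{i=1}^n\int_0^{|a_i|}f(x)\,dx .$$ -/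

import Mathlib

noncomputable section

namespace ConstCurv

/-- The generalized sine `sin_K`. -/
def sinK (K x : ℝ) : ℝ :=
  if 0 < K then Real.sin (Real.sqrt K * x) / Real.sqrt K
  else if K = 0 then x
  else Real.sinh (Real.sqrt (-K) * x) / Real.sqrt (-K)

/-- The generalized cosine, the derivative of `sin_K`. -/
def cosK (K x : ℝ) : ℝ :=
  if 0 < K then Real.cos (Real.sqrt K * x)
  else if K = 0 then 1
  else Real.cosh (Real.sqrt (-K) * x)

theorem cosK_sq_add (K x : ℝ) : cosK K x ^ 2 + K * sinK K x ^ 2 = 1 := by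
  unfold cosK sinK
  split_ifs with h1 h2
  · rw [div_pow, Real.sq_sqrt h1.le, mul_div_cancel₀ _ h1.ne']
    exact Real.cos_sq_add_sin_sq _
  · simp [h2]
  · have h3 : 0 < -K := by
      rcases lt_trichotomy K 0 with h | h | h
      · linarith
      · exact absurd h h2
      · exact absurd h h1
    rw [div_pow, Real.sq_sqrt h3.le]
    have h4 : K * (Real.sinh (Real.sqrt (-K) * x) ^ 2 / -K)
        = - Real.sinh (Real.sqrt (-K) * x) ^ 2 := by
      field_simp
    rw [h4]
    linarith [Real.cosh_sq (Real.sqrt (-K) * x)]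

theorem cosK_pos {K : ℝ} (hK : K ≤ 0) (x : ℝ) : 0 < cosK K x := by
  unfold cosK
  rw [if_neg (not_lt.mpr hK)]
  split_ifs
  · exact one_pos
  · exact Real.cosh_pos _

/-- The model plane `X_K` of constant curvature `K`, with coordinates `p = (t, x, y)`:
the surface `t² + K (x² + y²) = 1` (with `t > 0` if `K ≤ 0`) carrying the Riemannian metric
`dx² + dy² + dt² / K`. For `K > 0` the map `p ↦ (t / √K, x, y)` identifies it with the round sphere
of radius `1 / √K`; for `K = 0` it is the Euclidean plane `t = 1`, with metric `dx² + dy²`;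
for `K < 0` it is the hyperboloid model of the hyperbolic plane of curvature `K`. -/
def Plane (K : ℝ) : Type :=
  {p : Fin 3 → ℝ // p 0 ^ 2 + K * (p 1 ^ 2 + p 2 ^ 2) = 1 ∧ (K ≤ 0 → 0 < p 0)}

instance (K : ℝ) : TopologicalSpace (Plane K) :=
  inferInstanceAs (TopologicalSpace
    {p : Fin 3 → ℝ // p 0 ^ 2 + K * (p 1 ^ 2 + p 2 ^ 2) = 1 ∧ (K ≤ 0 → 0 < p 0)})

/-- Unit tangent vectors of `X_K`. The field `tangent` says that `vec` is tangent to the surface at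
`pt`, and `unit` that it has length one for the metric `dx² + dy² + dt² / K` (for `K = 0` tangency
forces `vec 0 = 0`, so the last term vanishes). -/
structure UnitTangent (K : ℝ) where
  pt : Plane K
  vec : Fin 3 → ℝ
  tangent : pt.1 0 * vec 0 + K * (pt.1 1 * vec 1 + pt.1 2 * vec 2) = 0
  unit : vec 1 ^ 2 + vec 2 ^ 2 + vec 0 ^ 2 / K = 1

namespace UnitTangent

variable {K : ℝ}

theorem vec_zero_of_flat (T : UnitTangent K) (hK : K = 0) : T.vec 0 = 0 := by
  subst hK
  have h := T.tangent
  have hp := T.pt.2.2 le_rfl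
  rw [zero_mul, add_zero] at h
  exact (mul_eq_zero.mp h).resolve_left hp.ne'

/-- The unit condition without division. -/
theorem unit' (T : UnitTangent K) :
    K * (T.vec 1 ^ 2 + T.vec 2 ^ 2) + T.vec 0 ^ 2 = K := by
  by_cases hK : K = 0
  · simp [T.vec_zero_of_flat hK, hK]
  · have h := T.unit
    field_simp at h
    linarith

theorem flat_unit (T : UnitTangent K) (hK : K = 0) : T.vec 1 ^ 2 + T.vec 2 ^ 2 = 1 := by
  have h := T.unit
  simpa [T.vec_zero_of_flat hK] using h

theorem geod_mem (T : UnitTangent K) (s : ℝ) :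
    (cosK K s • T.pt.1 + sinK K s • T.vec) 0 ^ 2
      + K * ((cosK K s • T.pt.1 + sinK K s • T.vec) 1 ^ 2
        + (cosK K s • T.pt.1 + sinK K s • T.vec) 2 ^ 2) = 1 ∧
    (K ≤ 0 → 0 < (cosK K s • T.pt.1 + sinK K s • T.vec) 0) := by
  have h1 := T.pt.2.1
  have h2 := T.tangent
  have h3 := T.unit'
  have h4 := cosK_sq_add K s
  constructor
  · simp only [Pi.add_apply, Pi.smul_apply, smul_eq_mul]
    linear_combination (cosK K s ^ 2) * h1 + (2 * cosK K s * sinK K s) * h2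
      + (sinK K s ^ 2) * h3 + h4
  · intro hK
    have hc := cosK_pos hK s
    have hp := T.pt.2.2 hK
    simp only [Pi.add_apply, Pi.smul_apply, smul_eq_mul]
    set c := cosK K s
    set S := sinK K s
    set t := T.pt.1 0
    set x := T.pt.1 1
    set y := T.pt.1 2
    set a := T.vec 0
    set u := T.vec 1
    set v := T.vec 2
    have h5 : a ^ 2 ≤ (-K) * (t ^ 2 - 1) := by
      have e1 : (t * a) ^ 2 = (K * (x * u + y * v)) ^ 2 := by
        have : t * a = -(K * (x * u + y * v)) := by linarith
        rw [this]; ring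
      have e2 : K ^ 2 * ((x ^ 2 + y ^ 2) * (u ^ 2 + v ^ 2))
          = (K * (x ^ 2 + y ^ 2)) * (K * (u ^ 2 + v ^ 2)) := by ring
      have e3 : K * (x ^ 2 + y ^ 2) = 1 - t ^ 2 := by linarith
      have e4 : K * (u ^ 2 + v ^ 2) = K - a ^ 2 := by linarith
      rw [e3, e4] at e2
      nlinarith [mul_nonneg (sq_nonneg K) (sq_nonneg (x * v - y * u))]
    have h6 : (S * a) ^ 2 < (c * t) ^ 2 := by
      have g1 : S ^ 2 * a ^ 2 ≤ S ^ 2 * ((-K) * (t ^ 2 - 1)) :=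
        mul_le_mul_of_nonneg_left h5 (sq_nonneg S)
      have g2 : S ^ 2 * ((-K) * (t ^ 2 - 1)) = (c ^ 2 - 1) * (t ^ 2 - 1) := by
        have : (-K) * S ^ 2 = c ^ 2 - 1 := by linarith
        calc _ = ((-K) * S ^ 2) * (t ^ 2 - 1) := by ring
          _ = _ := by rw [this]
      have g3 : 0 ≤ (-K) * S ^ 2 := mul_nonneg (by linarith) (sq_nonneg S)
      have g4 : 0 ≤ (-K) * (x ^ 2 + y ^ 2) := mul_nonneg (by linarith) (by positivity)
      nlinarith
    have h7 := abs_lt_of_sq_lt_sq h6 (by positivity)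
    linarith [(abs_lt.mp h7).1]

/-- The unit speed geodesic with initial unit tangent vector `T`. -/
def geod (T : UnitTangent K) (s : ℝ) : Plane K :=
  ⟨cosK K s • T.pt.1 + sinK K s • T.vec, T.geod_mem s⟩

/-- The unit tangent vector at time `s` of the geodesic with initial unit tangent vector `T`. -/
def flow (T : UnitTangent K) (s : ℝ) : UnitTangent K where
  pt := T.geod s
  vec := (-K * sinK K s) • T.pt.1 + cosK K s • T.vec
  tangent := by
    simp only [geod, Pi.add_apply, Pi.smul_apply, smul_eq_mul]
    linear_combination (-K * sinK K s * cosK K s) * T.pt.2.1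
      + (cosK K s ^ 2 - K * sinK K s ^ 2) * T.tangent + (cosK K s * sinK K s) * T.unit'
  unit := by
    simp only [Pi.add_apply, Pi.smul_apply, smul_eq_mul]
    by_cases hK : K = 0
    · have h := cosK_sq_add K s
      have h' := T.flat_unit hK
      simp only [T.vec_zero_of_flat hK]
      simp only [hK] at h ⊢
      simp only [zero_mul, neg_zero, add_zero, zero_add, mul_zero, div_zero] at h ⊢
      linear_combination (cosK 0 s ^ 2) * h' + h
    · field_simp
      linear_combination (K ^ 2 * sinK K s ^ 2) * T.pt.2.1
        - (2 * K * sinK K s * cosK K s) * T.tangent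
        + (cosK K s ^ 2) * T.unit' + K * cosK_sq_add K s

/-- The unit tangent vector obtained from `T` by the rotation of angle `π / 2` of the oriented
tangent plane. -/
def normalVec (T : UnitTangent K) : Fin 3 → ℝ :=
  ![K * (T.pt.1 1 * T.vec 2 - T.pt.1 2 * T.vec 1),
    T.pt.1 2 * T.vec 0 - T.pt.1 0 * T.vec 2,
    T.pt.1 0 * T.vec 1 - T.pt.1 1 * T.vec 0]

/-- The unit tangent vector `cos θ • T + sin θ • N`, where `N` is the unit normal to `T`: it points
to the left side of the geodesic directed by `T` if `0 < θ < π`. -/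
def rotate (T : UnitTangent K) (θ : ℝ) : UnitTangent K where
  pt := T.pt
  vec := Real.cos θ • T.vec + Real.sin θ • T.normalVec
  tangent := by
    simp only [normalVec, Pi.add_apply, Pi.smul_apply, smul_eq_mul, Matrix.cons_val_zero,
      Matrix.cons_val_one, Matrix.cons_val]
    linear_combination (Real.cos θ) * T.tangent
  unit := by
    simp only [normalVec, Pi.add_apply, Pi.smul_apply, smul_eq_mul, Matrix.cons_val_zero,
      Matrix.cons_val_one, Matrix.cons_val]
    have hθ := Real.cos_sq_add_sin_sq θ
    by_cases hK : K = 0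
    · have h := T.flat_unit hK
      have h1 := T.pt.2.1
      simp only [T.vec_zero_of_flat hK]
      simp only [hK, zero_mul, mul_zero, add_zero, div_zero, zero_sub, sub_zero] at h1 ⊢
      linear_combination (Real.cos θ ^ 2 + Real.sin θ ^ 2 * T.pt.1 0 ^ 2) * h
        + (Real.sin θ ^ 2) * h1 + hθ
    · field_simp
      have h1 := T.pt.2.1
      have h2 := T.tangent
      have h3 := T.unit'
      set t := T.pt.1 0
      set x := T.pt.1 1
      set y := T.pt.1 2
      set a := T.vec 0
      set u := T.vec 1
      set v := T.vec 2
      have hN : K * ((y * a - t * v) ^ 2 + (t * u - x * a) ^ 2)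
          + (K * (x * v - y * u)) ^ 2 = K := by
        linear_combination (K * (u ^ 2 + v ^ 2) + a ^ 2) * h1 + h3
          - (t * a + K * (x * u + y * v)) * h2
      linear_combination (Real.cos θ ^ 2) * h3 + (Real.sin θ ^ 2) * hN + K * hθ

end UnitTangent

/-- The geodesic with polar coordinates `q = (w, η)`, oriented and parametrized by arc length: it
passes through the point at distance `w` in the direction `η` from the origin `(1, 0, 0)`, and is
orthogonal there to the geodesic coming from the origin. -/
def polarGeodesic (K : ℝ) (q : ℝ × ℝ) : UnitTangent K where
  pt := ⟨![cosK K q.1, sinK K q.1 * Real.cos q.2, sinK K q.1 * Real.sin q.2], by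
    constructor
    · simp only [Matrix.cons_val_zero, Matrix.cons_val_one, Matrix.cons_val]
      linear_combination cosK_sq_add K q.1
        + (K * sinK K q.1 ^ 2) * Real.cos_sq_add_sin_sq q.2
    · intro hK
      simpa using cosK_pos hK q.1⟩
  vec := ![0, -Real.sin q.2, Real.cos q.2]
  tangent := by
    simp only [Matrix.cons_val_zero, Matrix.cons_val_one, Matrix.cons_val]
    ring
  unit := by
    simp only [Matrix.cons_val_zero, Matrix.cons_val_one, Matrix.cons_val]
    linear_combination Real.cos_sq_add_sin_sq q.2

/-- The range of the polar coordinates `(w, η)` on the set of (unoriented) geodesics: the distance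
`w` from the origin to the geodesic satisfies `0 ≤ w`, and `w ≤ π / (2 √K)` if `K > 0`. Every
geodesic has polar coordinates in this set, and they are unique except for the null set `w = 0` and
(if `K > 0`) `w = π / (2 √K)`. -/
def polarDomain (K : ℝ) : Set (ℝ × ℝ) :=
  {q | 0 ≤ q.1 ∧ (0 < K → q.1 ≤ Real.pi / (2 * Real.sqrt K)) ∧ 0 ≤ q.2 ∧ q.2 < 2 * Real.pi}

/-- The isometry invariant measure `μ_K` on the set of geodesics of `X_K`, normalized so that
`dμ_K = sin α dl dα` for geodesics meeting a given geodesic at arc length `l` and with angle `α`;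
in polar coordinates, `dμ_K = (sin_K)'(w) dw dη`. -/
def geodesicMeasure (K : ℝ) : MeasureTheory.Measure (ℝ × ℝ) :=
  (MeasureTheory.volume.restrict (polarDomain K)).withDensity
    (fun q => ENNReal.ofReal (cosK K q.1))

variable {K : ℝ}

/-- The set of geodesics, in polar coordinates, that intersect `D`. -/
def geodesicsMeeting (D : Set (Plane K)) : Set (ℝ × ℝ) :=
  {q | ∃ s : ℝ, (polarGeodesic K q).geod s ∈ D}

/-- An interval on which a unit speed geodesic runs through its image exactly once. -/
def onePeriod (K : ℝ) : Set ℝ :=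
  if 0 < K then Set.Ioc (-(Real.pi / Real.sqrt K)) (Real.pi / Real.sqrt K) else Set.univ

/-- The length of the chord cut out by `D` on the geodesic directed by `T`. -/
def chordLength (D : Set (Plane K)) (T : UnitTangent K) : ℝ :=
  (MeasureTheory.volume {s : ℝ | s ∈ onePeriod K ∧ T.geod s ∈ D}).toReal

open Filter Topology in
/-- `T` is based at a point of `D` at which the geodesic directed by `T` enters `D`. -/
def IsEntry (D : Set (Plane K)) (T : UnitTangent K) : Prop :=
  T.pt ∈ D ∧ ∀ᶠ r in 𝓝[>] (0 : ℝ), T.geod (-r) ∉ D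

open Filter Topology in
/-- The unit tangent vector `T` is tangent to a geodesic piece of the boundary of `D` that starts
at the base point of `T`. -/
def IsBoundaryDirection (D : Set (Plane K)) (T : UnitTangent K) : Prop :=
  ∀ᶠ r in 𝓝[>] (0 : ℝ), T.geod r ∈ frontier D

/-- The angle, on the left side of the geodesic directed by `T`, between the chord of this geodesic
and the boundary of `D`, at the point where the chord starts. The set below has exactly one element
if the geodesic passes through the interior of a convex geodesic polygon `D`. -/
def startAngle (D : Set (Plane K)) (T : UnitTangent K) : ℝ :=
  sSup {α : ℝ | 0 < α ∧ α < Real.pi ∧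
    ∃ s : ℝ, IsEntry D (T.flow s) ∧ IsBoundaryDirection D ((T.flow s).rotate α)}

/-- The angle, on the left side of the geodesic directed by `T`, between the chord of this geodesic
and the boundary of `D`, at the point where the chord ends. With the inward direction
`(T.flow s).rotate π` of the chord at this point, the left side of `T` corresponds to negative
rotations. -/
def endAngle (D : Set (Plane K)) (T : UnitTangent K) : ℝ :=
  sSup {α : ℝ | 0 < α ∧ α < Real.pi ∧
    ∃ s : ℝ, IsEntry D ((T.flow s).rotate Real.pi) ∧
      IsBoundaryDirection D ((T.flow s).rotate (Real.pi - α))}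

/-- The Riemannian distance: the least length of a geodesic segment from `p` to `q`. -/
def geodDist (p q : Plane K) : ℝ :=
  sInf {l : ℝ | 0 ≤ l ∧ ∃ T : UnitTangent K, T.pt = p ∧ T.geod l = q}

/-- Any two points of `D` are joined by a shortest geodesic segment that lies in `D`. -/
def GeodesicallyConvex (D : Set (Plane K)) : Prop :=
  ∀ p ∈ D, ∀ q ∈ D, ∃ T : UnitTangent K, T.pt = p ∧ T.geod (geodDist p q) = q ∧
    ∀ s ∈ Set.Icc 0 (geodDist p q), T.geod s ∈ D

/-- The boundary of `D` is a simple closed geodesic polygon: its edges are the geodesic segments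
`(a i).geod '' [0, len i]`, in cyclic order, and consecutive edges lie on different geodesics
(so every vertex is a true corner). -/
structure HasPolygonBoundary (D : Set (Plane K)) {n : ℕ} [NeZero n]
    (a : Fin n → UnitTangent K) (len : Fin n → ℝ) : Prop where
  len_pos : ∀ i, 0 < len i
  closed : ∀ i, (a i).geod (len i) = (a (i + 1)).pt
  simple : ∀ i j, ∀ s ∈ Set.Ico 0 (len i), ∀ t ∈ Set.Ico 0 (len j),
    (a i).geod s = (a j).geod t → i = j ∧ s = t
  corner : ∀ i, Set.range (a i).geod ≠ Set.range (a (i + 1)).geod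
  frontier_eq : frontier D = ⋃ i, (a i).geod '' Set.Icc 0 (len i)

end ConstCurv

end

/-! ### Generalized trigonometry -/

noncomputable section

namespace ConstCurv

open Real

/-! Up to a null set, every geodesic meeting `D` crosses exactly two edges, each in its interior. On
the geodesics crossing edges `i` and `j`, take as coordinates the arc-length positions `(s, t)` of
the two crossing points, and let `ρ(s, t)` be their distance. By the first variation formula, `ρ_s`
and `ρ_t` are, up to sign, the cosines of the crossing angles. A further differentiation gives `ρ_st
= sin α₁ sin α₂ / sin_K ρ > 0`. The invariant measure in these coordinates is exactly `ρ_st ds dt`,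
and `sin_K(ρ) cot α₁ cot α₂ = -ρ_s ρ_t / ρ_st`.

Hence, if `F` is the primitive of `f` with `F(0) = 0`, the difference of the two integrals over such
geodesics is the integral of `f(ρ) ρ_st + f'(ρ) ρ_s ρ_t = ∂_s ∂_t (F ∘ ρ)` over a rectangle. This is
an alternating sum of `H(v, w) = F(dist(v, w))` over endpoints of the two edges
(`integral_mixed_derivative`). The sum over all ordered pairs `(i, j)` vanishes by cyclic shift,
while each diagonal term is `-2 H(i, i + 1)`. By symmetry the pairs `i < j` contribute `∑ H(i, i +
1)`, which is the edge term (`sum_mixed_difference`).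

The change of measure is done by writing geodesics as planes `t = A x + B y`. In this affine chart
the invariant measure is `(A² + B² + K)^(-3/2) dA dB`; both polar coordinates
(`chartDensity_polarChart`) and crossing positions (`Joins.chartDensity_pairChart`) are compared
with it.

The convex geometry is linear algebra in `ℝ³`: geodesics are sections of the surface by planes
through the origin, and the cone over a geodesically convex set is closed under nonnegative
combinations (`GeodesicallyConvex.cone_mem`). It follows that the geodesic of each edge supports
`D`, that all edges have `D` on the same side, and that a chord meets the open edges only at its
ends. -/

theorem neg_pos_of_not_pos {K : ℝ} (h1 : ¬ 0 < K) (h2 : ¬ K = 0) : 0 < -K := by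
  rcases lt_trichotomy K 0 with h | h | h
  · linarith
  · exact absurd h h2
  · exact absurd h h1

@[simp] theorem sinK_zero (K : ℝ) : sinK K 0 = 0 := by simp [sinK]

@[simp] theorem cosK_zero (K : ℝ) : cosK K 0 = 1 := by simp [cosK]

theorem sinK_neg (K x : ℝ) : sinK K (-x) = -sinK K x := by
  unfold sinK; split_ifs <;> simp [neg_div]

theorem cosK_neg (K x : ℝ) : cosK K (-x) = cosK K x := by
  unfold cosK; split_ifs <;> simp

theorem sinK_add (K x y : ℝ) : sinK K (x + y) = sinK K x * cosK K y + cosK K x * sinK K y := by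
  unfold sinK cosK
  split_ifs with h1 h2
  · rw [mul_add, Real.sin_add]; ring
  · ring
  · rw [mul_add, Real.sinh_add]; ring

theorem cosK_add (K x y : ℝ) :
    cosK K (x + y) = cosK K x * cosK K y - K * (sinK K x * sinK K y) := by
  unfold sinK cosK
  split_ifs with h1 h2
  · rw [mul_add, Real.cos_add]
    have := Real.sq_sqrt h1.le
    have h0 : √K ≠ 0 := (Real.sqrt_pos.2 h1).ne'
    field_simp
    rw [this]; ring
  · simp [h2]
  · have h3 := neg_pos_of_not_pos h1 h2
    rw [mul_add, Real.cosh_add]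
    have := Real.sq_sqrt h3.le
    have h0 : √(-K) ≠ 0 := (Real.sqrt_pos.2 h3).ne'
    field_simp
    rw [this]; ring

theorem sinK_sub (K x y : ℝ) : sinK K (x - y) = sinK K x * cosK K y - cosK K x * sinK K y := by
  rw [sub_eq_add_neg, sinK_add, sinK_neg, cosK_neg]; ring

theorem cosK_sub (K x y : ℝ) :
    cosK K (x - y) = cosK K x * cosK K y + K * (sinK K x * sinK K y) := by
  rw [sub_eq_add_neg, cosK_add, sinK_neg, cosK_neg]; ring

theorem hasDerivAt_sinK (K x : ℝ) : HasDerivAt (sinK K) (cosK K x) x := by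
  by_cases h1 : 0 < K
  · have e : sinK K = fun x => Real.sin (√K * x) / √K := by funext x; simp [sinK, h1]
    rw [e]
    have h0 : √K ≠ 0 := (Real.sqrt_pos.2 h1).ne'
    have := (((hasDerivAt_id x).const_mul √K).sin).div_const √K
    refine this.congr_deriv ?_
    simp [cosK, h1, h0]
  · by_cases h2 : K = 0
    · have e : sinK K = fun x => x := by funext x; simp [sinK, h2]
      rw [e]
      simpa [cosK, h2] using hasDerivAt_id' x
    · have e : sinK K = fun x => Real.sinh (√(-K) * x) / √(-K) := by
        funext x; simp [sinK, h1, h2]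
      rw [e]
      have h0 : √(-K) ≠ 0 := (Real.sqrt_pos.2 (neg_pos_of_not_pos h1 h2)).ne'
      have := (((hasDerivAt_id x).const_mul √(-K)).sinh).div_const √(-K)
      refine this.congr_deriv ?_
      simp [cosK, h1, h2, h0]

theorem hasDerivAt_cosK (K x : ℝ) : HasDerivAt (cosK K) (-K * sinK K x) x := by
  by_cases h1 : 0 < K
  · have e : cosK K = fun x => Real.cos (√K * x) := by funext x; simp [cosK, h1]
    rw [e]
    have h0 : √K ≠ 0 := (Real.sqrt_pos.2 h1).ne'
    have := ((hasDerivAt_id x).const_mul √K).cos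
    refine this.congr_deriv ?_
    have h3 := Real.sq_sqrt h1.le
    simp only [sinK, h1, if_true, id]
    field_simp
    rw [h3]
    ring
  · by_cases h2 : K = 0
    · have e : cosK K = fun x => 1 := by funext x; simp [cosK, h2]
      rw [e]
      simpa [h2] using hasDerivAt_const x (1 : ℝ)
    · have e : cosK K = fun x => Real.cosh (√(-K) * x) := by
        funext x; simp [cosK, h1, h2]
      rw [e]
      have h3 := neg_pos_of_not_pos h1 h2
      have h0 : √(-K) ≠ 0 := (Real.sqrt_pos.2 h3).ne'
      have := ((hasDerivAt_id x).const_mul √(-K)).cosh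
      refine this.congr_deriv ?_
      have h3 := Real.sq_sqrt h3.le
      simp only [sinK, h1, h2, if_false, id]
      field_simp
      rw [h3]
      ring

theorem continuous_sinK (K : ℝ) : Continuous (sinK K) :=
  continuous_iff_continuousAt.2 fun x => (hasDerivAt_sinK K x).continuousAt

theorem continuous_cosK (K : ℝ) : Continuous (cosK K) :=
  continuous_iff_continuousAt.2 fun x => (hasDerivAt_cosK K x).continuousAt

theorem sinK_pos {K x : ℝ} (hx : 0 < x) (h : 0 < K → x < π / √K) : 0 < sinK K x := by
  unfold sinK
  split_ifs with h1 h2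
  · have h0 := Real.sqrt_pos.2 h1
    apply div_pos _ h0
    apply Real.sin_pos_of_pos_of_lt_pi (by positivity)
    have := h h1
    rw [lt_div_iff₀ h0] at this
    linarith
  · exact hx
  · have h0 := Real.sqrt_pos.2 (neg_pos_of_not_pos h1 h2)
    exact div_pos (Real.sinh_pos_iff.2 (by positivity)) h0

theorem sinK_pi {K : ℝ} (hK : 0 < K) : sinK K (π / √K) = 0 := by
  have h0 : √K ≠ 0 := (Real.sqrt_pos.2 hK).ne'
  simp [sinK, hK, mul_div_cancel₀ _ h0]

theorem cosK_pi {K : ℝ} (hK : 0 < K) : cosK K (π / √K) = -1 := by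
  have h0 : √K ≠ 0 := (Real.sqrt_pos.2 hK).ne'
  simp [cosK, hK, mul_div_cancel₀ _ h0]

theorem pi_div_sqrt_pos {K : ℝ} (hK : 0 < K) : 0 < π / √K :=
  div_pos Real.pi_pos (Real.sqrt_pos.2 hK)

theorem sinK_nonneg {K x : ℝ} (hx : 0 ≤ x) (h : 0 < K → x ≤ π / √K) : 0 ≤ sinK K x := by
  rcases hx.eq_or_lt with rfl | hx
  · simp
  · by_cases hK : 0 < K
    · rcases (h hK).eq_or_lt with h | h
      · rw [h, sinK_pi hK]
      · exact (sinK_pos hx fun _ => h).le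
    · exact (sinK_pos hx fun h => absurd h hK).le

theorem cosK_pos_of_lt {K x : ℝ} (hx : 0 ≤ x) (h : 0 < K → x < π / (2 * √K)) :
    0 < cosK K x := by
  by_cases hK : 0 < K
  · have h0 := Real.sqrt_pos.2 hK
    have := h hK
    simp only [cosK, hK, if_true]
    apply Real.cos_pos_of_mem_Ioo
    rw [lt_div_iff₀ (by positivity)] at this
    constructor
    · have : 0 ≤ √K * x := by positivity
      linarith [Real.pi_pos]
    · linarith
  · exact cosK_pos (not_lt.1 hK) x

theorem sinK_add_two_pi {K : ℝ} (hK : 0 < K) (x : ℝ) :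
    sinK K (x + 2 * (π / √K)) = sinK K x := by
  rw [two_mul, ← add_assoc, sinK_add, sinK_add, cosK_add, sinK_pi hK, cosK_pi hK]; ring

theorem cosK_add_two_pi {K : ℝ} (hK : 0 < K) (x : ℝ) :
    cosK K (x + 2 * (π / √K)) = cosK K x := by
  rw [two_mul, ← add_assoc, cosK_add, cosK_add, sinK_add, sinK_pi hK, cosK_pi hK]; ring

/-- The inverse of `sinK` on `[0, π / (2 √K)]`. -/
def arcsinK (K x : ℝ) : ℝ :=
  if 0 < K then Real.arcsin (√K * x) / √K
  else if K = 0 then x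
  else Real.arsinh (√(-K) * x) / √(-K)

theorem continuous_arcsinK (K : ℝ) : Continuous (arcsinK K) := by
  unfold arcsinK
  split_ifs
  · exact (Real.continuous_arcsin.comp (continuous_const.mul continuous_id)).div_const _
  · exact continuous_id
  · exact (Real.continuous_arsinh.comp (continuous_const.mul continuous_id)).div_const _

theorem arcsinK_sinK {K x : ℝ} (hx : 0 ≤ x) (h : 0 < K → x ≤ π / (2 * √K)) :
    arcsinK K (sinK K x) = x := by
  unfold arcsinK sinK
  split_ifs with h1 h2
  · have h0 := Real.sqrt_pos.2 h1
    have h3 := h h1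
    rw [le_div_iff₀ (by positivity)] at h3
    have : 0 ≤ √K * x := by positivity
    rw [mul_div_cancel₀ _ h0.ne', Real.arcsin_sin (by linarith [Real.pi_pos]) (by linarith),
      mul_div_cancel_left₀ _ h0.ne']
  · rfl
  · have h0 := Real.sqrt_pos.2 (neg_pos_of_not_pos h1 h2)
    rw [mul_div_cancel₀ _ h0.ne', Real.arsinh_sinh, mul_div_cancel_left₀ _ h0.ne']

/-- The condition `K * x ^ 2 < 1` says that `x` is below the maximum `1 / √K` of `sinK` when `K >
0`, and is automatic otherwise. -/
theorem exists_sinK_eq {K x : ℝ} (hx : 0 < x) (h : K * x ^ 2 < 1) :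
    0 < arcsinK K x ∧ (0 < K → arcsinK K x < π / (2 * √K)) ∧ sinK K (arcsinK K x) = x := by
  unfold arcsinK sinK
  split_ifs with h1 h2
  · have h0 := Real.sqrt_pos.2 h1
    have h3 : √K * x < 1 := by
      have : (√K * x) ^ 2 < 1 := by rw [mul_pow, Real.sq_sqrt h1.le]; exact h
      nlinarith
    have h4 : 0 < √K * x := by positivity
    refine ⟨div_pos (Real.arcsin_pos.2 h4) h0, fun _ => ?_, ?_⟩
    · rw [div_lt_div_iff₀ h0 (by positivity)]
      have := Real.arcsin_lt_pi_div_two.2 h3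
      nlinarith
    · rw [mul_div_cancel₀ _ h0.ne', Real.sin_arcsin (by linarith) h3.le,
        mul_div_cancel_left₀ _ h0.ne']
  · exact ⟨hx, fun h => absurd h h1, rfl⟩
  · have h0 := Real.sqrt_pos.2 (neg_pos_of_not_pos h1 h2)
    refine ⟨div_pos (Real.arsinh_pos_iff.2 (by positivity)) h0, fun h => absurd h h1, ?_⟩
    rw [mul_div_cancel₀ _ h0.ne', Real.sinh_arsinh, mul_div_cancel_left₀ _ h0.ne']

theorem cosK_arcsinK {K x : ℝ} (hx : 0 < x) (h : K * x ^ 2 < 1) :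
    cosK K (arcsinK K x) = √(1 - K * x ^ 2) := by
  obtain ⟨h1, h2, h3⟩ := exists_sinK_eq hx h
  have h4 := cosK_sq_add K (arcsinK K x)
  rw [h3] at h4
  rw [show 1 - K * x ^ 2 = cosK K (arcsinK K x) ^ 2 by linarith,
    Real.sqrt_sq (cosK_pos_of_lt h1.le h2).le]

theorem hasDerivAt_arcsinK {K x : ℝ} (hx : 0 < x) (h : K * x ^ 2 < 1) :
    HasDerivAt (arcsinK K) (1 / cosK K (arcsinK K x)) x := by
  rw [cosK_arcsinK hx h]
  by_cases h1 : 0 < K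
  · have h0 := Real.sqrt_pos.2 h1
    have h5 : (√K * x) ^ 2 < 1 := by rw [mul_pow, Real.sq_sqrt h1.le]; exact h
    have h4 : 0 < √K * x := by positivity
    have e : arcsinK K = fun x => Real.arcsin (√K * x) / √K := by
      funext x; simp [arcsinK, h1]
    rw [e]
    have h3 : √K * x < 1 := by nlinarith
    have := ((Real.hasDerivAt_arcsin (by linarith : √K * x ≠ -1) h3.ne).comp x
      ((hasDerivAt_id x).const_mul √K)).div_const √K
    refine this.congr_deriv ?_
    rw [mul_pow, Real.sq_sqrt h1.le]
    field_simp
  · by_cases h2 : K = 0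
    · have e : arcsinK K = fun x => x := by funext x; simp [arcsinK, h2]
      rw [e]
      simpa [h2] using hasDerivAt_id' x
    · have e : arcsinK K = fun x => Real.arsinh (√(-K) * x) / √(-K) := by
        funext x; simp [arcsinK, h1, h2]
      rw [e]
      have h3 := neg_pos_of_not_pos h1 h2
      have h0 := Real.sqrt_pos.2 h3
      have := ((Real.hasDerivAt_arsinh (√(-K) * x)).comp x
        ((hasDerivAt_id x).const_mul √(-K))).div_const √(-K)
      refine this.congr_deriv ?_
      rw [mul_pow, Real.sq_sqrt h3.le]
      rw [show 1 - K * x ^ 2 = 1 + -K * x ^ 2 by ring]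
      field_simp

theorem sinK_two_mul (K x : ℝ) : sinK K (2 * x) = 2 * sinK K x * cosK K x := by
  rw [two_mul, sinK_add]; ring

theorem one_sub_cosK_two_mul (K x : ℝ) : 1 - cosK K (2 * x) = 2 * K * sinK K x ^ 2 := by
  rw [two_mul, cosK_add]
  linear_combination (-1) * cosK_sq_add K x

/-- `(cosK, sinK)` parametrizes the conic `α² + K β² = 1`: by the complex argument if `K > 0`, and
by `arsinh` on the branch `α > 0` if `K < 0`. -/
theorem exists_cosK_sinK {K α β : ℝ} (h : α ^ 2 + K * β ^ 2 = 1) (hα : K ≤ 0 → 0 < α) :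
    ∃ s, cosK K s = α ∧ sinK K s = β := by
  by_cases h1 : 0 < K
  · have h0 := Real.sqrt_pos.2 h1
    have hz : ‖(⟨α, √K * β⟩ : ℂ)‖ = 1 := by
      rw [Complex.norm_def, Complex.normSq_mk, Real.sqrt_eq_one]
      have := Real.sq_sqrt h1.le
      linear_combination h + β ^ 2 * this
    have hne : (⟨α, √K * β⟩ : ℂ) ≠ 0 := by
      intro h; rw [h] at hz; simp at hz
    refine ⟨Complex.arg ⟨α, √K * β⟩ / √K, ?_, ?_⟩
    · simp only [cosK, h1, if_true, mul_div_cancel₀ _ h0.ne']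
      rw [Complex.cos_arg hne, hz]; simp
    · simp only [sinK, h1, if_true, mul_div_cancel₀ _ h0.ne']
      rw [Complex.sin_arg, hz]; simp [mul_div_cancel_left₀ _ h0.ne']
  · have hα := hα (not_lt.1 h1)
    by_cases h2 : K = 0
    · refine ⟨β, ?_, by simp [sinK, h2]⟩
      simp only [h2, zero_mul, add_zero] at h
      have : α = 1 := by nlinarith
      simp [cosK, h2, this]
    · have h0 := Real.sqrt_pos.2 (neg_pos_of_not_pos h1 h2)
      have e : sinK K (Real.arsinh (√(-K) * β) / √(-K)) = β := by
        simp only [sinK, h1, h2, if_false, mul_div_cancel₀ _ h0.ne', Real.sinh_arsinh]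
        rw [mul_div_cancel_left₀ _ h0.ne']
      refine ⟨Real.arsinh (√(-K) * β) / √(-K), ?_, e⟩
      have h3 := cosK_sq_add K (Real.arsinh (√(-K) * β) / √(-K))
      have h4 := cosK_pos (not_lt.1 h1) (Real.arsinh (√(-K) * β) / √(-K))
      rw [e] at h3
      have : cosK K (Real.arsinh (√(-K) * β) / √(-K)) ^ 2 = α ^ 2 := by linarith
      exact (sq_eq_sq₀ h4.le hα.le).1 this

end ConstCurv

end

/-! ### Linear algebra of geodesics in the ambient space -/

noncomputable section

namespace ConstCurv

open Real

/-- The determinant of three vectors of `ℝ³`. -/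
def det3 (u v w : Fin 3 → ℝ) : ℝ :=
  u 0 * (v 1 * w 2 - v 2 * w 1) + u 1 * (v 2 * w 0 - v 0 * w 2) + u 2 * (v 0 * w 1 - v 1 * w 0)

/-- The bilinear form `dx² + dy² + dt² / K`. -/
def ip (K : ℝ) (u v : Fin 3 → ℝ) : ℝ := u 1 * v 1 + u 2 * v 2 + u 0 * v 0 / K

theorem det3_smul_add_smul (u v x y : Fin 3 → ℝ) (r s : ℝ) :
    det3 u v (r • x + s • y) = r * det3 u v x + s * det3 u v y := by
  simp only [det3, Pi.add_apply, Pi.smul_apply, smul_eq_mul]; ring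

theorem det3_smul (u v x : Fin 3 → ℝ) (r : ℝ) : det3 u v (r • x) = r * det3 u v x := by
  simp only [det3, Pi.smul_apply, smul_eq_mul]; ring

theorem det3_neg (u v x : Fin 3 → ℝ) : det3 u v (-x) = -det3 u v x := by
  simp only [det3, Pi.neg_apply]; ring

theorem det3_swap (u v w : Fin 3 → ℝ) : det3 u v w = -det3 u w v := by
  simp only [det3]; ring

theorem det3_self_left (u v : Fin 3 → ℝ) : det3 u v u = 0 := by
  simp only [det3]; ring

theorem det3_self_right (u v : Fin 3 → ℝ) : det3 u v v = 0 := by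
  simp only [det3]; ring

/-- Cramer's rule. -/
theorem cramer (u v w z : Fin 3 → ℝ) :
    det3 u v w • z = det3 z v w • u + det3 u z w • v + det3 u v z • w := by
  funext k
  fin_cases k <;> simp [det3] <;> ring

theorem continuous_det3 {X : Type*} [TopologicalSpace X] {u v w : X → Fin 3 → ℝ}
    (hu : Continuous u) (hv : Continuous v) (hw : Continuous w) :
    Continuous fun x => det3 (u x) (v x) (w x) := by
  unfold det3; fun_prop

theorem continuous_ip (K : ℝ) {X : Type*} [TopologicalSpace X] {u v : X → Fin 3 → ℝ}
    (hu : Continuous u) (hv : Continuous v) :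
    Continuous fun x => ip K (u x) (v x) := by
  unfold ip; fun_prop

theorem ip_comm (K : ℝ) (u v : Fin 3 → ℝ) : ip K u v = ip K v u := by
  unfold ip; ring

theorem ip_smul_add_smul (K : ℝ) (u x y : Fin 3 → ℝ) (r s : ℝ) :
    ip K u (r • x + s • y) = r * ip K u x + s * ip K u y := by
  simp only [ip, Pi.add_apply, Pi.smul_apply, smul_eq_mul]; ring

theorem ip_smul_add_smul_left (K : ℝ) (u x y : Fin 3 → ℝ) (r s : ℝ) :
    ip K (r • x + s • y) u = r * ip K x u + s * ip K y u := by
  simp only [ip, Pi.add_apply, Pi.smul_apply, smul_eq_mul]; ring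

theorem continuous_plane_val (K : ℝ) : Continuous (fun p : Plane K => p.1) :=
  continuous_subtype_val

theorem Plane.ext {K : ℝ} {p q : Plane K} (h : p.1 = q.1) : p = q := Subtype.ext h

/-- A ray from the origin meets the surface at most once, so points of the surface may be handled
through the rays they span. -/
theorem Plane.smul_eq {K : ℝ} {p q : Plane K} {r : ℝ} (hr : 0 ≤ r) (h : q.1 = r • p.1) :
    q = p := by
  have h1 := q.2.1
  rw [h] at h1
  simp only [Pi.smul_apply, smul_eq_mul] at h1
  have h2 : r ^ 2 = 1 := by linear_combination h1 - r ^ 2 * p.2.1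
  have h3 : r = 1 := by nlinarith
  apply Plane.ext
  rw [h, h3, one_smul]

theorem Plane.ne_zero {K : ℝ} (p : Plane K) : p.1 ≠ 0 := by
  intro h
  have := p.2.1
  rw [h] at this
  simp at this

namespace UnitTangent

variable {K : ℝ}

theorem ext' {T S : UnitTangent K} (h1 : T.pt = S.pt) (h2 : T.vec = S.vec) : T = S := by
  cases T; cases S; simp_all

theorem geod_val (T : UnitTangent K) (s : ℝ) :
    (T.geod s).1 = cosK K s • T.pt.1 + sinK K s • T.vec := rfl

theorem flow_pt (T : UnitTangent K) (s : ℝ) : (T.flow s).pt = T.geod s := rfl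

theorem flow_vec (T : UnitTangent K) (s : ℝ) :
    (T.flow s).vec = (-K * sinK K s) • T.pt.1 + cosK K s • T.vec := rfl

@[simp] theorem geod_zero (T : UnitTangent K) : T.geod 0 = T.pt :=
  Plane.ext (by simp [geod_val])

@[simp] theorem flow_zero (T : UnitTangent K) : T.flow 0 = T :=
  ext' T.geod_zero (by simp [flow_vec])

theorem flow_geod (T : UnitTangent K) (s r : ℝ) : (T.flow s).geod r = T.geod (s + r) := by
  apply Plane.ext
  simp only [geod_val, flow_pt, flow_vec, sinK_add, cosK_add]
  module

theorem flow_flow (T : UnitTangent K) (s r : ℝ) : (T.flow s).flow r = T.flow (s + r) := by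
  apply ext'
  · exact T.flow_geod s r
  · simp only [geod_val, flow_pt, flow_vec, sinK_add, cosK_add]
    module

theorem geod_add_period (T : UnitTangent K) (hK : 0 < K) (s : ℝ) :
    T.geod (s + 2 * (π / √K)) = T.geod s :=
  Plane.ext (by rw [geod_val, geod_val, sinK_add_two_pi hK, cosK_add_two_pi hK])

theorem flow_add_period (T : UnitTangent K) (hK : 0 < K) (s : ℝ) :
    T.flow (s + 2 * (π / √K)) = T.flow s :=
  ext' (T.geod_add_period hK s)
    (by rw [flow_vec, flow_vec, sinK_add_two_pi hK, cosK_add_two_pi hK])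

theorem rotate_pt (T : UnitTangent K) (θ : ℝ) : (T.rotate θ).pt = T.pt := rfl

theorem rotate_vec (T : UnitTangent K) (θ : ℝ) :
    (T.rotate θ).vec = Real.cos θ • T.vec + Real.sin θ • T.normalVec := rfl

theorem reverse_vec (T : UnitTangent K) : (T.rotate π).vec = -T.vec := by
  simp [rotate_vec]

theorem reverse_geod (T : UnitTangent K) (s : ℝ) : (T.rotate π).geod s = T.geod (-s) := by
  apply Plane.ext
  simp only [geod_val, reverse_vec, rotate_pt, sinK_neg, cosK_neg]
  module

theorem reverse_flow_vec (T : UnitTangent K) (s : ℝ) :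
    ((T.rotate π).flow s).vec = -(T.flow (-s)).vec := by
  simp only [flow_vec, reverse_vec, rotate_pt, sinK_neg, cosK_neg]
  module

theorem normalVec_zero (T : UnitTangent K) :
    T.normalVec 0 = K * (T.pt.1 1 * T.vec 2 - T.pt.1 2 * T.vec 1) := rfl

theorem normalVec_one (T : UnitTangent K) :
    T.normalVec 1 = T.pt.1 2 * T.vec 0 - T.pt.1 0 * T.vec 2 := rfl

theorem normalVec_two (T : UnitTangent K) :
    T.normalVec 2 = T.pt.1 0 * T.vec 1 - T.pt.1 1 * T.vec 0 := rfl

theorem flow_normalVec (T : UnitTangent K) (s : ℝ) : (T.flow s).normalVec = T.normalVec := by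
  have h := cosK_sq_add K s
  funext k
  fin_cases k
  · simp only [Fin.zero_eta, normalVec_zero, flow_pt, geod_val, flow_vec, Pi.add_apply,
      Pi.smul_apply, smul_eq_mul]
    linear_combination K * (T.pt.1 1 * T.vec 2 - T.pt.1 2 * T.vec 1) * h
  · simp only [Fin.mk_one, normalVec_one, flow_pt, geod_val, flow_vec, Pi.add_apply,
      Pi.smul_apply, smul_eq_mul]
    linear_combination (T.pt.1 2 * T.vec 0 - T.pt.1 0 * T.vec 2) * h
  · simp only [Fin.reduceFinMk, normalVec_two, flow_pt, geod_val, flow_vec, Pi.add_apply,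
      Pi.smul_apply, smul_eq_mul]
    linear_combination (T.pt.1 0 * T.vec 1 - T.pt.1 1 * T.vec 0) * h

theorem flat_pt (T : UnitTangent K) (hK : K = 0) : T.pt.1 0 = 1 := by
  have h1 := T.pt.2.1
  have h2 := T.pt.2.2 hK.le
  simp only [hK, zero_mul, add_zero] at h1
  nlinarith

theorem normal_unit (T : UnitTangent K) :
    T.normalVec 0 ^ 2 + K * (T.normalVec 1 ^ 2 + T.normalVec 2 ^ 2) = K := by
  have h := (T.rotate (π / 2)).unit'
  simp only [rotate_vec, cos_pi_div_two, sin_pi_div_two, zero_smul, one_smul, zero_add] at h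
  linarith

theorem ip_normal_normal (T : UnitTangent K) : ip K T.normalVec T.normalVec = 1 := by
  have h := (T.rotate (π / 2)).unit
  simp only [rotate_vec, cos_pi_div_two, sin_pi_div_two, zero_smul, one_smul, zero_add] at h
  unfold ip
  linear_combination h

theorem ip_self (T : UnitTangent K) : ip K T.vec T.vec = 1 := by
  have h := T.unit
  unfold ip
  linear_combination h

theorem normal_tangent (T : UnitTangent K) :
    T.pt.1 0 * T.normalVec 0 + K * (T.pt.1 1 * T.normalVec 1 + T.pt.1 2 * T.normalVec 2) = 0 := by
  simp only [normalVec_zero, normalVec_one, normalVec_two]; ring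

theorem normal_vec (T : UnitTangent K) :
    T.vec 0 * T.normalVec 0 + K * (T.vec 1 * T.normalVec 1 + T.vec 2 * T.normalVec 2) = 0 := by
  simp only [normalVec_zero, normalVec_one, normalVec_two]; ring

theorem ip_normal_vec (T : UnitTangent K) : ip K T.normalVec T.vec = 0 := by
  by_cases hK : K = 0
  · simp only [ip, normalVec_one, normalVec_two, T.vec_zero_of_flat hK]
    ring
  · have := T.normal_vec
    unfold ip
    field_simp
    linarith

theorem det3_normal (T : UnitTangent K) : det3 T.pt.1 T.vec T.normalVec = 1 := by
  by_cases hK : K = 0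
  · have h1 := T.flat_pt hK
    have h2 := T.vec_zero_of_flat hK
    have h3 := T.flat_unit hK
    simp only [det3, normalVec_zero, normalVec_one, normalVec_two, h1, h2, hK]
    linear_combination h3
  · have h := T.normal_unit
    have e : K * det3 T.pt.1 T.vec T.normalVec = K := by
      simp only [normalVec_zero, normalVec_one, normalVec_two] at h
      simp only [det3, normalVec_zero, normalVec_one, normalVec_two]
      linear_combination h
    exact mul_left_cancel₀ hK (by linarith)

theorem decomp (T : UnitTangent K) (z : Fin 3 → ℝ) :
    z = det3 z T.vec T.normalVec • T.pt.1 + det3 T.pt.1 z T.normalVec • T.vec +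
      det3 T.pt.1 T.vec z • T.normalVec := by
  have := cramer T.pt.1 T.vec T.normalVec z
  rwa [det3_normal, one_smul] at this

/-- The linear form that vanishes on the geodesic directed by `T`. -/
def form (T : UnitTangent K) (v : Fin 3 → ℝ) : ℝ := det3 T.pt.1 T.vec v

theorem form_smul_add_smul (T : UnitTangent K) (x y : Fin 3 → ℝ) (r s : ℝ) :
    T.form (r • x + s • y) = r * T.form x + s * T.form y := det3_smul_add_smul _ _ _ _ _ _

theorem form_smul (T : UnitTangent K) (x : Fin 3 → ℝ) (r : ℝ) :
    T.form (r • x) = r * T.form x := det3_smul _ _ _ _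

theorem continuous_form (T : UnitTangent K) : Continuous T.form :=
  continuous_det3 continuous_const continuous_const continuous_id

@[simp] theorem form_pt (T : UnitTangent K) : T.form T.pt.1 = 0 := det3_self_left _ _

@[simp] theorem form_vec (T : UnitTangent K) : T.form T.vec = 0 := det3_self_right _ _

@[simp] theorem form_geod (T : UnitTangent K) (s : ℝ) : T.form (T.geod s).1 = 0 := by
  simp [geod_val, form_smul_add_smul]

theorem flow_form (T : UnitTangent K) (s : ℝ) : (T.flow s).form = T.form := by
  funext v
  have h := cosK_sq_add K s
  simp only [form, det3, flow_pt, geod_val, flow_vec, Pi.add_apply, Pi.smul_apply, smul_eq_mul]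
  linear_combination (T.pt.1 0 * (T.vec 1 * v 2 - T.vec 2 * v 1)
    + T.pt.1 1 * (T.vec 2 * v 0 - T.vec 0 * v 2)
    + T.pt.1 2 * (T.vec 0 * v 1 - T.vec 1 * v 0)) * h

/-- The plane spanned by `T.pt` and `T.vec` cuts the surface exactly in the geodesic: the
coordinates of `z` in this basis lie on the conic `α² + K β² = 1`. -/
theorem exists_geod_eq (T : UnitTangent K) {z : Plane K} (h : T.form z.1 = 0) :
    ∃ s, T.geod s = z := by
  have hd := T.decomp z.1
  rw [show det3 T.pt.1 T.vec z.1 = 0 from h, zero_smul, add_zero] at hd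
  set α := det3 z.1 T.vec T.normalVec
  set β := det3 T.pt.1 z.1 T.normalVec
  have hz := z.2.1
  have e : α ^ 2 + K * β ^ 2 = 1 := by
    rw [hd] at hz
    simp only [Pi.add_apply, Pi.smul_apply, smul_eq_mul] at hz
    linear_combination hz - α ^ 2 * T.pt.2.1 - 2 * α * β * T.tangent - β ^ 2 * T.unit'
  -- On the other branch `-z` would lie on the geodesic, but both `z` and the geodesic have positive
  -- `t`-coordinate.
  have hα : K ≤ 0 → 0 < α := by
    intro hK
    by_contra hα
    have hα' : 0 < -α := by
      rcases (not_lt.1 hα).eq_or_lt with h0 | h0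
      · rw [h0] at e; nlinarith [sq_nonneg β]
      · linarith
    obtain ⟨s, hs1, hs2⟩ := exists_cosK_sinK (K := K) (α := -α) (β := -β)
      (by linarith [neg_sq α, neg_sq β]) fun _ => hα'
    have h1 := (T.geod s).2.2 hK
    have h2 := z.2.2 hK
    rw [geod_val, hs1, hs2] at h1
    rw [hd] at h2
    simp only [Pi.add_apply, Pi.smul_apply, smul_eq_mul] at h1 h2
    linarith
  obtain ⟨s, hs1, hs2⟩ := exists_cosK_sinK e hα
  exact ⟨s, Plane.ext (by rw [geod_val, hs1, hs2, ← hd])⟩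

/-- Both vectors are tangent at the same point, so in the frame `(T.pt, T.vec, T.normalVec)` the
component along `T.pt` vanishes. The two remaining components are the cosine and the sine of the
angle from `T` to `E`. -/
theorem vec_eq (T E : UnitTangent K) (h : E.pt = T.pt) :
    E.vec = ip K E.vec T.vec • T.vec + T.form E.vec • T.normalVec := by
  have hd := T.decomp E.vec
  set α := det3 E.vec T.vec T.normalVec
  set β := det3 T.pt.1 E.vec T.normalVec
  have h1 := E.tangent
  have h0 : α = 0 := by
    rw [hd, h] at h1
    simp only [Pi.add_apply, Pi.smul_apply, smul_eq_mul] at h1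
    linear_combination h1 - α * T.pt.2.1 - β * T.tangent - det3 T.pt.1 T.vec E.vec * T.normal_tangent
  rw [h0, zero_smul, zero_add] at hd
  have h2 : ip K E.vec T.vec = β := by
    rw [hd, ip_comm, ip_smul_add_smul, ip_self, ip_comm, ip_normal_vec]; ring
  rw [h2]
  exact hd

theorem ip_sq_add_form_sq (T E : UnitTangent K) (h : E.pt = T.pt) :
    ip K E.vec T.vec ^ 2 + T.form E.vec ^ 2 = 1 := by
  have h1 := E.ip_self
  have e := vec_eq T E h
  set b := ip K E.vec T.vec
  set g := T.form E.vec
  rw [e, ip_smul_add_smul, ip_smul_add_smul_left, ip_smul_add_smul_left,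
    ip_self, ip_normal_vec, ip_comm, ip_normal_vec, ip_normal_normal] at h1
  linarith

theorem form_normal (T E : UnitTangent K) (h : E.pt = T.pt) :
    E.form T.normalVec = ip K E.vec T.vec := by
  have e := vec_eq T E h
  have h2 := T.det3_normal
  unfold form
  rw [h, det3_swap, e, det3_smul_add_smul, det3_self_right, det3_swap, h2, ← e]
  ring

theorem form_swap (T E : UnitTangent K) (h : E.pt = T.pt) : E.form T.vec = -T.form E.vec := by
  unfold form
  rw [h, det3_swap]

/-- The factor `K` is needed at `K = 0`: there `ip` degenerates to `dx² + dy²`, division by zero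
being zero, and `vec` need not be orthogonal to `pt`. -/
theorem ip_vec_pt (T : UnitTangent K) : K * ip K T.vec T.pt.1 = 0 := by
  by_cases hK : K = 0
  · simp [hK]
  · have := T.tangent
    unfold ip
    field_simp
    linarith

/-- `1 - cosK` carries a factor `K`, which removes the term that is exceptional in the flat case. -/
theorem one_sub_cosK_mul_ip (T : UnitTangent K) (s : ℝ) :
    (1 - cosK K (2 * s)) * ip K T.vec T.pt.1 = 0 := by
  rw [one_sub_cosK_two_mul]
  linear_combination 2 * sinK K s ^ 2 * T.ip_vec_pt

theorem ip_flow_vec (T : UnitTangent K) (s : ℝ) : ip K T.vec (T.flow s).vec = cosK K s := by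
  rw [flow_vec, ip_smul_add_smul, ip_self]
  linear_combination -sinK K s * T.ip_vec_pt

/-- The numerator of the first variation formula: the ambient difference of the ends of an arc,
tested against a tangent vector at one end, only sees the component along the arc. -/
theorem ip_geod_sub (T E : UnitTangent K) (h : E.pt = T.pt) (d : ℝ) :
    ip K E.vec (T.pt.1 - (T.geod d).1) = -(sinK K d * ip K E.vec T.vec) := by
  have h1 := E.one_sub_cosK_mul_ip (d / 2)
  rw [mul_div_cancel₀ _ two_ne_zero, h] at h1
  rw [show T.pt.1 - (T.geod d).1 = (1 - cosK K d) • T.pt.1 + (-sinK K d) • T.vec by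
    rw [geod_val]; module, ip_smul_add_smul]
  linear_combination h1

theorem reverse_flow_geod (T : UnitTangent K) (d : ℝ) :
    ((T.flow d).rotate π).geod d = T.pt := by
  rw [reverse_geod, flow_geod]; simp

theorem ip_geod_sub' (T E : UnitTangent K) (d : ℝ) (h : E.pt = T.geod d) :
    ip K E.vec ((T.geod d).1 - T.pt.1) = sinK K d * ip K E.vec (T.flow d).vec := by
  have := ip_geod_sub ((T.flow d).rotate π) E h d
  rw [reverse_flow_geod, rotate_pt, flow_pt, reverse_vec] at this
  rw [this]
  simp only [ip, Pi.neg_apply]; ring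

theorem form_geod_other (T E : UnitTangent K) (h : E.pt = T.pt) (d : ℝ) :
    E.form (T.geod d).1 = sinK K d * E.form T.vec := by
  rw [geod_val, ← h, form_smul_add_smul, form_pt]; ring

theorem form_geod_other' (T E : UnitTangent K) (d : ℝ) (h : E.pt = T.geod d) :
    E.form T.pt.1 = -(sinK K d * E.form (T.flow d).vec) := by
  have := form_geod_other ((T.flow d).rotate π) E h d
  rw [reverse_flow_geod, reverse_vec] at this
  rw [this]
  unfold form
  rw [det3_neg]; ring

/-- Decompose each vector in the frame of `T` at its own end. The normal is constant along the
geodesic (`flow_normalVec`), while the tangents at distance `d` have product `cosK K d`. -/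
theorem ip_vec_vec (T E F : UnitTangent K) (d : ℝ) (hE : E.pt = T.pt) (hF : F.pt = T.geod d) :
    ip K E.vec F.vec = cosK K d * (ip K E.vec T.vec * ip K F.vec (T.flow d).vec) +
      E.form T.vec * F.form (T.flow d).vec := by
  have e1 := vec_eq T E hE
  have e2 := vec_eq (T.flow d) F hF
  rw [form_swap T E hE, form_swap (T.flow d) F hF]
  have h0 := ip_normal_vec (T.flow d)
  rw [flow_normalVec] at e2 h0
  set b := ip K E.vec T.vec
  set g := T.form E.vec
  set b' := ip K F.vec (T.flow d).vec
  set g' := (T.flow d).form F.vec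
  rw [e1, e2, ip_smul_add_smul, ip_smul_add_smul_left, ip_smul_add_smul_left,
    ip_flow_vec, h0, ip_comm K T.vec, ip_normal_vec, ip_normal_normal]
  ring

end UnitTangent

/-- The distance of two points of the model surface. -/
def rho (K : ℝ) (u v : Fin 3 → ℝ) : ℝ := 2 * arcsinK K (√(ip K (u - v) (u - v)) / 2)

theorem rho_comm (K : ℝ) (u v : Fin 3 → ℝ) : rho K u v = rho K v u := by
  have : ip K (u - v) (u - v) = ip K (v - u) (v - u) := by
    simp only [ip, Pi.sub_apply]; ring
  simp [rho, this]

theorem rho_self (K : ℝ) (u : Fin 3 → ℝ) : rho K u u = 0 := by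
  have h : arcsinK K 0 = 0 := by simp [arcsinK]
  simp [rho, ip, h]

theorem continuous_rho (K : ℝ) {X : Type*} [TopologicalSpace X] {u v : X → Fin 3 → ℝ}
    (hu : Continuous u) (hv : Continuous v) : Continuous fun x => rho K (u x) (v x) := by
  unfold rho
  exact continuous_const.mul ((continuous_arcsinK K).comp
    ((continuous_ip K (hu.sub hv) (hu.sub hv)).sqrt.div_const _))

/-- The ambient chord has length `2 sin_K(d / 2)`. Unlike an arccosine of the ambient product, this
recovers `d` uniformly in `K`, the flat case included; `rho` is the inverse relation. -/
theorem ip_sub_self_geod {K : ℝ} (T : UnitTangent K) (d : ℝ) :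
    ip K (T.pt.1 - (T.geod d).1) (T.pt.1 - (T.geod d).1) = (2 * sinK K (d / 2)) ^ 2 := by
  have h2 := one_sub_cosK_two_mul K (d / 2)
  have h3 := sinK_two_mul K (d / 2)
  have h4 := cosK_sq_add K (d / 2)
  have h5 := T.ip_vec_pt
  rw [mul_div_cancel₀ _ two_ne_zero] at h2 h3
  have h6 : (1 - cosK K d) ^ 2 * ip K T.pt.1 T.pt.1 = 4 * K * sinK K (d / 2) ^ 4 := by
    rw [h2]
    by_cases hK : K = 0
    · simp [hK]
    · have := T.pt.2.1
      unfold ip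
      field_simp
      linear_combination 4 * sinK K (d / 2) ^ 4 * this
  rw [show T.pt.1 - (T.geod d).1 = (1 - cosK K d) • T.pt.1 + (-sinK K d) • T.vec by
    rw [T.geod_val]; module, ip_smul_add_smul, ip_smul_add_smul_left, ip_smul_add_smul_left,
    T.ip_self, ip_comm K T.pt.1 T.vec]
  rw [h2] at h6
  rw [h2, h3]
  linear_combination h6 - 8 * sinK K (d / 2) ^ 3 * cosK K (d / 2) * h5 + 4 * sinK K (d / 2) ^ 2 * h4

theorem rho_geod {K : ℝ} (T : UnitTangent K) {d : ℝ} (h0 : 0 ≤ d) (h : 0 < K → d ≤ π / √K) :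
    rho K T.pt.1 (T.geod d).1 = d := by
  have h1 : 0 < K → d / 2 ≤ π / (2 * √K) := fun hK => by
    have := h hK
    rw [mul_comm, ← div_div]; linarith
  have h2 : 0 ≤ sinK K (d / 2) := sinK_nonneg (by linarith) fun hK => by
    have := h hK; linarith
  rw [rho, ip_sub_self_geod, Real.sqrt_sq (by linarith), mul_div_cancel_left₀ _ two_ne_zero,
    arcsinK_sinK (by linarith) h1]
  ring

end ConstCurv

end

/-! ### Geodesic convexity and convex cones -/

noncomputable section

namespace ConstCurv

open Real Filter Topology

instance (K : ℝ) : T2Space (Plane K) :=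
  inferInstanceAs (T2Space
    {p : Fin 3 → ℝ // p 0 ^ 2 + K * (p 1 ^ 2 + p 2 ^ 2) = 1 ∧ (K ≤ 0 → 0 < p 0)})

variable {K : ℝ}

theorem geodDist_nonneg (p q : Plane K) : 0 ≤ geodDist p q :=
  Real.sInf_nonneg fun _ h => h.1

theorem geodDist_le_of_geod {p q : Plane K} {T : UnitTangent K} {l : ℝ} (hl : 0 ≤ l)
    (h1 : T.pt = p) (h2 : T.geod l = q) : geodDist p q ≤ l :=
  csInf_le ⟨0, fun _ h => h.1⟩ ⟨hl, T, h1, h2⟩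

/-- Beyond half a great circle, running the other way, or dropping a full turn, gives a shorter
segment. -/
theorem geodDist_le_pi {p q : Plane K} {T : UnitTangent K} (h1 : T.pt = p)
    (h2 : T.geod (geodDist p q) = q) (hK : 0 < K) : geodDist p q ≤ π / √K := by
  by_contra! h
  have hpi := pi_div_sqrt_pos hK
  set d := geodDist p q with hd
  rcases le_total d (2 * (π / √K)) with h3 | h3
  · have : (T.rotate π).geod (2 * (π / √K) - d) = q := by
      rw [T.reverse_geod, ← h2, ← T.geod_add_period hK]
      congr 1; ring
    have := geodDist_le_of_geod (by linarith) (by rw [T.rotate_pt, h1]) this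
    linarith
  · have : T.geod (d - 2 * (π / √K)) = q := by
      rw [← h2, ← T.geod_add_period hK]
      congr 1; ring
    have := geodDist_le_of_geod (by linarith) h1 this
    linarith

theorem eventually_sinK_pos (K : ℝ) : ∀ᶠ r in 𝓝[>] (0 : ℝ), 0 < sinK K r := by
  by_cases hK : 0 < K
  · have h1 : ∀ᶠ r in 𝓝[>] (0 : ℝ), r < π / √K :=
      nhdsWithin_le_nhds (Iio_mem_nhds (pi_div_sqrt_pos hK))
    filter_upwards [h1, self_mem_nhdsWithin] with r hr hr0
    exact sinK_pos hr0 fun _ => hr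
  · filter_upwards [self_mem_nhdsWithin] with r hr0
    exact sinK_pos hr0 fun h => absurd h hK

/-- The sine rule for an arc: the coefficients of an intermediate point in terms of the endpoints.
It translates arcs into positive combinations. -/
theorem UnitTangent.combination_geod (T : UnitTangent K) (s d : ℝ) :
    sinK K d • (T.geod s).1 = sinK K (d - s) • T.pt.1 + sinK K s • (T.geod d).1 := by
  have h := cosK_sq_add K s
  simp only [T.geod_val, sinK_sub]
  module

theorem UnitTangent.arc_combination (T : UnitTangent K) {d α β : ℝ} (hd : 0 ≤ d)
    (hd' : 0 < K → d ≤ π / √K) (hα : 0 ≤ α) (hβ : 0 ≤ β) :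
    ∃ s ∈ Set.Icc 0 d, ∃ r : ℝ, 0 ≤ r ∧ α • T.pt.1 + β • (T.geod d).1 = r • (T.geod s).1 := by
  rcases hd.eq_or_lt with rfl | hd0
  · exact ⟨0, by simp, α + β, by positivity, by simp [add_smul]⟩
  -- Antipodal endpoints are opposite vectors, so the combination is a nonnegative multiple of one
  -- of them.
  by_cases hpi : 0 < K ∧ d = π / √K
  · obtain ⟨hK, rfl⟩ := hpi
    have e : (T.geod (π / √K)).1 = -T.pt.1 := by
      rw [T.geod_val, sinK_pi hK, cosK_pi hK]; simp
    rcases le_total β α with h | h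
    · refine ⟨0, ⟨le_rfl, hd⟩, α - β, by linarith, ?_⟩
      rw [e, T.geod_zero]; module
    · refine ⟨π / √K, ⟨hd, le_rfl⟩, β - α, by linarith, ?_⟩
      rw [e]; module
  have hs : 0 < sinK K d := sinK_pos hd0 fun hK =>
    lt_of_le_of_ne (hd' hK) fun h => hpi ⟨hK, h⟩
  rcases (add_nonneg hα hβ).eq_or_lt with h0 | h0
  · have h1 : α = 0 := by linarith
    have h2 : β = 0 := by linarith
    exact ⟨0, by simp [hd], 0, le_rfl, by simp [h1, h2]⟩
  -- Intermediate values give `s` with `sinK (d - s) : sinK s = α : β`, which by `combination_geod`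
  -- puts the arc point on the right ray.
  have hc : ContinuousOn (fun s => α * sinK K s - β * sinK K (d - s)) (Set.Icc 0 d) := by
    have := continuous_sinK K
    fun_prop
  obtain ⟨s, hs1, hs2⟩ := intermediate_value_Icc hd hc (show (0 : ℝ) ∈ Set.Icc _ _ by
    simp only [sinK_zero, sub_zero, sub_self, mul_zero, zero_sub]
    exact ⟨by nlinarith, by positivity⟩)
  simp only at hs2
  have hx : 0 ≤ sinK K (d - s) := sinK_nonneg (by linarith [hs1.2]) fun hK => by
    linarith [hs1.1, hd' hK]
  have hy : 0 ≤ sinK K s := sinK_nonneg hs1.1 fun hK => by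
    linarith [hs1.2, hd' hK]
  have hc := T.combination_geod s d
  set x := sinK K (d - s)
  set y := sinK K s
  have hxy : 0 < x + y := by
    rcases (add_nonneg hx hy).eq_or_lt with h | h
    · exfalso
      have h1 : x = 0 := by linarith
      have h2 : y = 0 := by linarith
      rw [h1, h2] at hc
      simp only [zero_smul, add_zero, smul_eq_zero] at hc
      exact hc.elim hs.ne' (T.geod s).ne_zero
    · exact h
  refine ⟨s, hs1, (α + β) * sinK K d / (x + y), by positivity, ?_⟩
  rw [show ((α + β) * sinK K d / (x + y)) = ((α + β) / (x + y)) * sinK K d by ring, mul_smul, hc,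
    smul_add, smul_smul, smul_smul]
  congr 2
  · field_simp; linarith
  · field_simp; linarith

/-- The cone over a subset of the model surface. -/
def cone (D : Set (Plane K)) : Set (Fin 3 → ℝ) := {v | ∃ r : ℝ, 0 ≤ r ∧ ∃ p ∈ D, v = r • p.1}

variable {D : Set (Plane K)}

theorem val_mem_cone {p : Plane K} (hp : p ∈ D) : p.1 ∈ cone D :=
  ⟨1, zero_le_one, p, hp, by simp⟩

theorem mem_of_val_mem_cone {p : Plane K} (hp : p.1 ∈ cone D) : p ∈ D := by
  obtain ⟨r, hr, q, hq, h⟩ := hp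
  rwa [Plane.smul_eq hr h]

/-- A shortest arc is the radial projection of the ambient segment between its ends, so geodesic
convexity makes the cone convex. This is the form in which convexity is used afterwards. -/
theorem GeodesicallyConvex.cone_mem (hD : GeodesicallyConvex D) {u v : Fin 3 → ℝ} {α β : ℝ}
    (hu : u ∈ cone D) (hv : v ∈ cone D) (hα : 0 ≤ α) (hβ : 0 ≤ β) :
    α • u + β • v ∈ cone D := by
  obtain ⟨r, hr, p, hp, rfl⟩ := hu
  obtain ⟨r', hr', q, hq, rfl⟩ := hv
  obtain ⟨T, h1, h2, h3⟩ := hD p hp q hq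
  obtain ⟨s, hs, t, ht, e⟩ := T.arc_combination (geodDist_nonneg p q)
    (fun hK => geodDist_le_pi h1 h2 hK) (mul_nonneg hα hr) (mul_nonneg hβ hr')
  rw [h1, h2] at e
  exact ⟨t, ht, _, h3 s hs, by rw [smul_smul, smul_smul, e]⟩

/-- Write `z` in the basis `(u, v, c)` by Cramer's rule. Near `p` the first two coordinates stay
positive, and the third is nonnegative on the side of `c`: a half-neighbourhood of `p` lies in the
cone. -/
theorem GeodesicallyConvex.eventually_mem_cone (hD : GeodesicallyConvex D)
    {u v c p : Fin 3 → ℝ} {α β : ℝ} (hα : 0 < α) (hβ : 0 < β) (hu : u ∈ cone D) (hv : v ∈ cone D)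
    (hc : c ∈ cone D) (hp : p = α • u + β • v) (hdet : det3 u v c ≠ 0) :
    ∀ᶠ z in 𝓝 p, 0 ≤ det3 u v z * det3 u v c → z ∈ cone D := by
  have c1 : Continuous fun z => det3 z v c / det3 u v c :=
    (continuous_det3 continuous_id continuous_const continuous_const).div_const _
  have c2 : Continuous fun z => det3 u z c / det3 u v c :=
    (continuous_det3 continuous_const continuous_id continuous_const).div_const _
  have e1 : det3 p v c / det3 u v c = α := by
    rw [div_eq_iff hdet, hp]
    simp only [det3, Pi.add_apply, Pi.smul_apply, smul_eq_mul]; ring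
  have e2 : det3 u p c / det3 u v c = β := by
    rw [div_eq_iff hdet, hp]
    simp only [det3, Pi.add_apply, Pi.smul_apply, smul_eq_mul]; ring
  have h1 := c1.continuousAt.eventually (lt_mem_nhds (by rw [e1]; exact hα : 0 < det3 p v c / det3 u v c))
  have h2 := c2.continuousAt.eventually (lt_mem_nhds (by rw [e2]; exact hβ : 0 < det3 u p c / det3 u v c))
  filter_upwards [h1, h2] with z h1 h2 h3
  have e : z = (1 : ℝ) • ((det3 z v c / det3 u v c) • u + (det3 u z c / det3 u v c) • v) +
      (det3 u v z / det3 u v c) • c := by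
    have := cramer u v c z
    apply smul_right_injective _ hdet
    simp only [smul_add, smul_smul, one_mul, mul_div_cancel₀ _ hdet]
    exact this
  rw [e]
  refine hD.cone_mem (hD.cone_mem hu hv h1.le h2.le) hc zero_le_one ?_
  rw [← mul_div_mul_right _ _ hdet]
  exact div_nonneg h3 (mul_self_nonneg _)

theorem GeodesicallyConvex.eventually_mem (hD : GeodesicallyConvex D)
    {u v c : Fin 3 → ℝ} {p : Plane K} {α β : ℝ} (hα : 0 < α) (hβ : 0 < β) (hu : u ∈ cone D)
    (hv : v ∈ cone D) (hc : c ∈ cone D) (hp : p.1 = α • u + β • v) (hdet : det3 u v c ≠ 0) :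
    ∀ᶠ z : Plane K in 𝓝 p, 0 ≤ det3 u v z.1 * det3 u v c → z ∈ D := by
  have := (continuous_plane_val K).continuousAt.eventually
    (hD.eventually_mem_cone hα hβ hu hv hc hp hdet)
  filter_upwards [this] with z hz h
  exact mem_of_val_mem_cone (hz h)

theorem GeodesicallyConvex.eventually_mem_interior (hD : GeodesicallyConvex D)
    {u v c : Fin 3 → ℝ} {p : Plane K} {α β : ℝ} (hα : 0 < α) (hβ : 0 < β) (hu : u ∈ cone D)
    (hv : v ∈ cone D) (hc : c ∈ cone D) (hp : p.1 = α • u + β • v) (hdet : det3 u v c ≠ 0) :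
    ∀ᶠ z : Plane K in 𝓝 p, 0 < det3 u v z.1 * det3 u v c → z ∈ interior D := by
  have hcont : Continuous fun z : Plane K => det3 u v z.1 * det3 u v c :=
    (continuous_det3 continuous_const continuous_const (continuous_plane_val K)).mul_const _
  filter_upwards [eventually_eventually_nhds.2 (hD.eventually_mem hα hβ hu hv hc hp hdet)]
    with z hz h
  rw [mem_interior_iff_mem_nhds]
  filter_upwards [hz, hcont.continuousAt.eventually (lt_mem_nhds h)] with w hw h
  exact hw h.le

theorem UnitTangent.continuous_geod (T : UnitTangent K) : Continuous T.geod := by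
  apply Continuous.subtype_mk
  have := continuous_sinK K
  have := continuous_cosK K
  fun_prop

theorem UnitTangent.tendsto_geod (T : UnitTangent K) :
    Tendsto T.geod (𝓝[>] 0) (𝓝 T.pt) := by
  have := T.continuous_geod.tendsto 0
  rw [T.geod_zero] at this
  exact this.mono_left nhdsWithin_le_nhds

/-- At a point inside a segment of `D`, the boundary can only run along that segment. Otherwise a
boundary point `c` reached in the direction of `T` would make all points of this direction close to
the base point interior, being strictly on the side of `c`. -/
theorem det3_eq_zero_of_isBoundaryDirection (hD : GeodesicallyConvex D) (hcl : IsClosed D)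
    {x y : Fin 3 → ℝ} {α β : ℝ} (hα : 0 < α) (hβ : 0 < β) (hx : x ∈ cone D) (hy : y ∈ cone D)
    (T : UnitTangent K) (hT : T.pt.1 = α • x + β • y) (hb : IsBoundaryDirection D T) :
    det3 x y T.vec = 0 := by
  by_contra hne
  have hform : ∀ r, det3 x y (T.geod r).1 = sinK K r * det3 x y T.vec := by
    intro r
    rw [T.geod_val, det3_smul_add_smul, hT, det3_smul_add_smul, det3_self_left, det3_self_right]
    ring
  obtain ⟨r₀, h1, h2⟩ := ((eventually_sinK_pos K).and hb).exists
  have hdet : det3 x y (T.geod r₀).1 ≠ 0 := by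
    rw [hform]; exact mul_ne_zero h1.ne' hne
  have := T.tendsto_geod.eventually (hD.eventually_mem_interior hα hβ hx hy
    (val_mem_cone (hcl.frontier_subset h2)) hT hdet)
  obtain ⟨r, ⟨h3, h4⟩, h5⟩ := ((this.and (eventually_sinK_pos K)).and hb).exists
  refine h5.2 (h3 ?_)
  rw [hform, hform]
  have : 0 < det3 x y T.vec ^ 2 := by positivity
  have := mul_pos (mul_pos h4 h1) this
  linarith

theorem UnitTangent.det3_geod_geod (T : UnitTangent K) (s t : ℝ) (z : Fin 3 → ℝ) :
    det3 (T.geod s).1 (T.geod t).1 z = sinK K (t - s) * T.form z := by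
  simp only [UnitTangent.form, det3, T.geod_val, sinK_sub, Pi.add_apply, Pi.smul_apply, smul_eq_mul]
  ring

theorem UnitTangent.geod_sub_add_geod_add (T : UnitTangent K) (l ε : ℝ) :
    (T.geod (l - ε)).1 + (T.geod (l + ε)).1 = (2 * cosK K ε) • (T.geod l).1 := by
  simp only [T.geod_val, sinK_sub, cosK_sub, sinK_add, cosK_add]
  module

theorem UnitTangent.reverse_form (T : UnitTangent K) (z : Fin 3 → ℝ) :
    (T.rotate π).form z = -T.form z := by
  simp only [UnitTangent.form, T.reverse_vec, T.rotate_pt, det3, Pi.neg_apply]; ring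

/-- If two geodesics through a point are different, they are transversal there. -/
theorem form_ne_zero_of_range_ne {T E : UnitTangent K} (h : E.pt = T.pt)
    (hne : Set.range T.geod ≠ Set.range E.geod) : T.form E.vec ≠ 0 := by
  intro h0
  apply hne
  have e := T.vec_eq E h
  have h2 := T.ip_sq_add_form_sq E h
  rw [h0, zero_smul, add_zero] at e
  rw [h0] at h2
  have hb : ip K E.vec T.vec ≠ 0 := fun hb => by rw [hb] at h2; norm_num at h2
  have hf : ∀ z, E.form z = ip K E.vec T.vec * T.form z := by
    intro z
    conv_lhs => rw [UnitTangent.form, h, e]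
    simp only [UnitTangent.form, det3, Pi.smul_apply, smul_eq_mul]; ring
  ext z
  constructor
  · rintro ⟨s, rfl⟩
    exact E.exists_geod_eq (by rw [hf, T.form_geod, mul_zero])
  · rintro ⟨s, rfl⟩
    apply T.exists_geod_eq
    have := hf (E.geod s).1
    rw [E.form_geod] at this
    exact (mul_eq_zero.1 this.symm).resolve_left hb

/-- If the boundary turns away transversally at `S.geod h`, then `D` contains no point of the
geodesic ahead of it: such a point would put the corner inside a segment of `D`, contradicting
`det3_eq_zero_of_isBoundaryDirection`. -/
theorem mem_arc_of_isBoundaryDirection (hD : GeodesicallyConvex D) (hcl : IsClosed D)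
    (S B : UnitTangent K) {h s : ℝ} (h0 : 0 < h) (hpi : 0 < K → h < π / √K) (hm : S.pt ∈ D)
    (hp : S.geod s ∈ D) (hs : 0 < sinK K s) (hB : B.pt = S.geod h)
    (hb : IsBoundaryDirection D B) (hne : S.form B.vec ≠ 0) :
    ∃ s' ∈ Set.Icc 0 h, S.geod s = S.geod s' := by
  have hsh := sinK_pos h0 hpi
  have e : (S.geod h).1 = (sinK K (s - h) / sinK K s) • S.pt.1 +
      (sinK K h / sinK K s) • (S.geod s).1 := by
    apply smul_right_injective _ hs.ne'
    simp only [smul_add, smul_smul, mul_div_cancel₀ _ hs.ne']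
    exact S.combination_geod h s
  -- The sign tells whether the point at time `s` lies on the arc up to `h` or beyond it.
  rcases le_or_gt (sinK K (s - h)) 0 with hα | hα
  · have e' : (S.geod s).1 = (-sinK K (s - h) / sinK K h) • S.pt.1 +
        (sinK K s / sinK K h) • (S.geod h).1 := by
      rw [e, smul_add, smul_smul, smul_smul]
      have h1 : sinK K s / sinK K h * (sinK K h / sinK K s) = 1 := by field_simp
      have h2 : sinK K s / sinK K h * (sinK K (s - h) / sinK K s) =
          sinK K (s - h) / sinK K h := by field_simp
      rw [h1, h2]; module
    obtain ⟨s', hs', r, hr, e2⟩ := S.arc_combination h0.le (fun hK => (hpi hK).le)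
      (div_nonneg (neg_nonneg.2 hα) hsh.le) (div_nonneg hs.le hsh.le)
    exact ⟨s', hs', Plane.smul_eq hr (e'.trans e2)⟩
  · exfalso
    have := det3_eq_zero_of_isBoundaryDirection hD hcl (div_pos hα hs) (div_pos hsh hs)
      (val_mem_cone hm) (val_mem_cone hp) B (by rw [hB, e]) hb
    have h2 := S.det3_geod_geod 0 s B.vec
    rw [S.geod_zero, this, sub_zero] at h2
    exact (mul_ne_zero hs.ne' hne) h2.symm

/-- A compact convex domain bounded by a simple closed geodesic polygon. -/
structure IsConvexPolygon (D : Set (Plane K)) {n : ℕ} [NeZero n]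
    (a : Fin n → UnitTangent K) (len : Fin n → ℝ) : Prop where
  compact : IsCompact D
  convex : GeodesicallyConvex D
  poly : HasPolygonBoundary D a len

/-! ### Edges as supporting geodesics -/

namespace IsConvexPolygon

variable {n : ℕ} [NeZero n] {a : Fin n → UnitTangent K} {len : Fin n → ℝ}
  (h : IsConvexPolygon D a len)

include h

theorem closed : IsClosed D := h.compact.isClosed

theorem geod_mem_frontier {i : Fin n} {s : ℝ} (hs : s ∈ Set.Icc 0 (len i)) :
    (a i).geod s ∈ frontier D := by
  rw [h.poly.frontier_eq]
  exact Set.mem_iUnion.2 ⟨i, s, hs, rfl⟩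

theorem geod_mem {i : Fin n} {s : ℝ} (hs : s ∈ Set.Icc 0 (len i)) : (a i).geod s ∈ D :=
  h.closed.frontier_subset (h.geod_mem_frontier hs)

theorem isBoundaryDirection_flow {i : Fin n} {l : ℝ} (hl : l ∈ Set.Ico 0 (len i)) :
    IsBoundaryDirection D ((a i).flow l) := by
  have h1 : ∀ᶠ r in 𝓝[>] (0 : ℝ), r < len i - l :=
    nhdsWithin_le_nhds (Iio_mem_nhds (by linarith [hl.2]))
  unfold IsBoundaryDirection
  filter_upwards [h1, self_mem_nhdsWithin] with r hr hr0
  rw [(a i).flow_geod]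
  have hr0 : 0 < r := hr0
  exact h.geod_mem_frontier ⟨by linarith [hl.1], by linarith⟩

theorem isBoundaryDirection_reverse {i : Fin n} {l : ℝ} (hl : l ∈ Set.Ioc 0 (len i)) :
    IsBoundaryDirection D (((a i).flow l).rotate π) := by
  have h1 : ∀ᶠ r in 𝓝[>] (0 : ℝ), r < l :=
    nhdsWithin_le_nhds (Iio_mem_nhds hl.1)
  unfold IsBoundaryDirection
  filter_upwards [h1, self_mem_nhdsWithin] with r hr hr0
  rw [((a i).flow l).reverse_geod, (a i).flow_geod]
  have hr0 : 0 < r := hr0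
  exact h.geod_mem_frontier ⟨by linarith, by linarith [hl.2]⟩

theorem isBoundaryDirection (i : Fin n) : IsBoundaryDirection D (a i) := by
  have := h.isBoundaryDirection_flow (i := i) ⟨le_rfl, h.poly.len_pos i⟩
  rwa [(a i).flow_zero] at this

theorem form_next (i : Fin n) : (a i).form (a (i + 1)).vec ≠ 0 := by
  have h1 := form_ne_zero_of_range_ne (T := (a i).flow (len i)) (E := a (i + 1))
    (h.poly.closed i).symm ?_
  · rwa [(a i).flow_form] at h1
  · have : Set.range ((a i).flow (len i)).geod = Set.range (a i).geod := by
      ext z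
      constructor
      · rintro ⟨s, rfl⟩; exact ⟨len i + s, ((a i).flow_geod _ _).symm⟩
      · rintro ⟨s, rfl⟩
        exact ⟨s - len i, by rw [(a i).flow_geod]; congr 1; ring⟩
    rw [this]
    exact h.poly.corner i

theorem form_next_geod (i : Fin n) (r : ℝ) :
    (a i).form ((a (i + 1)).geod r).1 = sinK K r * (a i).form (a (i + 1)).vec := by
  rw [(a (i + 1)).geod_val, UnitTangent.form_smul_add_smul, ← h.poly.closed i,
    (a i).form_geod]
  ring

theorem exists_form_ne (i : Fin n) : ∃ c ∈ D, (a i).form c.1 ≠ 0 := by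
  obtain ⟨r, h1, h2⟩ := ((eventually_sinK_pos K).and (h.isBoundaryDirection (i + 1))).exists
  refine ⟨_, h.closed.frontier_subset h2, ?_⟩
  rw [h.form_next_geod]
  exact mul_ne_zero h1.ne' (h.form_next i)

/-- Two neighbours at equal distance on the same edge display an interior edge point as a positive
combination in the cone, as the half-neighbourhood lemmas require. -/
theorem exists_split {i : Fin n} {l : ℝ} (hl : l ∈ Set.Ioo 0 (len i)) :
    ∃ x ∈ cone D, ∃ y ∈ cone D, ∃ α > (0 : ℝ), ∃ β > (0 : ℝ), ((a i).geod l).1 = α • x + β • y ∧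
      ∃ k ≠ (0 : ℝ), ∀ z, det3 x y z = k * (a i).form z := by
  have h1 : ∀ᶠ r in 𝓝[>] (0 : ℝ), r < l := nhdsWithin_le_nhds (Iio_mem_nhds hl.1)
  have h2 : ∀ᶠ r in 𝓝[>] (0 : ℝ), r < len i - l :=
    nhdsWithin_le_nhds (Iio_mem_nhds (by linarith [hl.2]))
  have h3 : ∀ᶠ r in 𝓝[>] (0 : ℝ), 0 < cosK K r :=
    nhdsWithin_le_nhds ((continuous_cosK K).continuousAt.eventually
      (lt_mem_nhds (by rw [cosK_zero]; exact one_pos)))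
  obtain ⟨r, ⟨⟨⟨⟨h1, h2⟩, h3⟩, h4⟩, h5⟩⟩ := ((((h1.and h2).and h3).and
    (eventually_sinK_pos K)).and self_mem_nhdsWithin).exists
  have h5 : 0 < r := h5
  refine ⟨_, val_mem_cone (h.geod_mem (i := i) (s := l - r) ⟨by linarith, by linarith⟩), _,
    val_mem_cone (h.geod_mem (i := i) (s := l + r) ⟨by linarith, by linarith⟩),
    1 / (2 * cosK K r), by positivity, 1 / (2 * cosK K r), by positivity, ?_,
    sinK K (2 * r), ?_, ?_⟩
  · rw [← smul_add, (a i).geod_sub_add_geod_add, smul_smul, one_div,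
      inv_mul_cancel₀ (by positivity), one_smul]
  · rw [sinK_two_mul]; positivity
  · intro z
    rw [(a i).det3_geod_geod]
    congr 2; ring

/-- Points of `D` strictly on both sides would give two half-neighbourhoods of the midpoint of the
edge, making this boundary point interior. -/
theorem form_sign (i : Fin n) :
    (∀ p ∈ D, 0 ≤ (a i).form p.1) ∨ (∀ p ∈ D, (a i).form p.1 ≤ 0) := by
  by_contra! hcon
  obtain ⟨⟨c₁, hc₁, h1⟩, ⟨c₂, hc₂, h2⟩⟩ := hcon
  have hl : len i / 2 ∈ Set.Ioo 0 (len i) := by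
    have := h.poly.len_pos i
    exact ⟨by linarith, by linarith⟩
  obtain ⟨x, hx, y, hy, α, hα, β, hβ, e, k, hk, hdet⟩ := h.exists_split hl
  have g1 := h.convex.eventually_mem hα hβ hx hy (val_mem_cone hc₁) e
    (by rw [hdet]; exact mul_ne_zero hk h1.ne)
  have g2 := h.convex.eventually_mem hα hβ hx hy (val_mem_cone hc₂) e
    (by rw [hdet]; exact mul_ne_zero hk h2.ne')
  refine (h.geod_mem_frontier ⟨hl.1.le, hl.2.le⟩).2 ?_
  rw [mem_interior_iff_mem_nhds]
  filter_upwards [g1, g2] with z g1 g2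
  simp only [hdet] at g1 g2
  have hk2 : 0 < k ^ 2 := by positivity
  rcases le_total ((a i).form z.1) 0 with hz | hz
  · apply g1
    have := mul_nonneg hk2.le (mul_nonneg_of_nonpos_of_nonpos hz h1.le)
    linarith
  · apply g2
    have := mul_nonneg hk2.le (mul_nonneg hz h2.le)
    linarith

/-- Near the common corner, the form of edge `i` at a point of edge `i + 1` equals the form of edge
`i + 1` at the point of edge `i` at the same distance from the corner. Both points lie in `D`, so
the supporting signs agree. -/
theorem orientation_next {σ : ℝ} {i : Fin n} (hi : ∀ p ∈ D, 0 ≤ σ * (a i).form p.1)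
    (hσ : σ ≠ 0) : ∀ p ∈ D, 0 ≤ σ * (a (i + 1)).form p.1 := by
  have h1 : ∀ᶠ r in 𝓝[>] (0 : ℝ), r < len i := nhdsWithin_le_nhds (Iio_mem_nhds (h.poly.len_pos i))
  obtain ⟨r, ⟨⟨h1, h2⟩, h3⟩, h4⟩ := (((eventually_sinK_pos K).and
    (h.isBoundaryDirection (i + 1))).and (h1.and self_mem_nhdsWithin)).exists.imp
      fun r hr => (⟨⟨⟨hr.1.1, hr.1.2⟩, hr.2.1⟩, hr.2.2⟩ :
        ((_ ∧ _) ∧ _) ∧ _)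
  have h4 : 0 < r := h4
  have e1 : (a (i + 1)).form ((a i).geod (len i - r)).1 =
      sinK K r * (a i).form (a (i + 1)).vec := by
    have e := UnitTangent.form_geod_other ((a i).flow (len i)) (a (i + 1))
      (h.poly.closed i).symm (-r)
    rw [(a i).flow_geod, ← sub_eq_add_neg, sinK_neg,
      UnitTangent.form_swap ((a i).flow (len i)) (a (i + 1)) (h.poly.closed i).symm,
      (a i).flow_form] at e
    rw [e]; ring
  have e2 := h.form_next_geod i r
  have g1 := hi _ (h.closed.frontier_subset h2)
  have hq : (a i).geod (len i - r) ∈ D := h.geod_mem ⟨by linarith, by linarith⟩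
  have hne : sinK K r * (a i).form (a (i + 1)).vec ≠ 0 := mul_ne_zero h1.ne' (h.form_next i)
  rw [e2] at g1
  have g2 : 0 < σ * (sinK K r * (a i).form (a (i + 1)).vec) :=
    lt_of_le_of_ne g1 (mul_ne_zero hσ hne).symm
  rw [← e1] at g2
  intro p hp
  rcases h.form_sign (i + 1) with g | g
  · have := g _ hq
    have h5 : 0 < σ := by
      by_contra h5
      nlinarith
    exact mul_nonneg h5.le (g p hp)
  · have := g _ hq
    have h5 : σ < 0 := by
      by_contra h5
      nlinarith
    exact mul_nonneg_of_nonpos_of_nonpos h5.le (g p hp)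

theorem exists_orientation : ∃ σ : ℝ, σ ≠ 0 ∧ ∀ i, ∀ p ∈ D, 0 ≤ σ * (a i).form p.1 := by
  have key : ∀ σ : ℝ, σ ≠ 0 → (∀ p ∈ D, 0 ≤ σ * (a 0).form p.1) →
      ∀ i, ∀ p ∈ D, 0 ≤ σ * (a i).form p.1 := by
    intro σ hσ h0 i
    -- The induction runs over `ℕ`, since `i + 1` in `Fin n` is cyclic.
    have : ∀ k : ℕ, ∀ p ∈ D, 0 ≤ σ * (a (Fin.ofNat n k)).form p.1 := by
      intro k
      induction k with
      | zero => exact h0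
      | succ k ih =>
        have := h.orientation_next ih hσ
        convert this using 6
        ext
        simp [Fin.val_add, Nat.add_mod]
    have h1 := this i.val
    rwa [Fin.ofNat_eq_cast, Fin.cast_val_eq_self] at h1
  rcases h.form_sign 0 with g | g
  · exact ⟨1, one_ne_zero, key 1 one_ne_zero fun p hp => by rw [one_mul]; exact g p hp⟩
  · exact ⟨-1, by norm_num, key (-1) (by norm_num) fun p hp => by linarith [g p hp]⟩

/-- The antipode of an interior point of an edge does not lie in the polygon. -/
theorem val_ne_neg {i : Fin n} {l : ℝ} (hl : l ∈ Set.Ioo 0 (len i)) {p : Plane K} (hp : p ∈ D) :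
    p.1 ≠ -((a i).geod l).1 := by
  intro hneg
  obtain ⟨x, hx, y, hy, α, hα, β, hβ, e, k, hk, hdet⟩ := h.exists_split hl
  obtain ⟨c, -, hc⟩ := h.exists_form_ne i
  have hcd : det3 x y c.1 ≠ 0 := by rw [hdet]; exact mul_ne_zero hk hc
  -- The cone would contain an interior point of the edge together with its negative, hence the
  -- whole plane of this edge.
  have key : ∀ z, (a i).form z = 0 → z ∈ cone D := by
    intro z hz
    set s := det3 z y c.1 / det3 x y c.1
    set t := det3 x z c.1 / det3 x y c.1
    have ez : z = s • x + t • y := by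
      have := cramer x y c.1 z
      rw [hdet z, hz, mul_zero, zero_smul, add_zero] at this
      apply smul_right_injective _ hcd
      simp only [smul_add, smul_smul, s, t, mul_div_cancel₀ _ hcd]
      exact this
    -- Adding `τ • p = -τ • (α • x + β • y)` must be compensated by `τ * α` and `τ * β`; this `τ`
    -- makes both resulting coefficients nonnegative.
    set τ := |s| / α + |t| / β
    have e3 : z = (1 : ℝ) • ((s + τ * α) • x + (t + τ * β) • y) + τ • p.1 := by
      rw [hneg, e, ez]; module
    have hs0 : |s| / α * α = |s| := div_mul_cancel₀ _ hα.ne'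
    have ht0 : |t| / β * β = |t| := div_mul_cancel₀ _ hβ.ne'
    have p1 : 0 ≤ |t| / β * α := by positivity
    have p2 : 0 ≤ |s| / α * β := by positivity
    rw [e3]
    refine h.convex.cone_mem (h.convex.cone_mem hx hy ?_ ?_) (val_mem_cone hp) zero_le_one
      (by positivity)
    · have := neg_abs_le s
      simp only [τ, add_mul]
      linarith
    · have := neg_abs_le t
      simp only [τ, add_mul]
      linarith
  -- At the final vertex `T.pt ± T.vec` are then in the cone, so the vertex is inside a segment of
  -- `D`, although the next edge leaves it transversally.
  set T := (a i).flow (len i) with hT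
  have hf : (a i).form = T.form := ((a i).flow_form _).symm
  have m1 : (1 : ℝ) • T.pt.1 + (1 : ℝ) • T.vec ∈ cone D := key _ (by
    rw [hf, UnitTangent.form_smul_add_smul, T.form_pt, T.form_vec]; ring)
  have m2 : (1 : ℝ) • T.pt.1 + (-1 : ℝ) • T.vec ∈ cone D := key _ (by
    rw [hf, UnitTangent.form_smul_add_smul, T.form_pt, T.form_vec]; ring)
  have := det3_eq_zero_of_isBoundaryDirection h.convex h.closed (α := 1 / 2) (β := 1 / 2)
    (by norm_num) (by norm_num) m1 m2 (a (i + 1))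
    (by rw [← h.poly.closed i, hT, UnitTangent.flow_pt]; module) (h.isBoundaryDirection _)
  apply h.form_next i
  rw [hf]
  have e4 : det3 ((1 : ℝ) • T.pt.1 + (1 : ℝ) • T.vec) ((1 : ℝ) • T.pt.1 + (-1 : ℝ) • T.vec)
      (a (i + 1)).vec = -2 * T.form (a (i + 1)).vec := by
    simp only [UnitTangent.form, det3, Pi.add_apply, Pi.smul_apply, smul_eq_mul]; ring
  rw [e4] at this
  linarith

theorem len_le_pi (i : Fin n) (hK : 0 < K) : len i ≤ π / √K := by
  by_contra! hlt
  have hpi := pi_div_sqrt_pos hK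
  -- Two antipodal points placed symmetrically about the midpoint of the edge, hence both interior
  -- to it.
  refine h.val_ne_neg (i := i) (l := (len i - π / √K) / 2) ⟨by linarith, by linarith⟩
    (h.geod_mem (i := i) (s := (len i - π / √K) / 2 + π / √K) ⟨by linarith, by linarith⟩) ?_
  rw [(a i).geod_val, (a i).geod_val, sinK_add, cosK_add, sinK_pi hK, cosK_pi hK]
  module

/-- The geodesic containing an edge meets the polygon only in this edge. -/
theorem exists_geod_of_form_eq_zero {i : Fin n} {p : Plane K} (hp : p ∈ D)
    (h0 : (a i).form p.1 = 0) : ∃ s ∈ Set.Icc 0 (len i), (a i).geod s = p := by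
  have hlen := h.poly.len_pos i
  -- Starting from the midpoint, both corners are at distance less than `π / √K`.
  set T := (a i).flow (len i / 2) with hT
  have hl2 : 0 < len i / 2 := by linarith
  have hpi : 0 < K → len i / 2 < π / √K := fun hK => by
    linarith [h.len_le_pi i hK]
  have hf : T.form = (a i).form := (a i).flow_form _
  obtain ⟨s, hs⟩ := T.exists_geod_eq (by rw [hf]; exact h0 : T.form p.1 = 0)
  have hm : T.pt ∈ D := h.geod_mem ⟨by linarith, by linarith⟩
  -- The sign says whether the point is behind the midpoint, is the midpoint or its antipode, or is
  -- ahead of it.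
  rcases lt_trichotomy (sinK K s) 0 with hneg | hzero | hpos
  · set S := T.rotate π with hS
    have hSg : ∀ t, S.geod t = (a i).geod (len i / 2 - t) := fun t => by
      rw [hS, T.reverse_geod, hT, (a i).flow_geod, sub_eq_add_neg]
    have hSp : S.geod (-s) = p := by rw [hS, T.reverse_geod, neg_neg, hs]
    -- The previous edge run backwards is the boundary direction leaving the initial corner.
    set B := ((a (i - 1)).flow (len (i - 1))).rotate π with hB
    have hcl := h.poly.closed (i - 1)
    rw [sub_add_cancel] at hcl
    obtain ⟨t, ht, e⟩ := mem_arc_of_isBoundaryDirection h.convex h.closed S B hl2 hpi hm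
      (by rw [hSp]; exact hp) (by rw [sinK_neg]; linarith)
      (by rw [hSg, sub_self, (a i).geod_zero]; exact hcl)
      (h.isBoundaryDirection_reverse ⟨h.poly.len_pos _, le_rfl⟩) (by
        rw [hS, T.reverse_form, hB, UnitTangent.reverse_vec, hf, UnitTangent.form, det3_neg]
        change - -(a i).form _ ≠ 0
        rw [neg_neg, UnitTangent.form_swap ((a (i - 1)).flow (len (i - 1))) (a i) hcl.symm,
          UnitTangent.flow_form]
        have := h.form_next (i - 1)
        rw [sub_add_cancel] at this
        exact neg_ne_zero.2 this)
    rw [hSp, hSg] at e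
    exact ⟨_, ⟨by linarith [ht.2], by linarith [ht.1]⟩, e.symm⟩
  · have h1 := cosK_sq_add K s
    rw [hzero] at h1
    have h2 : (cosK K s - 1) * (cosK K s + 1) = 0 := by linarith
    have h3 := T.geod_val s
    rw [hs, hzero] at h3
    rcases mul_eq_zero.1 h2 with h4 | h4
    · refine ⟨len i / 2, ⟨by linarith, by linarith⟩, Plane.ext ?_⟩
      rw [h3, show cosK K s = 1 by linarith]
      simp [hT, UnitTangent.flow_pt]
    · refine absurd ?_ (h.val_ne_neg (i := i) (l := len i / 2) ⟨by linarith, by linarith⟩ hp)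
      rw [h3, show cosK K s = -1 by linarith]
      simp [hT, UnitTangent.flow_pt]
  · obtain ⟨t, ht, e⟩ := mem_arc_of_isBoundaryDirection h.convex h.closed T (a (i + 1)) hl2 hpi hm
      (by rw [hs]; exact hp) hpos
      (by rw [hT, (a i).flow_geod, add_halves]; exact (h.poly.closed i).symm)
      (h.isBoundaryDirection _) (by rw [hf]; exact h.form_next i)
    rw [hs, hT, (a i).flow_geod] at e
    exact ⟨_, ⟨by linarith [ht.1], by linarith [ht.2]⟩, e.symm⟩

/-- Admits `s = len i`, which is the start of edge `i + 1` and so cannot be interior to an edge. -/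
theorem simple' {i j : Fin n} {s t : ℝ} (hs : s ∈ Set.Icc 0 (len i)) (ht : t ∈ Set.Ioo 0 (len j))
    (e : (a i).geod s = (a j).geod t) : i = j ∧ s = t := by
  rcases hs.2.eq_or_lt with h1 | h1
  · rw [h1, h.poly.closed i, ← (a (i + 1)).geod_zero] at e
    have := h.poly.simple _ _ 0 ⟨le_rfl, h.poly.len_pos _⟩ t ⟨ht.1.le, ht.2⟩ e
    exact absurd this.2 ht.1.ne
  · exact h.poly.simple _ _ s ⟨hs.1, h1⟩ t ⟨ht.1.le, ht.2⟩ e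

theorem form_geod_ne_zero {i j : Fin n} {t : ℝ} (hij : i ≠ j) (ht : t ∈ Set.Ioo 0 (len j)) :
    (a i).form ((a j).geod t).1 ≠ 0 := by
  intro h0
  obtain ⟨s, hs, e⟩ := h.exists_geod_of_form_eq_zero (h.geod_mem ⟨ht.1.le, ht.2.le⟩) h0
  exact hij (h.simple' hs ht e).1

end IsConvexPolygon

end ConstCurv

end

/-! ### Chords, their angles and the distance function -/

noncomputable section

namespace ConstCurv

open Real Filter Topology

variable {K : ℝ}

namespace UnitTangent

theorem reverse_reverse (T : UnitTangent K) : (T.rotate π).rotate π = T :=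
  ext' rfl (by rw [reverse_vec, reverse_vec, neg_neg])

theorem reverse_flow (T : UnitTangent K) (s : ℝ) :
    (T.rotate π).flow s = (T.flow (-s)).rotate π :=
  ext' (T.reverse_geod s) (by rw [reverse_flow_vec, reverse_vec])

theorem exists_onePeriod (T : UnitTangent K) (s : ℝ) :
    ∃ s' ∈ onePeriod K, T.flow s = T.flow s' := by
  by_cases hK : 0 < K
  · have hp : 0 < 2 * (π / √K) := by have := pi_div_sqrt_pos hK; positivity
    have hper : Function.Periodic T.flow (2 * (π / √K)) := fun s => T.flow_add_period hK s
    refine ⟨toIocMod hp (-(π / √K)) s, ?_, ?_⟩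
    · have := toIocMod_mem_Ioc hp (-(π / √K)) s
      rw [onePeriod, if_pos hK]
      rwa [show -(π / √K) + 2 * (π / √K) = π / √K by ring] at this
    · rw [toIocMod, hper.sub_zsmul_eq]
  · exact ⟨s, by simp [onePeriod, hK], rfl⟩

end UnitTangent

/-- The unit speed geodesic directed by `T` is minimizing and runs from `p` to `q` in time `d`. -/
structure Joins (T : UnitTangent K) (d : ℝ) (p q : Plane K) : Prop where
  pos : 0 < d
  lt : 0 < K → d < π / √K
  start : T.pt = p
  finish : T.geod d = q

namespace Joins

variable {T : UnitTangent K} {d : ℝ} {p q : Plane K}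

theorem reverse (h : Joins T d p q) : Joins ((T.flow d).rotate π) d q p where
  pos := h.pos
  lt := h.lt
  start := h.finish
  finish := by rw [T.reverse_flow_geod, h.start]

theorem sinK_pos (h : Joins T d p q) : 0 < sinK K d := ConstCurv.sinK_pos h.pos h.lt

theorem rho_eq (h : Joins T d p q) : rho K p.1 q.1 = d := by
  rw [← h.start, ← h.finish, rho_geod T h.pos.le fun hK => (h.lt hK).le]

end Joins

variable {D : Set (Plane K)}

theorem GeodesicallyConvex.exists_joins (hD : GeodesicallyConvex D) {p q : Plane K} (hp : p ∈ D)
    (hq : q ∈ D) (hne : p ≠ q) (hanti : q.1 ≠ -p.1) : ∃ T d, Joins T d p q := by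
  obtain ⟨T, h1, h2, -⟩ := hD p hp q hq
  refine ⟨T, geodDist p q, ⟨?_, fun hK => ?_, h1, h2⟩⟩
  · refine lt_of_le_of_ne (geodDist_nonneg p q) fun h0 => hne ?_
    rw [← h0, T.geod_zero, h1] at h2
    exact h2
  · refine lt_of_le_of_ne (geodDist_le_pi h1 h2 hK) fun h0 => hanti ?_
    rw [← h2, h0, T.geod_val, sinK_pi hK, cosK_pi hK, h1]
    simp

/-! ### The distance of two points moving along geodesics -/

/-- The distance of the points of two geodesics at times `l.1` and `l.2`. -/
def pairDist (E F : UnitTangent K) (l : ℝ × ℝ) : ℝ := rho K (E.geod l.1).1 (F.geod l.2).1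

/-- The derivative of `pairDist` in the first variable. -/
def pairDist₁ (E F : UnitTangent K) (l : ℝ × ℝ) : ℝ :=
  ip K (E.flow l.1).vec ((E.geod l.1).1 - (F.geod l.2).1) / sinK K (pairDist E F l)

/-- The derivative of `pairDist` in the second variable. -/
def pairDist₂ (E F : UnitTangent K) (l : ℝ × ℝ) : ℝ :=
  ip K (F.flow l.2).vec ((F.geod l.2).1 - (E.geod l.1).1) / sinK K (pairDist E F l)

/-- The mixed second derivative of `pairDist`. -/
def pairDist₁₂ (E F : UnitTangent K) (l : ℝ × ℝ) : ℝ :=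
  E.form (F.geod l.2).1 * F.form (E.geod l.1).1 / sinK K (pairDist E F l) ^ 3

theorem pairDist_swap (E F : UnitTangent K) (l : ℝ × ℝ) :
    pairDist F E l.swap = pairDist E F l := rho_comm _ _ _

theorem pairDist₁_swap (E F : UnitTangent K) (l : ℝ × ℝ) :
    pairDist₁ F E l.swap = pairDist₂ E F l := by
  rw [pairDist₁, pairDist_swap]; rfl

theorem pairDist₂_swap (E F : UnitTangent K) (l : ℝ × ℝ) :
    pairDist₂ F E l.swap = pairDist₁ E F l := by
  rw [pairDist₂, pairDist_swap]; rfl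

theorem pairDist₁₂_swap (E F : UnitTangent K) (l : ℝ × ℝ) :
    pairDist₁₂ F E l.swap = pairDist₁₂ E F l := by
  rw [pairDist₁₂, pairDist_swap, mul_comm]; rfl

namespace Joins

variable {T E F : UnitTangent K} {d : ℝ} {l : ℝ × ℝ}

theorem pairDist_eq (h : Joins T d (E.geod l.1) (F.geod l.2)) : pairDist E F l = d := h.rho_eq

/-- First variation: minus the cosine of the angle between the edge and the chord. -/
theorem pairDist₁_eq (h : Joins T d (E.geod l.1) (F.geod l.2)) :
    pairDist₁ E F l = -ip K (E.flow l.1).vec T.vec := by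
  rw [pairDist₁, h.pairDist_eq, div_eq_iff h.sinK_pos.ne', ← h.start, ← h.finish,
    UnitTangent.ip_geod_sub T (E.flow l.1) h.start.symm]
  ring

theorem pairDist₂_eq (h : Joins T d (E.geod l.1) (F.geod l.2)) :
    pairDist₂ E F l = ip K (F.flow l.2).vec (T.flow d).vec := by
  rw [pairDist₂, h.pairDist_eq, div_eq_iff h.sinK_pos.ne', ← h.start, ← h.finish,
    UnitTangent.ip_geod_sub' T (F.flow l.2) d h.finish.symm]
  ring

theorem form_left (h : Joins T d (E.geod l.1) (F.geod l.2)) :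
    E.form (F.geod l.2).1 = sinK K d * E.form T.vec := by
  have := UnitTangent.form_geod_other T (E.flow l.1) h.start.symm d
  rwa [E.flow_form, h.finish] at this

theorem form_right (h : Joins T d (E.geod l.1) (F.geod l.2)) :
    F.form (E.geod l.1).1 = -(sinK K d * F.form (T.flow d).vec) := by
  have := UnitTangent.form_geod_other' T (F.flow l.2) d h.finish.symm
  rwa [F.flow_form, h.start] at this

/-- Up to sign, `sin α₁ sin α₂ / sin_K ρ`: the density of the invariant measure in arc-length
coordinates. -/
theorem pairDist₁₂_eq (h : Joins T d (E.geod l.1) (F.geod l.2)) :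
    pairDist₁₂ E F l = -(E.form T.vec * F.form (T.flow d).vec) / sinK K d := by
  have := h.sinK_pos.ne'
  rw [pairDist₁₂, h.pairDist_eq, h.form_left, h.form_right]
  field_simp

/-- The transport formula arranged as the quotient rule for `pairDist₂` produces it; this identifies
`pairDist₁₂` as the mixed derivative. -/
theorem ip_vec_vec (h : Joins T d (E.geod l.1) (F.geod l.2)) :
    -ip K (E.flow l.1).vec (F.flow l.2).vec =
      cosK K d * (pairDist₁ E F l * pairDist₂ E F l) + sinK K d * pairDist₁₂ E F l := by
  have := h.sinK_pos.ne'
  have e := UnitTangent.ip_vec_vec T (E.flow l.1) (F.flow l.2) d h.start.symm h.finish.symm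
  rw [E.flow_form, F.flow_form] at e
  rw [h.pairDist₁_eq, h.pairDist₂_eq, h.pairDist₁₂_eq, e]
  field_simp
  ring

theorem abs_pairDist₁_le (h : Joins T d (E.geod l.1) (F.geod l.2)) : |pairDist₁ E F l| ≤ 1 := by
  rw [h.pairDist₁_eq, abs_neg]
  have := UnitTangent.ip_sq_add_form_sq T (E.flow l.1) h.start.symm
  rw [← sq_le_one_iff_abs_le_one]
  nlinarith [sq_nonneg (T.form (E.flow l.1).vec)]

theorem abs_pairDist₂_le (h : Joins T d (E.geod l.1) (F.geod l.2)) : |pairDist₂ E F l| ≤ 1 := by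
  rw [h.pairDist₂_eq]
  have := UnitTangent.ip_sq_add_form_sq (T.flow d) (F.flow l.2) h.finish.symm
  rw [← sq_le_one_iff_abs_le_one]
  nlinarith [sq_nonneg ((T.flow d).form (F.flow l.2).vec)]

end Joins

/-! ### Chords of a convex polygon -/

theorem nonneg_of_sinK_nonneg {s : ℝ} (hs : s ∈ onePeriod K) (h : 0 ≤ sinK K s) : 0 ≤ s := by
  by_contra! h0
  have := sinK_pos (K := K) (x := -s) (by linarith) fun hK => by
    rw [onePeriod, if_pos hK] at hs
    linarith [hs.1]
  rw [sinK_neg] at this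
  linarith

/-- The equation says `cot α = -B / A`, which has the single solution `π / 2 - arctan (-B / A)` in
`(0, π)`; hence the supremum is that angle. -/
theorem cot_sSup {A B : ℝ} (hA : A ≠ 0) {S : Set ℝ}
    (hS : ∀ α, α ∈ S ↔ 0 < α ∧ α < π ∧ Real.cos α * A + Real.sin α * B = 0) :
    Real.cot (sSup S) = -B / A := by
  have h0 : π / 2 - Real.arctan (-B / A) ∈ S := by
    have h1 := Real.neg_pi_div_two_lt_arctan (-B / A)
    have h2 := Real.arctan_lt_pi_div_two (-B / A)
    refine (hS _).2 ⟨by linarith, by linarith, ?_⟩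
    rw [Real.cos_pi_div_two_sub, Real.sin_pi_div_two_sub]
    have h3 := Real.tan_arctan (-B / A)
    have h4 : Real.cos (Real.arctan (-B / A)) ≠ 0 := (Real.cos_arctan_pos _).ne'
    rw [Real.tan_eq_sin_div_cos, div_eq_div_iff h4 hA] at h3
    linarith
  set α₀ := π / 2 - Real.arctan (-B / A)
  have huniq : S = {α₀} := by
    ext α
    refine ⟨fun h => ?_, fun h => by rw [h]; exact h0⟩
    obtain ⟨h1, h2, h3⟩ := (hS _).1 h
    obtain ⟨g1, g2, g3⟩ := (hS _).1 h0
    have : Real.sin (α - α₀) = 0 := by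
      rw [Real.sin_sub]
      apply mul_left_cancel₀ hA
      linear_combination Real.sin α * g3 - Real.sin α₀ * h3
    rw [Real.sin_eq_zero_iff_of_lt_of_lt (by linarith) (by linarith)] at this
    exact sub_eq_zero.1 this
  rw [huniq, csSup_singleton]
  obtain ⟨g1, g2, g3⟩ := (hS _).1 h0
  rw [Real.cot_eq_cos_div_sin, div_eq_div_iff (Real.sin_pos_of_pos_of_lt_pi g1 g2).ne' hA]
  linarith

/-- The data of a chord joining interior points of two different edges. -/
structure IsChord {n : ℕ} (a : Fin n → UnitTangent K) (len : Fin n → ℝ) (i j : Fin n)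
    (l : ℝ × ℝ) (T : UnitTangent K) (d : ℝ) : Prop where
  ne : i ≠ j
  mem_left : l.1 ∈ Set.Ioo 0 (len i)
  mem_right : l.2 ∈ Set.Ioo 0 (len j)
  joins : Joins T d ((a i).geod l.1) ((a j).geod l.2)

theorem IsChord.reverse {n : ℕ} {a : Fin n → UnitTangent K} {len : Fin n → ℝ} {i j : Fin n}
    {l : ℝ × ℝ} {T : UnitTangent K} {d : ℝ} (hc : IsChord a len i j l T d) :
    IsChord a len j i l.swap ((T.flow d).rotate π) d :=
  ⟨hc.ne.symm, hc.mem_right, hc.mem_left, hc.joins.reverse⟩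

namespace IsConvexPolygon

variable {n : ℕ} [NeZero n] {a : Fin n → UnitTangent K} {len : Fin n → ℝ}
  {i j : Fin n} {l : ℝ × ℝ} {T : UnitTangent K} {d : ℝ}
  (h : IsConvexPolygon D a len)

include h

theorem exists_joins {i j : Fin n} {s t : ℝ} (hij : i ≠ j) (hs : s ∈ Set.Icc 0 (len i))
    (ht : t ∈ Set.Ioo 0 (len j)) : ∃ T d, Joins T d ((a i).geod s) ((a j).geod t) := by
  refine h.convex.exists_joins (h.geod_mem hs) (h.geod_mem ⟨ht.1.le, ht.2.le⟩)
    (fun e => hij (h.simple' hs ht e).1) fun e => ?_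
  exact h.val_ne_neg ht (h.geod_mem hs) (by rw [e, neg_neg])

theorem exists_chord {i j : Fin n} (hij : i ≠ j) (h1 : l.1 ∈ Set.Ioo 0 (len i))
    (h2 : l.2 ∈ Set.Ioo 0 (len j)) : ∃ T d, IsChord a len i j l T d := by
  obtain ⟨T, d, hT⟩ := h.exists_joins hij ⟨h1.1.le, h1.2.le⟩ h2
  exact ⟨T, d, hij, h1, h2, hT⟩

/-- The chord points into `D` across edge `i` and out of it across edge `j`; strictly, because each
end lies off the geodesic of the other edge. -/
theorem chord_form (hc : IsChord a len i j l T d) {σ : ℝ} (hσ : σ ≠ 0)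
    (hf : ∀ i, ∀ p ∈ D, 0 ≤ σ * (a i).form p.1) :
    0 < σ * (a i).form T.vec ∧ σ * (a j).form (T.flow d).vec < 0 := by
  have h1 := h.form_geod_ne_zero hc.ne hc.mem_right
  have h2 := h.form_geod_ne_zero hc.ne.symm hc.mem_left
  have g1 := hf i _ (h.geod_mem ⟨hc.mem_right.1.le, hc.mem_right.2.le⟩)
  have g2 := hf j _ (h.geod_mem ⟨hc.mem_left.1.le, hc.mem_left.2.le⟩)
  have g1 := lt_of_le_of_ne g1 (mul_ne_zero hσ h1).symm
  have g2 := lt_of_le_of_ne g2 (mul_ne_zero hσ h2).symm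
  rw [hc.joins.form_left] at g1
  rw [hc.joins.form_right] at g2
  have hs := hc.joins.sinK_pos
  constructor
  · by_contra! hcon
    nlinarith
  · by_contra! hcon
    nlinarith

theorem pairDist₁₂_pos (hc : IsChord a len i j l T d) : 0 < pairDist₁₂ (a i) (a j) l := by
  obtain ⟨σ, hσ, hf⟩ := h.exists_orientation
  obtain ⟨h1, h2⟩ := h.chord_form hc hσ hf
  rw [hc.joins.pairDist₁₂_eq]
  refine div_pos ?_ hc.joins.sinK_pos
  have := mul_pos_of_neg_of_neg (mul_neg_of_pos_of_neg h1 h2) (neg_one_lt_zero)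
  have h3 : 0 < σ ^ 2 := by positivity
  by_contra! hcon
  nlinarith

/-- Before time `0` the geodesic is on the wrong side of edge `i`, after time `d` on the wrong side
of edge `j`; in between it stays in `D` by convexity. -/
theorem chord_mem_iff (hc : IsChord a len i j l T d) {s : ℝ} (hs : s ∈ onePeriod K) :
    T.geod s ∈ D ↔ 0 ≤ s ∧ s ≤ d := by
  have hd := hc.joins.sinK_pos
  constructor
  · intro hm
    obtain ⟨σ, hσ, hf⟩ := h.exists_orientation
    obtain ⟨h1, h2⟩ := h.chord_form hc hσ hf
    have g1 := hf i _ hm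
    have e1 := UnitTangent.form_geod_other T ((a i).flow l.1) hc.joins.start.symm s
    rw [(a i).flow_form] at e1
    rw [e1] at g1
    have h3 : 0 ≤ s := nonneg_of_sinK_nonneg hs (by
      by_contra! hcon
      nlinarith)
    refine ⟨h3, ?_⟩
    by_contra! hlt
    have h4 : 0 < sinK K (s - d) := sinK_pos (by linarith) fun hK => by
      rw [onePeriod, if_pos hK] at hs
      linarith [hs.2, hc.joins.pos]
    have e2 := UnitTangent.form_geod_other (T.flow d) ((a j).flow l.2)
      hc.joins.finish.symm (s - d)
    rw [(a j).flow_form, T.flow_geod, add_sub_cancel] at e2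
    have g2 := hf j _ hm
    rw [e2] at g2
    nlinarith
  · rintro ⟨h0, h1⟩
    apply mem_of_val_mem_cone
    have e : (T.geod s).1 = (sinK K (d - s) / sinK K d) • T.pt.1 +
        (sinK K s / sinK K d) • (T.geod d).1 := by
      apply smul_right_injective _ hd.ne'
      simp only [smul_add, smul_smul, mul_div_cancel₀ _ hd.ne']
      exact T.combination_geod s d
    rw [e, hc.joins.start, hc.joins.finish]
    refine h.convex.cone_mem
      (val_mem_cone (h.geod_mem ⟨hc.mem_left.1.le, hc.mem_left.2.le⟩))
      (val_mem_cone (h.geod_mem ⟨hc.mem_right.1.le, hc.mem_right.2.le⟩))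
      (div_nonneg (sinK_nonneg (by linarith) fun hK => ?_) hd.le)
      (div_nonneg (sinK_nonneg h0 fun hK => ?_) hd.le)
    · linarith [hc.joins.lt hK]
    · linarith [hc.joins.lt hK]

theorem isEntry (hc : IsChord a len i j l T d) : IsEntry D T := by
  constructor
  · rw [hc.joins.start]
    exact h.geod_mem ⟨hc.mem_left.1.le, hc.mem_left.2.le⟩
  · have h1 : ∀ᶠ r in 𝓝[>] (0 : ℝ), 0 < K → r < π / √K := by
      by_cases hK : 0 < K
      · have : ∀ᶠ r in 𝓝[>] (0 : ℝ), r < π / √K :=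
          nhdsWithin_le_nhds (Iio_mem_nhds (pi_div_sqrt_pos hK))
        filter_upwards [this] with r hr _
        exact hr
      · exact Eventually.of_forall fun r hK' => absurd hK' hK
    filter_upwards [h1, self_mem_nhdsWithin] with r hr hr0
    have hr0 : 0 < r := hr0
    have hmem : -r ∈ onePeriod K := by
      rw [onePeriod]
      split_ifs with hK
      · have := hr hK
        have := pi_div_sqrt_pos hK
        exact ⟨by linarith, by linarith⟩
      · trivial
    rw [h.chord_mem_iff hc hmem]
    intro hcon
    linarith [hcon.1]

theorem flow_eq_of_isEntry (hc : IsChord a len i j l T d) {s : ℝ} (hs : IsEntry D (T.flow s)) :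
    T.flow s = T := by
  obtain ⟨t, ht, e⟩ := T.exists_onePeriod s
  rw [e] at hs ⊢
  obtain ⟨h1, h2⟩ := (h.chord_mem_iff hc ht).1 hs.1
  rcases h1.eq_or_lt with rfl | h1
  · exact T.flow_zero
  · exfalso
    have h3 : ∀ᶠ r in 𝓝[>] (0 : ℝ), r < t := nhdsWithin_le_nhds (Iio_mem_nhds h1)
    obtain ⟨r, ⟨h4, h5⟩, h6⟩ := ((hs.2.and h3).and self_mem_nhdsWithin).exists
    have h6 : 0 < r := h6
    apply h4
    rw [T.flow_geod]
    refine (h.chord_mem_iff hc ?_).2 ⟨by linarith, by linarith⟩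
    rw [onePeriod] at ht ⊢
    split_ifs at ht ⊢ with hK
    · have := pi_div_sqrt_pos hK
      exact ⟨by linarith, by linarith [ht.2]⟩
    · trivial

/-- An interior edge point lies inside a segment of `D`, so boundary directions there are exactly
the two directions of the edge. -/
theorem isBoundaryDirection_iff {S : UnitTangent K} {s : ℝ} (hs : s ∈ Set.Ioo 0 (len i))
    (hS : S.pt = (a i).geod s) : IsBoundaryDirection D S ↔ (a i).form S.vec = 0 := by
  constructor
  · intro hb
    obtain ⟨x, hx, y, hy, α, hα, β, hβ, e, k, hk, hdet⟩ := h.exists_split hs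
    have := det3_eq_zero_of_isBoundaryDirection h.convex h.closed hα hβ hx hy S (by rw [hS, e]) hb
    rw [hdet] at this
    exact (mul_eq_zero.1 this).resolve_left hk
  · intro h0
    have e1 := UnitTangent.vec_eq ((a i).flow s) S hS
    have e2 := UnitTangent.ip_sq_add_form_sq ((a i).flow s) S hS
    rw [(a i).flow_form, h0] at e1 e2
    rw [zero_smul, add_zero] at e1
    have h2 : (ip K S.vec ((a i).flow s).vec - 1) * (ip K S.vec ((a i).flow s).vec + 1) = 0 := by
      linarith
    rcases mul_eq_zero.1 h2 with h3 | h3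
    · rw [show S = (a i).flow s from UnitTangent.ext' hS (by
        rw [e1, show ip K S.vec ((a i).flow s).vec = 1 by linarith, one_smul])]
      exact h.isBoundaryDirection_flow ⟨hs.1.le, hs.2⟩
    · rw [show S = ((a i).flow s).rotate π from UnitTangent.ext' hS (by
        rw [UnitTangent.reverse_vec, e1, show ip K S.vec ((a i).flow s).vec = -1 by linarith,
          neg_one_smul])]
      exact h.isBoundaryDirection_reverse ⟨hs.1, hs.2.le⟩

/-- The entry point is unique up to the period, and the rotation by `α` is along the edge iff `cos α
* A + sin α * B = 0`, with `A` and `B` the edge form on `T.vec` and on the normal. Here `B` is the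
cosine `-pairDist₁`. -/
theorem cot_startAngle (hc : IsChord a len i j l T d) {S : UnitTangent K} {s₀ : ℝ}
    (hS : S.flow s₀ = T) :
    Real.cot (startAngle D S) = pairDist₁ (a i) (a j) l / (a i).form T.vec := by
  obtain ⟨σ, hσ, hf⟩ := h.exists_orientation
  have hne : (a i).form T.vec ≠ 0 := right_ne_zero_of_mul (h.chord_form hc hσ hf).1.ne'
  have hN := UnitTangent.form_normal T ((a i).flow l.1) hc.joins.start.symm
  rw [(a i).flow_form] at hN
  rw [hc.joins.pairDist₁_eq, ← hN]
  refine cot_sSup hne fun α => ?_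
  have hmem : (∃ s : ℝ, IsEntry D (S.flow s) ∧ IsBoundaryDirection D ((S.flow s).rotate α)) ↔
      Real.cos α * (a i).form T.vec + Real.sin α * (a i).form T.normalVec = 0 := by
    rw [← UnitTangent.form_smul_add_smul, ← T.rotate_vec,
      ← h.isBoundaryDirection_iff hc.mem_left (S := T.rotate α) hc.joins.start]
    constructor
    · rintro ⟨s, h1, h2⟩
      have e : S.flow s = T.flow (s - s₀) := by rw [← hS, S.flow_flow, add_sub_cancel]
      rw [e] at h1 h2
      rwa [h.flow_eq_of_isEntry hc h1] at h2
    · intro hb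
      exact ⟨s₀, by rw [hS]; exact h.isEntry hc, by rwa [hS]⟩
  rw [← hmem]
  rfl

theorem cot_endAngle (hc : IsChord a len i j l T d) {S : UnitTangent K} {s₀ : ℝ}
    (hS : S.flow s₀ = T) :
    Real.cot (endAngle D S) = pairDist₂ (a i) (a j) l / (a j).form (T.flow d).vec := by
  obtain ⟨σ, hσ, hf⟩ := h.exists_orientation
  have hne : (a j).form (T.flow d).vec ≠ 0 := right_ne_zero_of_mul (h.chord_form hc hσ hf).2.ne
  have hN := UnitTangent.form_normal (T.flow d) ((a j).flow l.2) hc.joins.finish.symm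
  rw [(a j).flow_form] at hN
  -- The angle is measured by rotating through `π - α`, which changes the sign of the cosine
  -- coefficient.
  rw [hc.joins.pairDist₂_eq, ← hN, ← neg_div_neg_eq]
  refine cot_sSup (neg_ne_zero.2 hne) fun α => ?_
  have hr := hc.reverse
  have hmem : (∃ s : ℝ, IsEntry D ((S.flow s).rotate π) ∧
      IsBoundaryDirection D ((S.flow s).rotate (π - α))) ↔
      Real.cos α * -(a j).form (T.flow d).vec
        + Real.sin α * (a j).form (T.flow d).normalVec = 0 := by
    have e : (a j).form ((T.flow d).rotate (π - α)).vec = Real.cos α * -(a j).form (T.flow d).vec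
        + Real.sin α * (a j).form (T.flow d).normalVec := by
      rw [UnitTangent.rotate_vec, UnitTangent.form_smul_add_smul, Real.cos_pi_sub,
        Real.sin_pi_sub]
      ring
    rw [← e, ← h.isBoundaryDirection_iff hc.mem_right (S := (T.flow d).rotate (π - α))
      hc.joins.finish]
    constructor
    · rintro ⟨s, h1, h2⟩
      have e : (S.flow s).rotate π = ((T.flow d).rotate π).flow (d - (s - s₀)) := by
        rw [UnitTangent.reverse_flow, T.flow_flow, ← hS, S.flow_flow]
        congr 2; ring
      rw [e] at h1
      have e2 := h.flow_eq_of_isEntry hr h1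
      rw [← e] at e2
      have e3 : S.flow s = T.flow d := by
        rw [← UnitTangent.reverse_reverse (S.flow s), e2, UnitTangent.reverse_reverse]
      rwa [e3] at h2
    · intro hb
      refine ⟨s₀ + d, ?_, ?_⟩ <;> rw [← S.flow_flow, hS]
      · exact h.isEntry hr
      · exact hb
  rw [← hmem]
  rfl

theorem chordLength_eq (hc : IsChord a len i j l T d) {S : UnitTangent K} {s₀ : ℝ}
    (hS : S.flow s₀ = T) : chordLength D S = pairDist (a i) (a j) l := by
  rw [hc.joins.pairDist_eq]
  have hg : ∀ s, S.geod s = T.geod (s - s₀) := fun s => by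
    rw [← hS, S.flow_geod, add_sub_cancel]
  have hd := hc.joins.pos
  suffices hvol : MeasureTheory.volume {s : ℝ | s ∈ onePeriod K ∧ S.geod s ∈ D} =
      MeasureTheory.volume (Set.Icc s₀ (s₀ + d)) by
    rw [chordLength, hvol, Real.volume_Icc, add_sub_cancel_left, ENNReal.toReal_ofReal hd.le]
  by_cases hK : 0 < K
  · have hpi := pi_div_sqrt_pos hK
    have hp : 0 < 2 * (π / √K) := by positivity
    have hA : MeasurableSet {s : ℝ | S.geod s ∈ D} :=
      (h.closed.preimage S.continuous_geod).measurableSet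
    -- Seen from `S`, the chord may straddle the end of the period. Its measure is the same over the
    -- period shifted by `s₀`, where it is the interval `[s₀, s₀ + d]`.
    have f1 := isAddFundamentalDomain_Ioc hp (-(π / √K))
    have f2 := isAddFundamentalDomain_Ioc hp (-(π / √K) + s₀)
    have hper : Function.Periodic S.geod (2 * (π / √K)) :=
      fun s => S.geod_add_period hK s
    have key := f1.measure_set_eq f2 hA (by
      rintro ⟨g, k, rfl⟩
      ext s
      simp only [Set.mem_preimage, Set.mem_ofPred_eq, AddSubgroup.vadd_def, vadd_eq_add]
      rw [add_comm, hper.zsmul k])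
    have e1 : {s : ℝ | s ∈ onePeriod K ∧ S.geod s ∈ D} =
        {s : ℝ | S.geod s ∈ D} ∩ Set.Ioc (-(π / √K)) (-(π / √K) + 2 * (π / √K)) := by
      rw [show -(π / √K) + 2 * (π / √K) = π / √K by ring]
      ext s
      simp only [onePeriod, if_pos hK, Set.mem_ofPred_eq, Set.mem_inter_iff]
      exact and_comm
    rw [e1, key]
    congr 1
    ext s
    have hlt := hc.joins.lt hK
    constructor
    · rintro ⟨h1, h2⟩
      simp only [Set.mem_ofPred_eq, hg] at h1
      have := (h.chord_mem_iff hc (by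
        rw [onePeriod, if_pos hK]
        exact ⟨by linarith [h2.1], by linarith [h2.2]⟩)).1 h1
      exact ⟨by linarith, by linarith⟩
    · rintro ⟨h1, h2⟩
      refine ⟨?_, by linarith, by linarith⟩
      simp only [Set.mem_ofPred_eq, hg]
      refine (h.chord_mem_iff hc ?_).2 ⟨by linarith, by linarith⟩
      rw [onePeriod, if_pos hK]
      exact ⟨by linarith, by linarith⟩
  · congr 1
    ext s
    simp only [onePeriod, if_neg hK, Set.mem_univ, true_and, Set.mem_ofPred_eq, hg]
    rw [h.chord_mem_iff hc (by simp [onePeriod, hK])]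
    constructor
    · rintro ⟨h1, h2⟩; exact ⟨by linarith, by linarith⟩
    · rintro ⟨h1, h2⟩; exact ⟨by linarith, by linarith⟩

/-- The angular factor of the chord, expressed by the arc length positions of its endpoints. -/
theorem sinK_mul_cot_mul_cot (hc : IsChord a len i j l T d) {S : UnitTangent K} {s₀ : ℝ}
    (hS : S.flow s₀ = T) :
    sinK K (pairDist (a i) (a j) l) * Real.cot (startAngle D S) * Real.cot (endAngle D S) =
      -(pairDist₁ (a i) (a j) l * pairDist₂ (a i) (a j) l) / pairDist₁₂ (a i) (a j) l := by
  obtain ⟨σ, hσ, hf⟩ := h.exists_orientation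
  have h1 : (a i).form T.vec ≠ 0 := right_ne_zero_of_mul (h.chord_form hc hσ hf).1.ne'
  have h2 : (a j).form (T.flow d).vec ≠ 0 := right_ne_zero_of_mul (h.chord_form hc hσ hf).2.ne
  have h3 := hc.joins.sinK_pos.ne'
  rw [h.cot_startAngle hc hS, h.cot_endAngle hc hS, hc.joins.pairDist₁₂_eq, hc.joins.pairDist_eq]
  field_simp

end IsConvexPolygon

end ConstCurv

end

/-! ### Derivatives of the distance -/

noncomputable section

namespace ConstCurv

open Real Filter Topology MeasureTheory

variable {K : ℝ}

theorem UnitTangent.hasDerivAt_geod (T : UnitTangent K) (s : ℝ) (k : Fin 3) :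
    HasDerivAt (fun s => (T.geod s).1 k) ((T.flow s).vec k) s := by
  have := ((hasDerivAt_cosK K s).mul_const (T.pt.1 k)).add
    ((hasDerivAt_sinK K s).mul_const (T.vec k))
  refine this.congr_deriv ?_
  simp [T.flow_vec]

theorem hasDerivAt_ip_sub_self (E : UnitTangent K) (q : Fin 3 → ℝ) (s : ℝ) :
    HasDerivAt (fun s => ip K ((E.geod s).1 - q) ((E.geod s).1 - q))
      (2 * ip K (E.flow s).vec ((E.geod s).1 - q)) s := by
  have h0 := (E.hasDerivAt_geod s 0).sub_const (q 0)
  have h1 := (E.hasDerivAt_geod s 1).sub_const (q 1)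
  have h2 := (E.hasDerivAt_geod s 2).sub_const (q 2)
  refine (((h1.mul h1).add (h2.mul h2)).add ((h0.mul h0).div_const K)).congr_deriv ?_
  simp only [ip, Pi.sub_apply]
  ring

theorem hasDerivAt_ip_sub (E : UnitTangent K) (v q : Fin 3 → ℝ) (s : ℝ) :
    HasDerivAt (fun s => ip K v (q - (E.geod s).1)) (-ip K (E.flow s).vec v) s := by
  have h0 := ((E.hasDerivAt_geod s 0).const_sub (q 0)).const_mul (v 0)
  have h1 := ((E.hasDerivAt_geod s 1).const_sub (q 1)).const_mul (v 1)
  have h2 := ((E.hasDerivAt_geod s 2).const_sub (q 2)).const_mul (v 2)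
  refine ((h1.add h2).add (h0.div_const K)).congr_deriv ?_
  simp only [ip]
  ring

namespace Joins

variable {T E F : UnitTangent K} {d : ℝ} {l : ℝ × ℝ}

/-- Chain rule in `2 * arcsinK (√g / 2)`: `0 < d` is needed for the root and `d < π / √K` for
`arcsinK`; the factors combine through `sin_K d = 2 sin_K(d/2) cos_K(d/2)`. -/
theorem hasDerivAt_left (h : Joins T d (E.geod l.1) (F.geod l.2)) :
    HasDerivAt (fun s => pairDist E F (s, l.2)) (pairDist₁ E F l) l.1 := by
  have hd2 : 0 < K → d / 2 < π / (2 * √K) := fun hK => by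
    have := h.lt hK
    rw [mul_comm, ← div_div]; linarith
  have hd := h.pos
  have hs : 0 < sinK K (d / 2) := ConstCurv.sinK_pos (by linarith) fun hK => by
    linarith [h.lt hK]
  have hc : 0 < cosK K (d / 2) := cosK_pos_of_lt (by linarith) hd2
  have hK : K * sinK K (d / 2) ^ 2 < 1 := by
    have := cosK_sq_add K (d / 2)
    have : 0 < cosK K (d / 2) ^ 2 := by positivity
    linarith
  have hg : ip K ((E.geod l.1).1 - (F.geod l.2).1) ((E.geod l.1).1 - (F.geod l.2).1) =
      (2 * sinK K (d / 2)) ^ 2 := by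
    rw [← ip_sub_self_geod T d, h.start, h.finish]
  have hsq : √(ip K ((E.geod l.1).1 - (F.geod l.2).1) ((E.geod l.1).1 - (F.geod l.2).1)) =
      2 * sinK K (d / 2) := by
    rw [hg, Real.sqrt_sq (by linarith)]
  have h1 := ((hasDerivAt_ip_sub_self E (F.geod l.2).1 l.1).sqrt (by
    rw [hg]; positivity)).div_const 2
  have h2 := hasDerivAt_arcsinK hs hK
  rw [arcsinK_sinK (by linarith) fun hK => (hd2 hK).le] at h2
  have h3 : √(ip K ((E.geod l.1).1 - (F.geod l.2).1) ((E.geod l.1).1 - (F.geod l.2).1)) / 2 =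
      sinK K (d / 2) := by
    rw [hsq]; ring
  rw [← h3] at h2
  refine ((h2.comp l.1 h1).const_mul 2).congr_deriv ?_
  rw [hsq, pairDist₁, h.pairDist_eq]
  have e := sinK_two_mul K (d / 2)
  rw [mul_div_cancel₀ _ two_ne_zero] at e
  rw [e]
  field_simp

theorem hasDerivAt_right (h : Joins T d (E.geod l.1) (F.geod l.2)) :
    HasDerivAt (fun t => pairDist E F (l.1, t)) (pairDist₂ E F l) l.2 := by
  have := Joins.hasDerivAt_left (E := F) (F := E) (l := l.swap) h.reverse
  rw [pairDist₁_swap] at this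
  refine this.congr_of_eventuallyEq (Eventually.of_forall fun t => ?_)
  exact pairDist_swap F E (t, l.1)

theorem hasDerivAt_pairDist₂ (h : Joins T d (E.geod l.1) (F.geod l.2)) :
    HasDerivAt (fun s => pairDist₂ E F (s, l.2)) (pairDist₁₂ E F l) l.1 := by
  have hs := h.sinK_pos.ne'
  have h1 := hasDerivAt_ip_sub E (F.flow l.2).vec (F.geod l.2).1 l.1
  have h2 := (hasDerivAt_sinK K _).comp l.1 h.hasDerivAt_left
  have h3 : (sinK K ∘ fun s => pairDist E F (s, l.2)) l.1 ≠ 0 := by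
    change sinK K (pairDist E F l) ≠ 0
    rwa [h.pairDist_eq]
  refine (h1.div h2 h3).congr_deriv ?_
  have e := h.ip_vec_vec
  have e2 : ip K (F.flow l.2).vec ((F.geod l.2).1 - (E.geod l.1).1) =
      pairDist₂ E F l * sinK K d := by
    rw [pairDist₂, h.pairDist_eq, div_mul_cancel₀ _ hs]
  change (_ * sinK K (pairDist E F l) - _ * (cosK K (pairDist E F l) * _)) /
    sinK K (pairDist E F l) ^ 2 = _
  rw [h.pairDist_eq, e2, e]
  field_simp
  ring

end Joins

theorem UnitTangent.continuous_flow_vec (T : UnitTangent K) :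
    Continuous fun s => (T.flow s).vec := by
  have := continuous_sinK K
  have := continuous_cosK K
  unfold UnitTangent.flow
  fun_prop

theorem continuous_pairDist (E F : UnitTangent K) : Continuous (pairDist E F) :=
  continuous_rho K ((continuous_plane_val K).comp (E.continuous_geod.comp continuous_fst))
    ((continuous_plane_val K).comp (F.continuous_geod.comp continuous_snd))

theorem measurable_pairDist₂ (E F : UnitTangent K) : Measurable (pairDist₂ E F) := by
  have c1 : Continuous fun l : ℝ × ℝ => (E.geod l.1).1 :=
    (continuous_plane_val K).comp (E.continuous_geod.comp continuous_fst)
  have c2 : Continuous fun l : ℝ × ℝ => (F.geod l.2).1 :=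
    (continuous_plane_val K).comp (F.continuous_geod.comp continuous_snd)
  exact (continuous_ip K (F.continuous_flow_vec.comp continuous_snd) (c2.sub c1)).measurable.div
    ((continuous_sinK K).comp (continuous_pairDist E F)).measurable

theorem measurable_pairDist₁ (E F : UnitTangent K) : Measurable (pairDist₁ E F) := by
  have := (measurable_pairDist₂ F E).comp measurable_swap
  convert this using 1
  funext l
  exact (pairDist₂_swap E F l).symm

theorem measurable_pairDist₁₂ (E F : UnitTangent K) : Measurable (pairDist₁₂ E F) := by
  have c1 : Continuous fun l : ℝ × ℝ => (E.geod l.1).1 :=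
    (continuous_plane_val K).comp (E.continuous_geod.comp continuous_fst)
  have c2 : Continuous fun l : ℝ × ℝ => (F.geod l.2).1 :=
    (continuous_plane_val K).comp (F.continuous_geod.comp continuous_snd)
  exact ((E.continuous_form.comp c2).mul (F.continuous_form.comp c1)).measurable.div
    (((continuous_sinK K).comp (continuous_pairDist E F)).pow 3).measurable

variable {D : Set (Plane K)}

/-! ### Integrals over the rectangle of two edges -/

namespace IsConvexPolygon

variable {n : ℕ} [NeZero n] {a : Fin n → UnitTangent K} {len : Fin n → ℝ}
  {i j : Fin n} {l : ℝ × ℝ} {T : UnitTangent K} {d : ℝ}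
  (h : IsConvexPolygon D a len)

include h

theorem continuousOn_pairDist₂ (hij : i ≠ j) {t : ℝ} (ht : t ∈ Set.Ioo 0 (len j)) :
    ContinuousOn (fun s => pairDist₂ (a i) (a j) (s, t)) (Set.Icc 0 (len i)) := fun s hs => by
  obtain ⟨T, d, hT⟩ := h.exists_joins hij hs ht
  exact (Joins.hasDerivAt_pairDist₂ (l := (s, t)) hT).continuousAt.continuousWithinAt

theorem abs_pairDist₂_le (hij : i ≠ j) {s t : ℝ} (hs : s ∈ Set.Icc 0 (len i))
    (ht : t ∈ Set.Ioo 0 (len j)) : |pairDist₂ (a i) (a j) (s, t)| ≤ 1 := by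
  obtain ⟨T, d, hT⟩ := h.exists_joins hij hs ht
  exact Joins.abs_pairDist₂_le (l := (s, t)) hT

theorem hasDerivAt_pairDist₂ (hij : i ≠ j) {s t : ℝ} (hs : s ∈ Set.Icc 0 (len i))
    (ht : t ∈ Set.Ioo 0 (len j)) :
    HasDerivAt (fun s => pairDist₂ (a i) (a j) (s, t)) (pairDist₁₂ (a i) (a j) (s, t)) s := by
  obtain ⟨T, d, hT⟩ := h.exists_joins hij hs ht
  exact Joins.hasDerivAt_pairDist₂ (l := (s, t)) hT

theorem pairDist₁₂_pos_of_mem (hij : i ≠ j) (hl : l ∈ Set.Ioo 0 (len i) ×ˢ Set.Ioo 0 (len j)) :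
    0 < pairDist₁₂ (a i) (a j) l := by
  obtain ⟨T, d, hT⟩ := h.exists_chord hij hl.1 hl.2
  exact h.pairDist₁₂_pos hT

/-- `pairDist₁₂` can blow up at a common vertex of adjacent edges. It is, however, a positive
derivative of `pairDist₂`, which is bounded by `1`, so each slice is integrable with integral at
most `2`. -/
theorem integrableOn_pairDist₁₂ (hij : i ≠ j) :
    IntegrableOn (pairDist₁₂ (a i) (a j)) (Set.Ioo 0 (len i) ×ˢ Set.Ioo 0 (len j)) := by
  have hL := (h.poly.len_pos i).le
  rw [IntegrableOn, Measure.volume_eq_prod, ← Measure.prod_restrict,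
    integrable_prod_iff' (measurable_pairDist₁₂ _ _).aestronglyMeasurable]
  have key : ∀ t ∈ Set.Ioo 0 (len j),
      IntegrableOn (fun s => pairDist₁₂ (a i) (a j) (s, t)) (Set.Ioc 0 (len i)) := fun t ht =>
    intervalIntegral.integrableOn_deriv_of_nonneg (h.continuousOn_pairDist₂ hij ht)
      (fun s hs => h.hasDerivAt_pairDist₂ hij ⟨hs.1.le, hs.2.le⟩ ht)
      (fun s hs => (h.pairDist₁₂_pos_of_mem hij ⟨hs, ht⟩).le)
  constructor
  · filter_upwards [ae_restrict_mem measurableSet_Ioo] with t ht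
    exact (key t ht).mono_set Set.Ioo_subset_Ioc_self
  · have hb : Integrable (fun t => pairDist₂ (a i) (a j) (len i, t) - pairDist₂ (a i) (a j) (0, t))
        (volume.restrict (Set.Ioo 0 (len j))) := by
      refine Integrable.of_bound (C := 2) ?_ ?_
      · exact (((measurable_pairDist₂ _ _).comp measurable_prodMk_left).sub
          ((measurable_pairDist₂ _ _).comp measurable_prodMk_left)).aestronglyMeasurable
      · filter_upwards [ae_restrict_mem measurableSet_Ioo] with t ht
        have h1 := h.abs_pairDist₂_le hij ⟨hL, le_rfl⟩ ht
        have h2 := h.abs_pairDist₂_le hij ⟨le_rfl, hL⟩ ht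
        rw [Real.norm_eq_abs]
        exact (abs_sub _ _).trans (by linarith)
    refine hb.congr ?_
    filter_upwards [ae_restrict_mem measurableSet_Ioo] with t ht
    rw [← intervalIntegral.integral_eq_sub_of_hasDerivAt_of_le hL
      (h.continuousOn_pairDist₂ hij ht)
      (fun s hs => h.hasDerivAt_pairDist₂ hij ⟨hs.1.le, hs.2.le⟩ ht)
      ((intervalIntegrable_iff_integrableOn_Ioc_of_le hL).2 (key t ht)),
      intervalIntegral.integral_of_le hL, integral_Ioc_eq_integral_Ioo]
    refine setIntegral_congr_fun measurableSet_Ioo fun s hs => ?_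
    exact (Real.norm_of_nonneg (h.pairDist₁₂_pos_of_mem hij ⟨hs, ht⟩).le).symm

omit [NeZero n] h in
theorem exists_bound_comp_pairDist {g : ℝ → ℝ} (hg : Continuous g) (E F : UnitTangent K) (L L' : ℝ) :
    ∃ C, ∀ l ∈ Set.Icc 0 L ×ˢ Set.Icc 0 L', |g (pairDist E F l)| ≤ C := by
  obtain ⟨C, hC⟩ := (isCompact_Icc.prod isCompact_Icc).exists_bound_of_continuousOn
    (hg.comp (continuous_pairDist E F)).continuousOn (s := Set.Icc 0 L ×ˢ Set.Icc 0 L')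
  exact ⟨C, hC⟩

theorem integrableOn_comp_mul_pairDist₁₂ (hij : i ≠ j) {g : ℝ → ℝ} (hg : Continuous g) :
    IntegrableOn (fun l => g (pairDist (a i) (a j) l) * pairDist₁₂ (a i) (a j) l)
      (Set.Ioo 0 (len i) ×ˢ Set.Ioo 0 (len j)) := by
  obtain ⟨C, hC⟩ := exists_bound_comp_pairDist hg (a i) (a j) (len i) (len j)
  refine (h.integrableOn_pairDist₁₂ hij).bdd_mul (c := C)
    (hg.comp (continuous_pairDist _ _)).aestronglyMeasurable ?_
  filter_upwards [ae_restrict_mem (measurableSet_Ioo.prod measurableSet_Ioo)] with l hl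
  exact hC l ⟨⟨hl.1.1.le, hl.1.2.le⟩, ⟨hl.2.1.le, hl.2.2.le⟩⟩

theorem integrableOn_comp_mul_pairDist₁_mul_pairDist₂ (hij : i ≠ j) {g : ℝ → ℝ}
    (hg : Continuous g) :
    IntegrableOn (fun l => g (pairDist (a i) (a j) l) *
      (pairDist₁ (a i) (a j) l * pairDist₂ (a i) (a j) l))
      (Set.Ioo 0 (len i) ×ˢ Set.Ioo 0 (len j)) := by
  obtain ⟨C, hC⟩ := exists_bound_comp_pairDist hg (a i) (a j) (len i) (len j)
  have hfin : IsFiniteMeasure (volume.restrict (Set.Ioo 0 (len i) ×ˢ Set.Ioo 0 (len j))) := by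
    rw [Measure.volume_eq_prod, ← Measure.prod_restrict]
    infer_instance
  refine Integrable.of_bound (C := C) ?_ ?_
  · exact (((hg.comp (continuous_pairDist _ _)).measurable).mul
      ((measurable_pairDist₁ _ _).mul (measurable_pairDist₂ _ _))).aestronglyMeasurable
  · filter_upwards [ae_restrict_mem (measurableSet_Ioo.prod measurableSet_Ioo)] with l hl
    have h1 := hC l ⟨⟨hl.1.1.le, hl.1.2.le⟩, ⟨hl.2.1.le, hl.2.2.le⟩⟩
    obtain ⟨T, d, hT⟩ := h.exists_chord hij hl.1 hl.2
    have h2 := hT.joins.abs_pairDist₁_le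
    have h3 := hT.joins.abs_pairDist₂_le
    rw [Real.norm_eq_abs, abs_mul, abs_mul]
    have h4 := mul_le_one₀ h2 (abs_nonneg _) h3
    calc _ ≤ |g (pairDist (a i) (a j) l)| * 1 := mul_le_mul_of_nonneg_left h4 (abs_nonneg _)
      _ ≤ C := by rw [mul_one]; exact h1

/-- The integrand is the `t`-derivative of the primitive of `f` composed with the distance. At the
ends of the `t`-interval the points may coincide, and only continuity is used there. -/
theorem integral_comp_mul_pairDist₂ (hij : i ≠ j) {f : ℝ → ℝ} (hf : Continuous f) {s : ℝ}
    (hs : s ∈ Set.Icc 0 (len i)) :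
    IntegrableOn (fun t => f (pairDist (a i) (a j) (s, t)) * pairDist₂ (a i) (a j) (s, t))
      (Set.Ioo 0 (len j)) ∧
    ∫ t in Set.Ioo 0 (len j), f (pairDist (a i) (a j) (s, t)) * pairDist₂ (a i) (a j) (s, t) =
      (∫ x in (0 : ℝ)..pairDist (a i) (a j) (s, len j), f x) -
        ∫ x in (0 : ℝ)..pairDist (a i) (a j) (s, 0), f x := by
  have hL := (h.poly.len_pos j).le
  have hcont : Continuous fun t => pairDist (a i) (a j) (s, t) :=
    (continuous_pairDist _ _).comp (Continuous.prodMk_right s)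
  have hint : IntegrableOn
      (fun t => f (pairDist (a i) (a j) (s, t)) * pairDist₂ (a i) (a j) (s, t))
      (Set.Ioo 0 (len j)) := by
    obtain ⟨C, hC⟩ := exists_bound_comp_pairDist hf (a i) (a j) (len i) (len j)
    refine Integrable.of_bound (C := C) ?_ ?_
    · exact ((hf.comp hcont).measurable.mul
        ((measurable_pairDist₂ _ _).comp measurable_prodMk_left)).aestronglyMeasurable
    · filter_upwards [ae_restrict_mem measurableSet_Ioo] with t ht
      have h1 := hC (s, t) ⟨hs, ⟨ht.1.le, ht.2.le⟩⟩
      have h2 := h.abs_pairDist₂_le hij hs ht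
      rw [Real.norm_eq_abs, abs_mul]
      calc _ ≤ |f (pairDist (a i) (a j) (s, t))| * 1 :=
            mul_le_mul_of_nonneg_left h2 (abs_nonneg _)
        _ ≤ C := by rw [mul_one]; exact h1
  refine ⟨hint, ?_⟩
  have hF : ∀ x, HasDerivAt (fun x => ∫ y in (0 : ℝ)..x, f y) (f x) x := fun x =>
    hf.integral_hasStrictDerivAt 0 x |>.hasDerivAt
  rw [← integral_Ioc_eq_integral_Ioo, ← intervalIntegral.integral_of_le hL]
  refine intervalIntegral.integral_eq_sub_of_hasDerivAt_of_le hL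
    (f := fun t => ∫ x in (0 : ℝ)..pairDist (a i) (a j) (s, t), f x) ?_ ?_ ?_
  · exact (((continuous_iff_continuousAt.2 fun x => (hF x).continuousAt)).comp hcont).continuousOn
  · intro t ht
    obtain ⟨T, d, hT⟩ := h.exists_joins hij hs ht
    exact (hF _).comp t (Joins.hasDerivAt_right (l := (s, t)) hT)
  · rwa [intervalIntegrable_iff_integrableOn_Ioo_of_le hL]

/-- The integral of the mixed second derivative of a function of the distance. -/
theorem integral_mixed_derivative (hij : i ≠ j) {f : ℝ → ℝ} (hf : ContDiff ℝ 1 f) :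
    ∫ l in Set.Ioo 0 (len i) ×ˢ Set.Ioo 0 (len j),
      (deriv f (pairDist (a i) (a j) l) * (pairDist₁ (a i) (a j) l * pairDist₂ (a i) (a j) l) +
        f (pairDist (a i) (a j) l) * pairDist₁₂ (a i) (a j) l) =
    ((∫ x in (0 : ℝ)..pairDist (a i) (a j) (len i, len j), f x) -
      ∫ x in (0 : ℝ)..pairDist (a i) (a j) (len i, 0), f x) -
    ((∫ x in (0 : ℝ)..pairDist (a i) (a j) (0, len j), f x) -
      ∫ x in (0 : ℝ)..pairDist (a i) (a j) (0, 0), f x) := by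
  have hL := (h.poly.len_pos i).le
  have hf' : Continuous (deriv f) := hf.continuous_deriv le_rfl
  have hint := (h.integrableOn_comp_mul_pairDist₁_mul_pairDist₂ hij hf').add
    (h.integrableOn_comp_mul_pairDist₁₂ hij hf.continuous)
  rw [IntegrableOn, Measure.volume_eq_prod, ← Measure.prod_restrict] at hint
  obtain ⟨i1, e1⟩ := h.integral_comp_mul_pairDist₂ hij hf.continuous ⟨hL, le_rfl⟩
  obtain ⟨i2, e2⟩ := h.integral_comp_mul_pairDist₂ hij hf.continuous ⟨le_rfl, hL⟩
  rw [← e1, ← e2, ← integral_sub i1 i2, Measure.volume_eq_prod, ← Measure.prod_restrict]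
  -- Integrating first in `s` leaves the two boundary integrals at `s = len i` and `s = 0`.
  refine (integral_prod_symm _ hint).trans ?_
  refine integral_congr_ae ?_
  filter_upwards [ae_restrict_mem measurableSet_Ioo, hint.prod_left_ae] with t ht hit
  rw [← integral_Ioc_eq_integral_Ioo, ← intervalIntegral.integral_of_le hL]
  have hder : ∀ s ∈ Set.Icc 0 (len i), HasDerivAt
      (fun s => f (pairDist (a i) (a j) (s, t)) * pairDist₂ (a i) (a j) (s, t))
      (deriv f (pairDist (a i) (a j) (s, t)) *
        (pairDist₁ (a i) (a j) (s, t) * pairDist₂ (a i) (a j) (s, t)) +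
        f (pairDist (a i) (a j) (s, t)) * pairDist₁₂ (a i) (a j) (s, t)) s := by
    intro s hs
    obtain ⟨T, d, hT⟩ := h.exists_joins hij hs ht
    have d1 := ((hf.differentiable one_ne_zero _).hasDerivAt).comp s
      (Joins.hasDerivAt_left (l := (s, t)) hT)
    refine (d1.mul (Joins.hasDerivAt_pairDist₂ (l := (s, t)) hT)).congr_deriv ?_
    simp only [Function.comp]
    ring
  refine intervalIntegral.integral_eq_sub_of_hasDerivAt_of_le hL
    (f := fun s => f (pairDist (a i) (a j) (s, t)) * pairDist₂ (a i) (a j) (s, t))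
    (fun s hs => (hder s hs).continuousAt.continuousWithinAt)
    (fun s hs => hder s ⟨hs.1.le, hs.2.le⟩) ?_
  rw [intervalIntegrable_iff_integrableOn_Ioo_of_le hL]
  exact hit

end IsConvexPolygon

end ConstCurv

end

noncomputable section

namespace ConstCurv

open Real Filter Topology MeasureTheory

/-! ### Change of variables in the plane -/

/-- The linear form on the plane with the given coefficients. -/
def linForm (a b : ℝ) : ℝ × ℝ →L[ℝ] ℝ :=
  a • ContinuousLinearMap.fst ℝ ℝ ℝ + b • ContinuousLinearMap.snd ℝ ℝ ℝ

theorem det_linForm_prod (a b c d : ℝ) :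
    ((linForm a b).prod (linForm c d)).det = a * d - b * c := by
  unfold linForm
  rw [← Matrix.toLin_finTwoProd_toContinuousLinearMap]
  simp [LinearMap.det_toContinuousLinearMap, Matrix.det_fin_two_of]

theorem hasFDerivAt_comp_fst {g : ℝ → ℝ} {g' : ℝ} {l : ℝ × ℝ} (hg : HasDerivAt g g' l.1) :
    HasFDerivAt (fun l : ℝ × ℝ => g l.1) (linForm g' 0) l := by
  refine (hg.comp_hasFDerivAt l hasFDerivAt_fst).congr_fderiv ?_
  simp [linForm]

theorem hasFDerivAt_comp_snd {g : ℝ → ℝ} {g' : ℝ} {l : ℝ × ℝ} (hg : HasDerivAt g g' l.2) :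
    HasFDerivAt (fun l : ℝ × ℝ => g l.2) (linForm 0 g') l := by
  refine (hg.comp_hasFDerivAt l hasFDerivAt_snd).congr_fderiv ?_
  simp [linForm]

theorem hasFDerivAt_mul_linForm {u v : ℝ × ℝ → ℝ} {a b c d : ℝ} {l : ℝ × ℝ}
    (hu : HasFDerivAt u (linForm a b) l) (hv : HasFDerivAt v (linForm c d) l) :
    HasFDerivAt (fun l => u l * v l) (linForm (a * v l + u l * c) (b * v l + u l * d)) l := by
  refine (hu.mul hv).congr_fderiv ?_
  unfold linForm
  module

theorem hasFDerivAt_sub_linForm {u v : ℝ × ℝ → ℝ} {a b c d : ℝ} {l : ℝ × ℝ}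
    (hu : HasFDerivAt u (linForm a b) l) (hv : HasFDerivAt v (linForm c d) l) :
    HasFDerivAt (fun l => u l - v l) (linForm (a - c) (b - d)) l := by
  refine (hu.sub hv).congr_fderiv ?_
  unfold linForm
  module

theorem hasFDerivAt_div_linForm {u v : ℝ × ℝ → ℝ} {a b c d : ℝ} {l : ℝ × ℝ}
    (hu : HasFDerivAt u (linForm a b) l) (hv : HasFDerivAt v (linForm c d) l) (h0 : v l ≠ 0) :
    HasFDerivAt (fun l => u l / v l)
      (linForm ((a * v l - u l * c) / v l ^ 2) ((b * v l - u l * d) / v l ^ 2)) l := by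
  have h1 : HasFDerivAt (fun l => (v l)⁻¹) (linForm (-c / v l ^ 2) (-d / v l ^ 2)) l := by
    refine ((hasDerivAt_inv h0).comp_hasFDerivAt l hv).congr_fderiv ?_
    unfold linForm
    module
  have h2 := hasFDerivAt_mul_linForm hu h1
  simp only [div_eq_mul_inv (u _)]
  convert h2 using 2 <;> field_simp <;> ring

/-- Two parametrizations of the same region, with densities induced by the same measure, give the
same integrals. -/
theorem setIntegral_transfer {Θ Φ : ℝ × ℝ → ℝ × ℝ} {Θ' Φ' : ℝ × ℝ → ℝ × ℝ →L[ℝ] ℝ × ℝ}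
    {E R : Set (ℝ × ℝ)} (hE : MeasurableSet E) (hR : MeasurableSet R)
    (hΘ : ∀ x ∈ E, HasFDerivAt Θ (Θ' x) x) (hΦ : ∀ x ∈ R, HasFDerivAt Φ (Φ' x) x)
    (iΘ : Set.InjOn Θ E) (iΦ : Set.InjOn Φ R) (himg : Θ '' E = Φ '' R)
    {δ g g' w w' : ℝ × ℝ → ℝ} (hw : ∀ x ∈ E, w x = |(Θ' x).det| * δ (Θ x))
    (hw' : ∀ x ∈ R, w' x = |(Φ' x).det| * δ (Φ x))
    (hg : ∀ x ∈ E, ∀ y ∈ R, Θ x = Φ y → g x = g' y) :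
    (IntegrableOn (fun x => w x * g x) E ↔ IntegrableOn (fun y => w' y * g' y) R) ∧
      ∫ x in E, w x * g x = ∫ y in R, w' y * g' y := by
  -- Both integrands are pullbacks of this one function on the common image; no measurability of `g`
  -- is needed.
  set H : ℝ × ℝ → ℝ := fun z => δ z * g' (Function.invFunOn Φ R z)
  have e1 : Set.EqOn (fun x => w x * g x) (fun x => |(Θ' x).det| • H (Θ x)) E := by
    intro x hx
    have hmem : Θ x ∈ Φ '' R := himg ▸ Set.mem_image_of_mem Θ hx
    have h1 := Function.invFunOn_mem hmem
    have h2 := Function.invFunOn_eq hmem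
    simp only [H, smul_eq_mul, hw x hx, ← hg x hx _ h1 h2.symm]
    ring
  have e2 : Set.EqOn (fun y => w' y * g' y) (fun y => |(Φ' y).det| • H (Φ y)) R := by
    intro y hy
    simp only [H, smul_eq_mul, hw' y hy, iΦ.leftInvOn_invFunOn hy]
    ring
  have d1 := fun x hx => (hΘ x hx).hasFDerivWithinAt (s := E)
  have d2 := fun x hx => (hΦ x hx).hasFDerivWithinAt (s := R)
  constructor
  · rw [integrableOn_congr_fun e1 hE, integrableOn_congr_fun e2 hR,
      ← integrableOn_image_iff_integrableOn_abs_det_fderiv_smul volume hE d1 iΘ,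
      ← integrableOn_image_iff_integrableOn_abs_det_fderiv_smul volume hR d2 iΦ, himg]
  · rw [setIntegral_congr_fun hE e1, setIntegral_congr_fun hR e2,
      ← integral_image_eq_integral_abs_det_fderiv_smul volume hE d1 iΘ,
      ← integral_image_eq_integral_abs_det_fderiv_smul volume hR d2 iΦ, himg]

/-! ### The affine chart of the space of geodesics -/

variable {K : ℝ}

/-- The generalized cotangent. -/
def cotK (K x : ℝ) : ℝ := cosK K x / sinK K x

/-- The coefficients `(A, B)` of the geodesic `t = A x + B y` with given polar coordinates. -/
def polarChart (K : ℝ) (q : ℝ × ℝ) : ℝ × ℝ :=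
  (cotK K q.1 * Real.cos q.2, cotK K q.1 * Real.sin q.2)

/-- The polar coordinates of the geodesics at positive and less than maximal distance from the
origin. -/
def polarInterior (K : ℝ) : Set (ℝ × ℝ) :=
  {q | 0 < q.1 ∧ (0 < K → q.1 < π / (2 * √K)) ∧ 0 ≤ q.2 ∧ q.2 < 2 * π}

theorem polarInterior_subset : polarInterior K ⊆ polarDomain K :=
  fun _ hq => ⟨hq.1.le, fun hK => (hq.2.1 hK).le, hq.2.2⟩

theorem lt_pi_of_lt_half {x : ℝ} (h : 0 < K → x < π / (2 * √K)) (hK : 0 < K) : x < π / √K := by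
  have h1 := h hK
  rw [mul_comm, ← div_div] at h1
  linarith [pi_div_sqrt_pos hK]

theorem sinK_pos_of_mem {q : ℝ × ℝ} (hq : q ∈ polarInterior K) : 0 < sinK K q.1 :=
  sinK_pos hq.1 fun hK => lt_pi_of_lt_half hq.2.1 hK

theorem cosK_pos_of_mem {q : ℝ × ℝ} (hq : q ∈ polarInterior K) : 0 < cosK K q.1 :=
  cosK_pos_of_lt hq.1.le hq.2.1

theorem hasDerivAt_cotK {x : ℝ} (hx : sinK K x ≠ 0) :
    HasDerivAt (cotK K) (-1 / sinK K x ^ 2) x := by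
  refine ((hasDerivAt_cosK K x).div (hasDerivAt_sinK K x) hx).congr_deriv ?_
  congr 1
  linear_combination -cosK_sq_add K x

/-- The derivative of `polarChart`. -/
def polarChartDeriv (K : ℝ) (q : ℝ × ℝ) : ℝ × ℝ →L[ℝ] ℝ × ℝ :=
  (linForm (-1 / sinK K q.1 ^ 2 * Real.cos q.2) (cotK K q.1 * -Real.sin q.2)).prod
    (linForm (-1 / sinK K q.1 ^ 2 * Real.sin q.2) (cotK K q.1 * Real.cos q.2))

theorem hasFDerivAt_polarChart {q : ℝ × ℝ} (hq : q ∈ polarInterior K) :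
    HasFDerivAt (polarChart K) (polarChartDeriv K q) q := by
  have h1 := hasFDerivAt_comp_fst (l := q) (hasDerivAt_cotK (sinK_pos_of_mem hq).ne')
  have h2 := hasFDerivAt_comp_snd (l := q) (Real.hasDerivAt_cos q.2)
  have h3 := hasFDerivAt_comp_snd (l := q) (Real.hasDerivAt_sin q.2)
  have g1 := hasFDerivAt_mul_linForm h1 h2
  have g2 := hasFDerivAt_mul_linForm h1 h3
  refine (g1.prodMk g2).congr_fderiv ?_
  simp [polarChartDeriv]

theorem cotK_sq_add {x : ℝ} (hx : sinK K x ≠ 0) : cotK K x ^ 2 + K = (1 / sinK K x) ^ 2 := by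
  unfold cotK
  field_simp
  linear_combination cosK_sq_add K x

/-- The density of the invariant measure in the affine chart. -/
def chartDensity (K : ℝ) (z : ℝ × ℝ) : ℝ := (1 / √(z.1 ^ 2 + z.2 ^ 2 + K)) ^ 3

/-- With `A² + B² = cot_K² w`, one has `A² + B² + K = 1 / sin_K² w`, and the Jacobian of the chart
is `cos_K w / sin_K³ w` in absolute value. -/
theorem chartDensity_polarChart {q : ℝ × ℝ} (hq : q ∈ polarInterior K) :
    cosK K q.1 = |(polarChartDeriv K q).det| * chartDensity K (polarChart K q) := by
  have hs := sinK_pos_of_mem hq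
  have hc := cosK_pos_of_mem hq
  have e1 : (polarChartDeriv K q).det = -(cosK K q.1 / sinK K q.1 ^ 3) := by
    rw [polarChartDeriv, det_linForm_prod]
    have := Real.sin_sq_add_cos_sq q.2
    unfold cotK
    field_simp
    linear_combination -this
  have e2 : (polarChart K q).1 ^ 2 + (polarChart K q).2 ^ 2 + K = (1 / sinK K q.1) ^ 2 := by
    rw [← cotK_sq_add hs.ne']
    simp only [polarChart]
    linear_combination cotK K q.1 ^ 2 * Real.sin_sq_add_cos_sq q.2
  rw [e1, abs_neg, abs_of_pos (by positivity), chartDensity, e2, Real.sqrt_sq (by positivity)]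
  field_simp

theorem sinK_injOn : Set.InjOn (sinK K) {x | 0 ≤ x ∧ (0 < K → x ≤ π / (2 * √K))} := by
  intro x hx y hy h
  rw [← arcsinK_sinK hx.1 hx.2, h, arcsinK_sinK hy.1 hy.2]

theorem injOn_polarChart : Set.InjOn (polarChart K) (polarInterior K) := by
  intro p hp q hq h
  have sp := sinK_pos_of_mem hp
  have sq := sinK_pos_of_mem hq
  have h1 : cotK K p.1 * Real.cos p.2 = cotK K q.1 * Real.cos q.2 := congrArg Prod.fst h
  have h2 : cotK K p.1 * Real.sin p.2 = cotK K q.1 * Real.sin q.2 := congrArg Prod.snd h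
  have cp : 0 < cotK K p.1 := div_pos (cosK_pos_of_mem hp) sp
  have cq : 0 < cotK K q.1 := div_pos (cosK_pos_of_mem hq) sq
  have e : cotK K p.1 ^ 2 = cotK K q.1 ^ 2 := by
    have f1 := Real.sin_sq_add_cos_sq p.2
    have f2 := Real.sin_sq_add_cos_sq q.2
    linear_combination (-cotK K p.1 ^ 2) * f1 + cotK K q.1 ^ 2 * f2 +
      (cotK K p.1 * Real.cos p.2 + cotK K q.1 * Real.cos q.2) * h1 +
      (cotK K p.1 * Real.sin p.2 + cotK K q.1 * Real.sin q.2) * h2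
  have e' : cotK K p.1 = cotK K q.1 := (sq_eq_sq₀ cp.le cq.le).1 e
  have e3 : p.1 = q.1 := by
    have := cotK_sq_add (K := K) sp.ne'
    rw [e, cotK_sq_add sq.ne'] at this
    have := (sq_eq_sq₀ (by positivity) (by positivity)).1 this
    refine sinK_injOn ⟨hp.1.le, fun hK => (hp.2.1 hK).le⟩ ⟨hq.1.le, fun hK => (hq.2.1 hK).le⟩ ?_
    simpa using this.symm
  rw [e'] at h1 h2
  have h1 := mul_left_cancel₀ cq.ne' h1
  have h2 := mul_left_cancel₀ cq.ne' h2
  have h3 : Real.cos (p.2 - q.2) = 1 := by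
    rw [Real.cos_sub, h1, h2]
    linear_combination Real.sin_sq_add_cos_sq q.2
  rw [Real.cos_eq_one_iff_of_lt_of_lt (by linarith [hp.2.2.1, hq.2.2.2])
    (by linarith [hp.2.2.2, hq.2.2.1])] at h3
  exact Prod.ext e3 (sub_eq_zero.1 h3)

theorem exists_angle {x y : ℝ} (h : x ^ 2 + y ^ 2 = 1) :
    ∃ η, 0 ≤ η ∧ η < 2 * π ∧ Real.cos η = x ∧ Real.sin η = y := by
  obtain ⟨s, h1, h2⟩ := exists_cosK_sinK (K := 1) (α := x) (β := y) (by linarith)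
    fun h => absurd h (by norm_num)
  simp only [cosK, sinK, zero_lt_one, if_true, Real.sqrt_one, one_mul, div_one] at h1 h2
  have hm := toIcoMod_mem_Ico Real.two_pi_pos 0 s
  rw [zero_add] at hm
  refine ⟨toIcoMod Real.two_pi_pos 0 s, hm.1, hm.2, ?_, ?_⟩
  · rw [toIcoMod, Real.cos_periodic.sub_zsmul_eq, h1]
  · rw [toIcoMod, Real.sin_periodic.sub_zsmul_eq, h2]

/-- The distance `w` is determined by `sin_K w = 1 / √(A² + B² + K)`, and the direction is that of
`(A, B)`. -/
theorem exists_polarChart_eq {z : ℝ × ℝ} (h0 : z ≠ 0) (hz : 0 < z.1 ^ 2 + z.2 ^ 2 + K) :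
    ∃ q ∈ polarInterior K, polarChart K q = z := by
  have hr2 : 0 < z.1 ^ 2 + z.2 ^ 2 := by
    rcases (add_nonneg (sq_nonneg z.1) (sq_nonneg z.2)).eq_or_lt with h | h
    · exfalso
      apply h0
      have h1 : z.1 ^ 2 = 0 := by nlinarith [sq_nonneg z.1, sq_nonneg z.2]
      have h2 : z.2 ^ 2 = 0 := by nlinarith [sq_nonneg z.1, sq_nonneg z.2]
      exact Prod.ext (pow_eq_zero_iff two_ne_zero |>.1 h1) (pow_eq_zero_iff two_ne_zero |>.1 h2)
    · exact h
  set r := √(z.1 ^ 2 + z.2 ^ 2) with hr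
  have hr0 : 0 < r := Real.sqrt_pos.2 hr2
  have hrr : r ^ 2 = z.1 ^ 2 + z.2 ^ 2 := Real.sq_sqrt hr2.le
  have hS := Real.sqrt_pos.2 hz
  have hSS := Real.sq_sqrt hz.le
  set m := √(z.1 ^ 2 + z.2 ^ 2 + K)
  have hx : 0 < 1 / m := by positivity
  have hK : 1 - K * (1 / m) ^ 2 = (r / m) ^ 2 := by
    field_simp
    linear_combination hSS - hrr
  have hK' : K * (1 / m) ^ 2 < 1 := by
    have : 0 < (r / m) ^ 2 := by positivity
    linarith
  obtain ⟨h1, h2, h3⟩ := exists_sinK_eq hx hK'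
  have h4 := cosK_arcsinK hx hK'
  rw [hK, Real.sqrt_sq (by positivity)] at h4
  obtain ⟨η, g1, g2, g3, g4⟩ := exists_angle (x := z.1 / r) (y := z.2 / r) (by
    field_simp
    linarith)
  refine ⟨(arcsinK K (1 / m), η), ⟨h1, h2, g1, g2⟩, ?_⟩
  have h5 : cotK K (arcsinK K (1 / m)) = r := by
    rw [cotK, h3, h4]; field_simp
  apply Prod.ext
  · simp only [polarChart, h5, g3]; field_simp
  · simp only [polarChart, h5, g4]; field_simp

theorem measurableSet_polarInterior : MeasurableSet (polarInterior K) := by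
  have m1 : MeasurableSet {q : ℝ × ℝ | 0 < q.1} := measurableSet_lt measurable_const measurable_fst
  have m2 : MeasurableSet {q : ℝ × ℝ | 0 < K → q.1 < π / (2 * √K)} := by
    by_cases hK : 0 < K
    · simp only [hK, forall_const]
      exact measurableSet_lt measurable_fst measurable_const
    · simp [hK]
  have m3 : MeasurableSet {q : ℝ × ℝ | 0 ≤ q.2} := measurableSet_le measurable_const measurable_snd
  have m4 : MeasurableSet {q : ℝ × ℝ | q.2 < 2 * π} :=
    measurableSet_lt measurable_snd measurable_const
  exact m1.inter (m2.inter (m3.inter m4))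

theorem measurable_polarChart : Measurable (polarChart K) := by
  have : Measurable (cotK K) := (continuous_cosK K).measurable.div (continuous_sinK K).measurable
  unfold polarChart
  fun_prop

theorem polarGeodesic_form (q : ℝ × ℝ) (v : Fin 3 → ℝ) :
    (polarGeodesic K q).form v =
      sinK K q.1 * v 0 - cosK K q.1 * (Real.cos q.2 * v 1 + Real.sin q.2 * v 2) := by
  have h := Real.sin_sq_add_cos_sq q.2
  simp only [UnitTangent.form, det3, polarGeodesic, Matrix.cons_val_zero, Matrix.cons_val_one,
    Matrix.cons_val]
  linear_combination (sinK K q.1 * v 0) * h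

theorem polarGeodesic_form_eq_zero_iff {q : ℝ × ℝ} (hq : q ∈ polarInterior K) (v : Fin 3 → ℝ) :
    (polarGeodesic K q).form v = 0 ↔
      v 0 = (polarChart K q).1 * v 1 + (polarChart K q).2 * v 2 := by
  have hs := (sinK_pos_of_mem hq).ne'
  rw [polarGeodesic_form]
  simp only [polarChart, cotK]
  constructor
  · intro h
    field_simp
    linarith
  · intro h
    rw [h]
    field_simp
    ring

end ConstCurv

end

noncomputable section

namespace ConstCurv

open Real Filter Topology MeasureTheory

variable {K : ℝ}

/-! ### The chart of geodesics through two points on given geodesics -/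

/-- The cross product of the points of two geodesics at times `l.1` and `l.2`, up to sign. -/
def pairNormal (E F : UnitTangent K) (k m : Fin 3) (l : ℝ × ℝ) : ℝ :=
  (E.geod l.1).1 k * (F.geod l.2).1 m - (E.geod l.1).1 m * (F.geod l.2).1 k

/-- The geodesic through the points of two geodesics at times `l.1` and `l.2`, in the affine
chart. -/
def pairChart (E F : UnitTangent K) (l : ℝ × ℝ) : ℝ × ℝ :=
  (pairNormal E F 0 2 l / pairNormal E F 1 2 l, pairNormal E F 1 0 l / pairNormal E F 1 2 l)

/-- The derivative of `pairNormal` in the first variable. -/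
def pairNormal₁ (E F : UnitTangent K) (k m : Fin 3) (l : ℝ × ℝ) : ℝ :=
  (E.flow l.1).vec k * (F.geod l.2).1 m - (E.flow l.1).vec m * (F.geod l.2).1 k

/-- The derivative of `pairNormal` in the second variable. -/
def pairNormal₂ (E F : UnitTangent K) (k m : Fin 3) (l : ℝ × ℝ) : ℝ :=
  (E.geod l.1).1 k * (F.flow l.2).vec m - (E.geod l.1).1 m * (F.flow l.2).vec k

theorem hasFDerivAt_pairNormal (E F : UnitTangent K) (k m : Fin 3) (l : ℝ × ℝ) :
    HasFDerivAt (pairNormal E F k m)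
      (linForm (pairNormal₁ E F k m l) (pairNormal₂ E F k m l)) l := by
  have h1 := hasFDerivAt_mul_linForm (hasFDerivAt_comp_fst (l := l) (E.hasDerivAt_geod l.1 k))
    (hasFDerivAt_comp_snd (l := l) (F.hasDerivAt_geod l.2 m))
  have h2 := hasFDerivAt_mul_linForm (hasFDerivAt_comp_fst (l := l) (E.hasDerivAt_geod l.1 m))
    (hasFDerivAt_comp_snd (l := l) (F.hasDerivAt_geod l.2 k))
  refine (hasFDerivAt_sub_linForm h1 h2).congr_fderiv ?_
  simp [pairNormal₁, pairNormal₂]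

/-- The derivative of `pairChart`. -/
def pairChartDeriv (E F : UnitTangent K) (l : ℝ × ℝ) : ℝ × ℝ →L[ℝ] ℝ × ℝ :=
  (linForm
    ((pairNormal₁ E F 0 2 l * pairNormal E F 1 2 l - pairNormal E F 0 2 l * pairNormal₁ E F 1 2 l) /
      pairNormal E F 1 2 l ^ 2)
    ((pairNormal₂ E F 0 2 l * pairNormal E F 1 2 l - pairNormal E F 0 2 l * pairNormal₂ E F 1 2 l) /
      pairNormal E F 1 2 l ^ 2)).prod
  (linForm
    ((pairNormal₁ E F 1 0 l * pairNormal E F 1 2 l - pairNormal E F 1 0 l * pairNormal₁ E F 1 2 l) /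
      pairNormal E F 1 2 l ^ 2)
    ((pairNormal₂ E F 1 0 l * pairNormal E F 1 2 l - pairNormal E F 1 0 l * pairNormal₂ E F 1 2 l) /
      pairNormal E F 1 2 l ^ 2))

theorem hasFDerivAt_pairChart {E F : UnitTangent K} {l : ℝ × ℝ} (h0 : pairNormal E F 1 2 l ≠ 0) :
    HasFDerivAt (pairChart E F) (pairChartDeriv E F l) l :=
  (hasFDerivAt_div_linForm (hasFDerivAt_pairNormal E F 0 2 l) (hasFDerivAt_pairNormal E F 1 2 l)
    h0).prodMk
  (hasFDerivAt_div_linForm (hasFDerivAt_pairNormal E F 1 0 l) (hasFDerivAt_pairNormal E F 1 2 l) h0)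

theorem det_pairChartDeriv {E F : UnitTangent K} {l : ℝ × ℝ} (h0 : pairNormal E F 1 2 l ≠ 0) :
    (pairChartDeriv E F l).det =
      -(E.form (F.geod l.2).1 * F.form (E.geod l.1).1) / pairNormal E F 1 2 l ^ 3 := by
  rw [pairChartDeriv, det_linForm_prod, ← E.flow_form l.1, ← F.flow_form l.2]
  -- Clearing the quotient-rule denominators turns the Jacobian into a 3 × 3 determinant of the
  -- cross product and its two derivatives, which factors into the two edge forms.
  have key : (pairNormal₁ E F 0 2 l * pairNormal₂ E F 1 0 l -
      pairNormal₂ E F 0 2 l * pairNormal₁ E F 1 0 l) * pairNormal E F 1 2 l -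
      (pairNormal₁ E F 0 2 l * pairNormal₂ E F 1 2 l -
        pairNormal₂ E F 0 2 l * pairNormal₁ E F 1 2 l) * pairNormal E F 1 0 l -
      (pairNormal₁ E F 1 2 l * pairNormal₂ E F 1 0 l -
        pairNormal₂ E F 1 2 l * pairNormal₁ E F 1 0 l) * pairNormal E F 0 2 l =
      -((E.flow l.1).form (F.geod l.2).1 * (F.flow l.2).form (E.geod l.1).1) := by
    simp only [UnitTangent.form, det3, pairNormal, pairNormal₁, pairNormal₂, UnitTangent.flow_pt]
    ring
  rw [← key]
  field_simp
  ring

/-- In the dual quadratic form, the cross product of two points at distance `d` has norm `sin_K d`.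
-/
theorem Joins.pairNormal_sq {T E F : UnitTangent K} {d : ℝ} {l : ℝ × ℝ}
    (h : Joins T d (E.geod l.1) (F.geod l.2)) :
    pairNormal E F 0 2 l ^ 2 + pairNormal E F 1 0 l ^ 2 + K * pairNormal E F 1 2 l ^ 2 =
      sinK K d ^ 2 := by
  have e := T.det3_normal
  simp only [det3, T.normalVec_zero, T.normalVec_one, T.normalVec_two] at e
  simp only [pairNormal, ← h.start, ← h.finish, T.geod_val, Pi.add_apply, Pi.smul_apply, smul_eq_mul]
  linear_combination sinK K d ^ 2 * e

/-- The invariant measure is `|ρ_st| ds dt`: the powers of the third coordinate of the cross product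
cancel between Jacobian and density. -/
theorem Joins.chartDensity_pairChart {T E F : UnitTangent K} {d : ℝ} {l : ℝ × ℝ}
    (h : Joins T d (E.geod l.1) (F.geod l.2)) (h0 : pairNormal E F 1 2 l ≠ 0) :
    |(pairChartDeriv E F l).det| * chartDensity K (pairChart E F l) = |pairDist₁₂ E F l| := by
  have hs := h.sinK_pos
  have e : (pairChart E F l).1 ^ 2 + (pairChart E F l).2 ^ 2 + K =
      (sinK K d / |pairNormal E F 1 2 l|) ^ 2 := by
    rw [div_pow, ← h.pairNormal_sq, sq_abs]
    simp only [pairChart]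
    field_simp
  have h1 : 0 < |pairNormal E F 1 2 l| := abs_pos.2 h0
  rw [chartDensity, e, Real.sqrt_sq (by positivity), det_pairChartDeriv h0, pairDist₁₂,
    h.pairDist_eq, abs_div, abs_div, abs_neg, abs_pow, abs_of_pos (by positivity : 0 < sinK K d ^ 3)]
  field_simp

theorem Joins.chart_pos {T E F : UnitTangent K} {d : ℝ} {l : ℝ × ℝ}
    (h : Joins T d (E.geod l.1) (F.geod l.2)) (h0 : pairNormal E F 1 2 l ≠ 0) :
    0 < (pairChart E F l).1 ^ 2 + (pairChart E F l).2 ^ 2 + K := by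
  have hs := h.sinK_pos
  have h1 := h.pairNormal_sq
  have e : (pairChart E F l).1 ^ 2 + (pairChart E F l).2 ^ 2 + K =
      sinK K d ^ 2 / pairNormal E F 1 2 l ^ 2 := by
    rw [← h1]
    simp only [pairChart]
    field_simp
  rw [e]
  positivity

/-- The pairs of times for which the geodesic through the two points is at positive and less than
maximal distance from the origin. -/
def pairRegular (E F : UnitTangent K) (L L' : ℝ) : Set (ℝ × ℝ) :=
  {l | l ∈ Set.Ioo 0 L ×ˢ Set.Ioo 0 L' ∧ pairNormal E F 1 2 l ≠ 0 ∧
    (pairNormal E F 0 2 l ≠ 0 ∨ pairNormal E F 1 0 l ≠ 0)}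

theorem continuous_pairNormal (E F : UnitTangent K) (k m : Fin 3) :
    Continuous (pairNormal E F k m) :=
  continuous_iff_continuousAt.2 fun l => (hasFDerivAt_pairNormal E F k m l).continuousAt

theorem measurableSet_pairRegular (E F : UnitTangent K) (L L' : ℝ) :
    MeasurableSet (pairRegular E F L L') := by
  have h : ∀ k m, IsOpen {l | pairNormal E F k m l ≠ 0} := fun k m =>
    isOpen_compl_singleton.preimage (continuous_pairNormal E F k m)
  exact ((isOpen_Ioo.prod isOpen_Ioo).inter ((h 1 2).inter ((h 0 2).union (h 1 0)))).measurableSet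

theorem form_eq_zero_of_chart_eq {E F : UnitTangent K} {q l : ℝ × ℝ} (hq : q ∈ polarInterior K)
    (h0 : pairNormal E F 1 2 l ≠ 0) (h : polarChart K q = pairChart E F l) :
    (polarGeodesic K q).form (E.geod l.1).1 = 0 ∧ (polarGeodesic K q).form (F.geod l.2).1 = 0 := by
  rw [polarGeodesic_form_eq_zero_iff hq, polarGeodesic_form_eq_zero_iff hq, h]
  simp only [pairChart]
  constructor <;> (field_simp; simp only [pairNormal]; ring)

theorem Joins.chart_eq_of_form_eq_zero {T E F : UnitTangent K} {d : ℝ} {q l : ℝ × ℝ}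
    (h : Joins T d (E.geod l.1) (F.geod l.2)) (hq : q ∈ polarInterior K)
    (h1 : (polarGeodesic K q).form (E.geod l.1).1 = 0)
    (h2 : (polarGeodesic K q).form (F.geod l.2).1 = 0) :
    pairNormal E F 1 2 l ≠ 0 ∧ (pairNormal E F 0 2 l ≠ 0 ∨ pairNormal E F 1 0 l ≠ 0) ∧
      polarChart K q = pairChart E F l := by
  rw [polarGeodesic_form_eq_zero_iff hq] at h1 h2
  have e1 : pairNormal E F 0 2 l = (polarChart K q).1 * pairNormal E F 1 2 l := by
    simp only [pairNormal]
    rw [h1, h2]; ring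
  have e2 : pairNormal E F 1 0 l = (polarChart K q).2 * pairNormal E F 1 2 l := by
    simp only [pairNormal]
    rw [h1, h2]; ring
  have hs := h.sinK_pos
  have h3 := h.pairNormal_sq
  have hne : pairNormal E F 1 2 l ≠ 0 := by
    intro h0
    rw [e1, e2, h0] at h3
    have : 0 < sinK K d ^ 2 := by positivity
    rw [← h3] at this
    simp at this
  have hc : 0 < cotK K q.1 := div_pos (cosK_pos_of_mem hq) (sinK_pos_of_mem hq)
  refine ⟨hne, ?_, ?_⟩
  · by_contra! hcon
    rw [hcon.1] at e1
    rw [hcon.2] at e2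
    have g1 := (mul_eq_zero.1 e1.symm).resolve_right hne
    have g2 := (mul_eq_zero.1 e2.symm).resolve_right hne
    simp only [polarChart] at g1 g2
    have g1 := (mul_eq_zero.1 g1).resolve_left hc.ne'
    have g2 := (mul_eq_zero.1 g2).resolve_left hc.ne'
    have := Real.sin_sq_add_cos_sq q.2
    rw [g1, g2] at this
    norm_num at this
  · apply Prod.ext
    · simp only [pairChart]; rw [e1]; field_simp
    · simp only [pairChart]; rw [e2]; field_simp

/-! ### Null sets -/

/-- If the function and its derivative vanish together, then `A = B = 0` by `cosK_sq_add`; hence all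
zeros are isolated. -/
theorem volume_zeros_sinK {A B : ℝ} (h : A ≠ 0 ∨ B ≠ 0) :
    volume {s : ℝ | cosK K s * A + sinK K s * B = 0} = 0 := by
  apply measure_null_of_locally_null
  intro s hs
  refine ⟨{s}, ?_, by simp⟩
  have hd : HasDerivAt (fun s => cosK K s * A + sinK K s * B)
      (-K * sinK K s * A + cosK K s * B) s :=
    ((hasDerivAt_cosK K s).mul_const A).add ((hasDerivAt_sinK K s).mul_const B)
  have hs : cosK K s * A + sinK K s * B = 0 := hs
  have h1 := cosK_sq_add K s
  have hne : -K * sinK K s * A + cosK K s * B ≠ 0 := by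
    intro h0
    have hA : A = 0 := by
      linear_combination (-A) * h1 + cosK K s * hs - sinK K s * h0
    have hB : B = 0 := by
      linear_combination (-B) * h1 + K * sinK K s * hs + cosK K s * h0
    exact h.elim (· hA) (· hB)
  have h2 := hd.eventually_ne (c := 0) hne
  rw [eventually_nhdsWithin_iff] at h2
  rw [mem_nhdsWithin_iff_eventually]
  filter_upwards [h2] with t ht hmem
  by_contra hts
  exact ht hts hmem

theorem UnitTangent.det3_geod_left (T : UnitTangent K) (c z : Fin 3 → ℝ) (s : ℝ) :
    det3 c (T.geod s).1 z = cosK K s * det3 c T.pt.1 z + sinK K s * det3 c T.vec z := by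
  simp only [det3, T.geod_val, Pi.add_apply, Pi.smul_apply, smul_eq_mul]; ring

theorem UnitTangent.det3_geod_right (T : UnitTangent K) (c z : Fin 3 → ℝ) (s : ℝ) :
    det3 c z (T.geod s).1 = cosK K s * det3 c z T.pt.1 + sinK K s * det3 c z T.vec := by
  simp only [det3, T.geod_val, Pi.add_apply, Pi.smul_apply, smul_eq_mul]; ring

/-- Pairs whose spanning plane contains the fixed vector `c` are negligible by Fubini: for fixed `s`
the determinant is a combination of `cosK` and `sinK` in `t`, nontrivial unless `c` is parallel to
`E.geod s`. -/
theorem volume_det3_eq_zero {E F : UnitTangent K} {c : Fin 3 → ℝ} (hc : c ≠ 0) {L L' : ℝ}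
    (hEF : ∀ s ∈ Set.Ioo 0 L, F.form (E.geod s).1 ≠ 0) :
    volume {l : ℝ × ℝ | l ∈ Set.Ioo 0 L ×ˢ Set.Ioo 0 L' ∧
      det3 c (E.geod l.1).1 (F.geod l.2).1 = 0} = 0 := by
  have hm : MeasurableSet {l : ℝ × ℝ | l ∈ Set.Ioo 0 L ×ˢ Set.Ioo 0 L' ∧
      det3 c (E.geod l.1).1 (F.geod l.2).1 = 0} := by
    refine (measurableSet_Ioo.prod measurableSet_Ioo).inter (isClosed_singleton.preimage
      (continuous_det3 continuous_const ?_ ?_)).measurableSet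
    · exact (continuous_plane_val K).comp (E.continuous_geod.comp continuous_fst)
    · exact (continuous_plane_val K).comp (F.continuous_geod.comp continuous_snd)
  rw [Measure.volume_eq_prod, Measure.measure_prod_null hm]
  -- The exceptional `s` are zeros of a nontrivial combination of the same kind, or there are none,
  -- since otherwise `c = 0`.
  have hexc : volume {s : ℝ | s ∈ Set.Ioo 0 L ∧ ∃ k : ℝ, c = k • (E.geod s).1} = 0 := by
    by_cases h0 : det3 c E.pt.1 E.normalVec ≠ 0 ∨ det3 c E.vec E.normalVec ≠ 0
    · refine measure_mono_null ?_ (volume_zeros_sinK (K := K) h0)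
      rintro s ⟨-, k, hk⟩
      change _ = _
      rw [← E.det3_geod_left, hk]
      simp only [det3, Pi.smul_apply, smul_eq_mul]; ring
    · push Not at h0
      convert measure_empty (μ := volume)
      rw [Set.eq_empty_iff_forall_notMem]
      rintro s ⟨-, k, hk⟩
      have e := E.decomp c
      have e2 : det3 E.pt.1 c E.normalVec = 0 := by
        have := h0.1
        simp only [det3] at this ⊢
        linarith
      have e3 : det3 E.pt.1 E.vec c = 0 := by
        have := E.form_geod s
        rw [hk, det3_smul]
        exact mul_eq_zero_of_right k this
      rw [h0.2, e2, e3] at e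
      simp only [zero_smul, add_zero] at e
      exact hc e
  have hae : ∀ᵐ s : ℝ, ¬ (s ∈ Set.Ioo 0 L ∧ ∃ k : ℝ, c = k • (E.geod s).1) := by
    exact measure_eq_zero_iff_ae_notMem.1 hexc
  filter_upwards [hae] with s hs
  by_cases hsL : s ∈ Set.Ioo 0 L
  · have hne : det3 c (E.geod s).1 F.pt.1 ≠ 0 ∨ det3 c (E.geod s).1 F.vec ≠ 0 := by
      by_contra! hcon
      refine hs ⟨hsL, det3 F.pt.1 F.vec c / F.form (E.geod s).1, ?_⟩
      have hF := hEF s hsL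
      have e := cramer F.pt.1 F.vec (E.geod s).1 c
      have e1 : det3 c F.vec (E.geod s).1 = 0 := by
        have := hcon.2
        simp only [det3] at this ⊢
        linarith
      have e2 : det3 F.pt.1 c (E.geod s).1 = 0 := by
        have := hcon.1
        simp only [det3] at this ⊢
        linarith
      rw [e1, e2] at e
      simp only [zero_smul, zero_add] at e
      apply smul_right_injective _ hF
      simp only [smul_smul, mul_div_cancel₀ _ hF]
      exact e
    refine measure_mono_null ?_ (volume_zeros_sinK (K := K) hne)
    rintro t ⟨-, ht⟩
    change _ = _
    rw [← F.det3_geod_right]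
    exact ht
  · refine measure_mono_null ?_ (measure_empty (μ := volume))
    rintro t ⟨ht, -⟩
    exact hsL ht.1

theorem pairRegular_ae_eq {E F : UnitTangent K} {L L' : ℝ}
    (hEF : ∀ s ∈ Set.Ioo 0 L, F.form (E.geod s).1 ≠ 0) :
    pairRegular E F L L' =ᵐ[volume] Set.Ioo 0 L ×ˢ Set.Ioo 0 L' := by
  -- The vector `(1, 0, 0)` accounts for geodesics through the origin; `(0, 1, 0)` for the vanishing
  -- of one of the two other normal coordinates, which suffices.
  have h0 := volume_det3_eq_zero (E := E) (F := F) (c := ![1, 0, 0]) (L' := L')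
    (fun h => by simpa using congrFun h 0) hEF
  have h1 := volume_det3_eq_zero (E := E) (F := F) (c := ![0, 1, 0]) (L' := L')
    (fun h => by simpa using congrFun h 1) hEF
  rw [measure_eq_zero_iff_ae_notMem] at h0 h1
  refine eventuallyEq_set.2 ?_
  filter_upwards [h0, h1] with l h0 h1
  refine ⟨fun h => h.1, fun h => ⟨h, fun hz => h0 ⟨h, ?_⟩, Or.inl fun hz => h1 ⟨h, ?_⟩⟩⟩
  · simp only [pairNormal] at hz
    simp [det3, hz]
  · simp only [pairNormal] at hz
    simp only [det3, Matrix.cons_val_zero, Matrix.cons_val_one, Matrix.cons_val]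
    linarith

theorem volume_geodesics_through (p : Plane K) :
    volume {q : ℝ × ℝ | (polarGeodesic K q).form p.1 = 0} = 0 := by
  have hcont : Continuous fun q : ℝ × ℝ => (polarGeodesic K q).form p.1 := by
    simp only [polarGeodesic_form]
    have := continuous_sinK K
    have := continuous_cosK K
    fun_prop
  have hm : MeasurableSet {q : ℝ × ℝ | (polarGeodesic K q).form p.1 = 0} :=
    (isClosed_singleton.preimage hcont).measurableSet
  rw [Measure.volume_eq_prod, Measure.prod_apply_symm hm, lintegral_eq_zero_iff'
    (measurable_measure_prodMk_right hm).aemeasurable]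
  -- For fixed `η` the condition on `w` is nontrivial, except when `p` has `t`-coordinate `0` and is
  -- orthogonal to the direction `η`; such `η` are themselves negligible.
  have key : ∀ η : ℝ, p.1 0 ≠ 0 ∨ Real.cos η * p.1 1 + Real.sin η * p.1 2 ≠ 0 →
      volume ((fun x => (x, η)) ⁻¹' {q : ℝ × ℝ | (polarGeodesic K q).form p.1 = 0}) = 0 := by
    intro η hη
    have hη' : -(Real.cos η * p.1 1 + Real.sin η * p.1 2) ≠ 0 ∨ p.1 0 ≠ 0 :=
      hη.symm.imp_left neg_ne_zero.2
    refine measure_mono_null ?_ (volume_zeros_sinK (K := K) hη')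
    intro w hw
    have hw : (polarGeodesic K (w, η)).form p.1 = 0 := hw
    rw [polarGeodesic_form] at hw
    change _ = _
    linarith
  by_cases h0 : p.1 0 = 0
  · have hxy : p.1 1 ≠ 0 ∨ p.1 2 ≠ 0 := by
      by_contra! hcon
      exact p.ne_zero (by
        funext k
        fin_cases k
        exacts [h0, hcon.1, hcon.2])
    have hz := volume_zeros_sinK (K := 1) hxy
    rw [measure_eq_zero_iff_ae_notMem] at hz
    filter_upwards [hz] with η hη
    refine key η (Or.inr fun h => hη ?_)
    simpa [cosK, sinK] using h
  · exact Eventually.of_forall fun η => key η (Or.inl h0)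

theorem ae_mem_polarInterior : ∀ᵐ q : ℝ × ℝ, q ∈ polarDomain K → q ∈ polarInterior K := by
  have key : ∀ c : ℝ, ∀ᵐ q : ℝ × ℝ, q.1 ≠ c := by
    intro c
    have : volume {q : ℝ × ℝ | q.1 = c} = 0 := by
      rw [show {q : ℝ × ℝ | q.1 = c} = {c} ×ˢ Set.univ by ext; simp, Measure.volume_eq_prod,
        Measure.prod_prod]
      simp
    simpa [ae_iff] using this
  filter_upwards [key 0, key (π / (2 * √K))] with q h0 h1 hq
  exact ⟨lt_of_le_of_ne hq.1 h0.symm, fun hK => lt_of_le_of_ne (hq.2.1 hK) h1, hq.2.2⟩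

end ConstCurv

end

noncomputable section

namespace ConstCurv

open Real Filter Topology MeasureTheory

variable {K : ℝ}

/-! ### The geodesics that cross two given edges -/

/-- A geodesic through both ends of a nondegenerate arc is the geodesic of the arc, in one of its
two orientations. -/
theorem Joins.exists_flow_eq {T S : UnitTangent K} {d : ℝ} {p q : Plane K} (h : Joins T d p q)
    (h1 : S.form p.1 = 0) (h2 : S.form q.1 = 0) :
    ∃ s, S.flow s = T ∨ S.flow s = (T.flow d).rotate π := by
  obtain ⟨s, hs⟩ := S.exists_geod_eq h1
  have hpt : T.pt = (S.flow s).pt := by rw [h.start, ← hs, S.flow_pt]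
  have e := UnitTangent.form_geod_other T (S.flow s) hpt.symm d
  rw [h.finish, S.flow_form, h2] at e
  have e0 : S.form T.vec = 0 := (mul_eq_zero.1 e.symm).resolve_left h.sinK_pos.ne'
  have e1 := UnitTangent.vec_eq (S.flow s) T hpt
  have e2 := UnitTangent.ip_sq_add_form_sq (S.flow s) T hpt
  rw [S.flow_form, e0] at e1 e2
  rw [zero_smul, add_zero] at e1
  have h3 : (ip K T.vec (S.flow s).vec - 1) * (ip K T.vec (S.flow s).vec + 1) = 0 := by linarith
  rcases mul_eq_zero.1 h3 with h4 | h4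
  · refine ⟨s, Or.inl (UnitTangent.ext' hpt.symm ?_)⟩
    rw [e1, show ip K T.vec (S.flow s).vec = 1 by linarith, one_smul]
  · refine ⟨s - d, Or.inr ?_⟩
    have : T = (S.flow s).rotate π := UnitTangent.ext' hpt (by
      rw [UnitTangent.reverse_vec, e1, show ip K T.vec (S.flow s).vec = -1 by linarith,
        neg_one_smul])
    rw [this, UnitTangent.reverse_flow, UnitTangent.reverse_reverse, S.flow_flow, sub_eq_add_neg]

theorem Joins.form_eq_zero {T S : UnitTangent K} {d : ℝ} {p q : Plane K} (h : Joins T d p q)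
    (h1 : S.form p.1 = 0) (h2 : S.form q.1 = 0) {z : Fin 3 → ℝ} (h3 : S.form z = 0) :
    T.form z = 0 := by
  obtain ⟨s, e | e⟩ := h.exists_flow_eq h1 h2
  · rw [← e, S.flow_form, h3]
  · have := congrArg (fun R : UnitTangent K => R.form z) e
    simp only [S.flow_form, UnitTangent.reverse_form, T.flow_form, h3] at this
    linarith

/-- The polar coordinates of the geodesics that cross two given edges. -/
def edgeCell {n : ℕ} (a : Fin n → UnitTangent K) (len : Fin n → ℝ) (i j : Fin n) :
    Set (ℝ × ℝ) :=
  polarInterior K ∩ polarChart K ⁻¹'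
    (pairChart (a i) (a j) '' pairRegular (a i) (a j) (len i) (len j))

variable {D : Set (Plane K)}

namespace IsConvexPolygon

variable {n : ℕ} [NeZero n] {a : Fin n → UnitTangent K} {len : Fin n → ℝ}
  {i j : Fin n} {l : ℝ × ℝ} {T : UnitTangent K} {d : ℝ}
  (h : IsConvexPolygon D a len)

include h

/-- At a point strictly inside the chord, the form of edge `k` is a positive combination of its
values at the two ends, which have the same sign. If it vanishes, both ends lie on the geodesic of
edge `k`, impossible as they are interior to different edges. -/
theorem eq_of_form_chord_eq_zero (hc : IsChord a len i j l T d) {k : Fin n} {t : ℝ}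
    (ht : t ∈ Set.Ioo 0 (len k)) (h0 : T.form ((a k).geod t).1 = 0) :
    (k = i ∧ t = l.1) ∨ (k = j ∧ t = l.2) := by
  obtain ⟨s₀, hs₀⟩ := T.exists_geod_eq h0
  obtain ⟨s, hs, e⟩ := T.exists_onePeriod s₀
  have e : T.geod s = (a k).geod t := by rw [← hs₀]; exact (congrArg UnitTangent.pt e).symm
  have hm : T.geod s ∈ D := by rw [e]; exact h.geod_mem ⟨ht.1.le, ht.2.le⟩
  obtain ⟨h1, h2⟩ := (h.chord_mem_iff hc hs).1 hm
  have m1 := h.geod_mem (i := i) ⟨hc.mem_left.1.le, hc.mem_left.2.le⟩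
  have m2 := h.geod_mem (i := j) ⟨hc.mem_right.1.le, hc.mem_right.2.le⟩
  rcases h1.eq_or_lt with rfl | h1
  · rw [T.geod_zero, hc.joins.start] at e
    obtain ⟨g1, g2⟩ := h.simple' ⟨hc.mem_left.1.le, hc.mem_left.2.le⟩ ht e
    exact Or.inl ⟨g1.symm, g2.symm⟩
  rcases h2.eq_or_lt with rfl | h2
  · rw [hc.joins.finish] at e
    obtain ⟨g1, g2⟩ := h.simple' ⟨hc.mem_right.1.le, hc.mem_right.2.le⟩ ht e
    exact Or.inr ⟨g1.symm, g2.symm⟩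
  exfalso
  obtain ⟨σ, hσ, hf⟩ := h.exists_orientation
  have c := congrArg (a k).form (T.combination_geod s d)
  rw [UnitTangent.form_smul, UnitTangent.form_smul_add_smul, e, UnitTangent.form_geod, mul_zero,
    hc.joins.start, hc.joins.finish] at c
  have p1 : 0 < sinK K s := sinK_pos h1 fun hK => by linarith [hc.joins.lt hK]
  have p2 : 0 < sinK K (d - s) := sinK_pos (by linarith) fun hK => by linarith [hc.joins.lt hK]
  have f1 := mul_nonneg p2.le (hf k _ m1)
  have f2 := mul_nonneg p1.le (hf k _ m2)
  have f3 : sinK K (d - s) * (σ * (a k).form ((a i).geod l.1).1) +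
      sinK K s * (σ * (a k).form ((a j).geod l.2).1) = 0 := by
    linear_combination -σ * c
  by_cases hki : k = i
  · have hkj : k ≠ j := fun hkj => hc.ne (hki.symm.trans hkj)
    have g : sinK K s * (σ * (a k).form ((a j).geod l.2).1) = 0 := by linarith
    exact mul_ne_zero p1.ne' (mul_ne_zero hσ (h.form_geod_ne_zero hkj hc.mem_right)) g
  · have g : sinK K (d - s) * (σ * (a k).form ((a i).geod l.1).1) = 0 := by linarith
    exact mul_ne_zero p2.ne' (mul_ne_zero hσ (h.form_geod_ne_zero hki hc.mem_left)) g

/-- A geodesic crosses at most two edges. -/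
theorem crossing_unique (hij : i ≠ j) (h1 : l.1 ∈ Set.Ioo 0 (len i))
    (h2 : l.2 ∈ Set.Ioo 0 (len j)) {S : UnitTangent K} (s1 : S.form ((a i).geod l.1).1 = 0)
    (s2 : S.form ((a j).geod l.2).1 = 0) {k : Fin n} {t : ℝ} (ht : t ∈ Set.Ioo 0 (len k))
    (s3 : S.form ((a k).geod t).1 = 0) : (k = i ∧ t = l.1) ∨ (k = j ∧ t = l.2) := by
  obtain ⟨T, d, hc⟩ := h.exists_chord hij h1 h2
  exact h.eq_of_form_chord_eq_zero hc ht (hc.joins.form_eq_zero s1 s2 s3)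

/-- A description free of the charts: the regularity conditions in the cell hold automatically in
`polarInterior`. -/
theorem mem_edgeCell_iff (hij : i ≠ j) {q : ℝ × ℝ} :
    q ∈ edgeCell a len i j ↔ q ∈ polarInterior K ∧
      ∃ l : ℝ × ℝ, l.1 ∈ Set.Ioo 0 (len i) ∧ l.2 ∈ Set.Ioo 0 (len j) ∧
        (polarGeodesic K q).form ((a i).geod l.1).1 = 0 ∧
        (polarGeodesic K q).form ((a j).geod l.2).1 = 0 := by
  refine and_congr_right fun hq => ⟨?_, ?_⟩
  · rintro ⟨l, ⟨hl, h0, -⟩, e⟩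
    obtain ⟨g1, g2⟩ := form_eq_zero_of_chart_eq hq h0 e.symm
    exact ⟨l, hl.1, hl.2, g1, g2⟩
  · rintro ⟨l, h1, h2, g1, g2⟩
    obtain ⟨T, d, hc⟩ := h.exists_chord hij h1 h2
    obtain ⟨e1, e2, e3⟩ := hc.joins.chart_eq_of_form_eq_zero hq g1 g2
    exact ⟨l, ⟨⟨h1, h2⟩, e1, e2⟩, e3.symm⟩

theorem edgeCell_swap (hij : i ≠ j) : edgeCell a len i j = edgeCell a len j i := by
  ext q
  rw [h.mem_edgeCell_iff hij, h.mem_edgeCell_iff hij.symm]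
  refine and_congr_right fun _ => ⟨?_, ?_⟩
  · rintro ⟨l, h1, h2, g1, g2⟩
    exact ⟨l.swap, h2, h1, g2, g1⟩
  · rintro ⟨l, h1, h2, g1, g2⟩
    exact ⟨l.swap, h2, h1, g2, g1⟩

theorem disjoint_edgeCell {i' j' : Fin n} (hij : i < j) (hij' : i' < j')
    (hne : (i, j) ≠ (i', j')) : Disjoint (edgeCell a len i j) (edgeCell a len i' j') := by
  rw [Set.disjoint_left]
  intro q hq hq'
  rw [h.mem_edgeCell_iff hij.ne] at hq
  rw [h.mem_edgeCell_iff hij'.ne] at hq'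
  obtain ⟨-, l, h1, h2, g1, g2⟩ := hq
  obtain ⟨-, l', h1', h2', g1', g2'⟩ := hq'
  rcases h.crossing_unique hij.ne h1 h2 g1 g2 h1' g1' with ⟨e1, -⟩ | ⟨e1, -⟩ <;>
  rcases h.crossing_unique hij.ne h1 h2 g1 g2 h2' g2' with ⟨e2, -⟩ | ⟨e2, -⟩ <;>
  subst e1 <;> subst e2
  · exact hij'.ne rfl
  · exact hne rfl
  · exact lt_asymm hij hij'
  · exact hij'.ne rfl

theorem exists_polarChart_eq_pairChart (hij : i ≠ j)
    (hl : l ∈ pairRegular (a i) (a j) (len i) (len j)) :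
    ∃ q ∈ polarInterior K, polarChart K q = pairChart (a i) (a j) l := by
  obtain ⟨T, d, hc⟩ := h.exists_chord hij hl.1.1 hl.1.2
  refine exists_polarChart_eq (fun h0 => ?_) (hc.joins.chart_pos hl.2.1)
  have e1 := congrArg Prod.fst h0
  have e2 := congrArg Prod.snd h0
  simp only [pairChart, Prod.fst_zero, Prod.snd_zero, div_eq_zero_iff, hl.2.1, or_false] at e1 e2
  exact hl.2.2.elim (· e1) (· e2)

theorem injOn_pairChart (hij : i ≠ j) :
    Set.InjOn (pairChart (a i) (a j)) (pairRegular (a i) (a j) (len i) (len j)) := by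
  intro l hl l' hl' e
  obtain ⟨q, hq, hql⟩ := h.exists_polarChart_eq_pairChart hij hl
  obtain ⟨g1, g2⟩ := form_eq_zero_of_chart_eq hq hl.2.1 hql
  obtain ⟨g1', g2'⟩ := form_eq_zero_of_chart_eq hq hl'.2.1 (hql.trans e)
  rcases h.crossing_unique hij hl.1.1 hl.1.2 g1 g2 hl'.1.1 g1' with ⟨-, e1⟩ | ⟨e1, -⟩
  · rcases h.crossing_unique hij hl.1.1 hl.1.2 g1 g2 hl'.1.2 g2' with ⟨e2, -⟩ | ⟨-, e2⟩
    · exact absurd e2.symm hij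
    · exact Prod.ext e1.symm e2.symm
  · exact absurd e1 hij

theorem image_edgeCell (hij : i ≠ j) : polarChart K '' edgeCell a len i j =
    pairChart (a i) (a j) '' pairRegular (a i) (a j) (len i) (len j) := by
  ext z
  constructor
  · rintro ⟨q, hq, rfl⟩
    exact hq.2
  · rintro ⟨l, hl, rfl⟩
    obtain ⟨q, hq, hql⟩ := h.exists_polarChart_eq_pairChart hij hl
    exact ⟨q, ⟨hq, l, hl, hql.symm⟩, hql⟩

/-- Rests on the measurability of images of measurable sets under injective differentiable maps. -/
theorem measurableSet_edgeCell (hij : i ≠ j) : MeasurableSet (edgeCell a len i j) :=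
  measurableSet_polarInterior.inter (measurable_polarChart
    (measurable_image_of_fderivWithin (measurableSet_pairRegular _ _ _ _)
      (fun _ hl => (hasFDerivAt_pairChart hl.2.1).hasFDerivWithinAt) (h.injOn_pairChart hij)))

/-- The chord length and the angular factor of a geodesic that crosses two given edges. -/
theorem chord_of_form_eq_zero (hij : i ≠ j) (h1 : l.1 ∈ Set.Ioo 0 (len i))
    (h2 : l.2 ∈ Set.Ioo 0 (len j)) {S : UnitTangent K} (s1 : S.form ((a i).geod l.1).1 = 0)
    (s2 : S.form ((a j).geod l.2).1 = 0) :
    chordLength D S = pairDist (a i) (a j) l ∧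
      sinK K (pairDist (a i) (a j) l) * Real.cot (startAngle D S) * Real.cot (endAngle D S) =
        -(pairDist₁ (a i) (a j) l * pairDist₂ (a i) (a j) l) / pairDist₁₂ (a i) (a j) l := by
  obtain ⟨T, d, hc⟩ := h.exists_chord hij h1 h2
  obtain ⟨s, e | e⟩ := hc.joins.exists_flow_eq s1 s2
  · exact ⟨h.chordLength_eq hc e, h.sinK_mul_cot_mul_cot hc e⟩
  · have g1 := h.chordLength_eq hc.reverse e
    have g2 := h.sinK_mul_cot_mul_cot hc.reverse e
    rw [pairDist_swap] at g1 g2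
    rw [pairDist₁_swap, pairDist₂_swap, pairDist₁₂_swap] at g2
    exact ⟨g1, by rw [g2, mul_comm (pairDist₂ _ _ _)]⟩

/-- Transfer of integrals to the arc length coordinates on two edges. -/
theorem integral_edgeCell (hij : i ≠ j) {g g' : ℝ × ℝ → ℝ}
    (hg : ∀ q l, l.1 ∈ Set.Ioo 0 (len i) → l.2 ∈ Set.Ioo 0 (len j) →
      (polarGeodesic K q).form ((a i).geod l.1).1 = 0 →
      (polarGeodesic K q).form ((a j).geod l.2).1 = 0 → g q = g' l) :
    (IntegrableOn (fun q => cosK K q.1 * g q) (edgeCell a len i j) ↔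
      IntegrableOn (fun l => pairDist₁₂ (a i) (a j) l * g' l)
        (Set.Ioo 0 (len i) ×ˢ Set.Ioo 0 (len j))) ∧
    ∫ q in edgeCell a len i j, cosK K q.1 * g q =
      ∫ l in Set.Ioo 0 (len i) ×ˢ Set.Ioo 0 (len j), pairDist₁₂ (a i) (a j) l * g' l := by
  have hae := pairRegular_ae_eq (E := a i) (F := a j) (L := len i) (L' := len j)
    fun s hs => h.form_geod_ne_zero hij.symm hs
  have key := setIntegral_transfer (h.measurableSet_edgeCell hij)
    (measurableSet_pairRegular (a i) (a j) (len i) (len j))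
    (fun q hq => hasFDerivAt_polarChart hq.1) (fun l hl => hasFDerivAt_pairChart hl.2.1)
    (injOn_polarChart.mono fun _ hq => hq.1) (h.injOn_pairChart hij) (h.image_edgeCell hij)
    (δ := chartDensity K) (g := g) (g' := g') (w := fun q => cosK K q.1)
    (w' := pairDist₁₂ (a i) (a j)) (fun q hq => chartDensity_polarChart hq.1)
    (fun l hl => by
      obtain ⟨T, d, hc⟩ := h.exists_chord hij hl.1.1 hl.1.2
      rw [hc.joins.chartDensity_pairChart hl.2.1, abs_of_pos (h.pairDist₁₂_pos hc)])
    (fun q hq l hl e => by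
      obtain ⟨g1, g2⟩ := form_eq_zero_of_chart_eq hq.1 hl.2.1 e
      exact hg q l hl.1.1 hl.1.2 g1 g2)
  rw [integrableOn_congr_set_ae hae, setIntegral_congr_set hae] at key
  exact key

end IsConvexPolygon

end ConstCurv

end

noncomputable section

namespace ConstCurv

open Real Filter Topology MeasureTheory

variable {K : ℝ}

/-! ### Geodesics meeting the polygon -/

/-- For `K ≤ 0` every geodesic minimizes, so the distance to its start is unbounded along it. -/
theorem UnitTangent.exists_geod_notMem_of_nonpos (hK : K ≤ 0) {D : Set (Plane K)}
    (hD : IsCompact D) (T : UnitTangent K) : ∃ s > 0, T.geod s ∉ D := by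
  have hc : Continuous fun p : Plane K => rho K T.pt.1 p.1 :=
    continuous_rho K continuous_const (continuous_plane_val K)
  obtain ⟨C, hC⟩ := (hD.image hc).bddAbove
  refine ⟨max C 0 + 1, by positivity, fun hm => ?_⟩
  have h1 : rho K T.pt.1 (T.geod (max C 0 + 1)).1 ≤ C := hC ⟨_, hm, rfl⟩
  rw [rho_geod T (by positivity) fun h => absurd h hK.not_gt] at h1
  linarith [le_max_left C 0]

variable {D : Set (Plane K)}

namespace IsConvexPolygon

variable {n : ℕ} [NeZero n] {a : Fin n → UnitTangent K} {len : Fin n → ℝ}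
  {i j : Fin n} {l : ℝ × ℝ} {T : UnitTangent K} {d : ℝ}
  (h : IsConvexPolygon D a len)

include h

theorem exists_edge_of_mem_frontier {p : Plane K} (hp : p ∈ frontier D) {S : UnitTangent K}
    (hS : ∀ i, S.form (a i).pt.1 ≠ 0) (h0 : S.form p.1 = 0) :
    ∃ i, ∃ t ∈ Set.Ioo 0 (len i), (a i).geod t = p := by
  rw [h.poly.frontier_eq] at hp
  obtain ⟨i, t, ht, e⟩ := Set.mem_iUnion.1 hp
  refine ⟨i, t, ⟨lt_of_le_of_ne ht.1 ?_, lt_of_le_of_ne ht.2 ?_⟩, e⟩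
  · rintro rfl
    apply hS i
    rwa [← (a i).geod_zero, e]
  · rintro rfl
    apply hS (i + 1)
    rwa [← h.poly.closed i, e]

/-- If `K > 0` and a whole great circle lay in `D`, the supporting form of edge `0` would vanish on
it by antipodal symmetry. Then `S.pt` would be interior to this edge with its antipode in `D`,
against `val_ne_neg`. -/
theorem exists_geod_notMem {S : UnitTangent K} (hS : ∀ i, S.form (a i).pt.1 ≠ 0) :
    ∃ s, S.geod s ∉ D := by
  by_cases hK : 0 < K
  · by_contra! hall
    obtain ⟨σ, hσ, hf⟩ := h.exists_orientation
    have hanti : (S.geod (π / √K)).1 = -S.pt.1 := by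
      rw [S.geod_val, sinK_pi hK, cosK_pi hK]; module
    have h1 := hf 0 _ (hall 0)
    have h2 := hf 0 _ (hall (π / √K))
    rw [S.geod_zero] at h1
    rw [hanti, UnitTangent.form, det3_neg] at h2
    change 0 ≤ σ * -(a 0).form S.pt.1 at h2
    have h3 : σ * (a 0).form S.pt.1 = 0 := by linarith
    have h4 := (mul_eq_zero.1 h3).resolve_left hσ
    have hm := hall 0
    rw [S.geod_zero] at hm
    obtain ⟨s, hs, e⟩ := h.exists_geod_of_form_eq_zero hm h4
    have hs' : s ∈ Set.Ioo 0 (len 0) := by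
      refine ⟨lt_of_le_of_ne hs.1 ?_, lt_of_le_of_ne hs.2 ?_⟩
      · rintro rfl
        apply hS 0
        rw [← (a 0).geod_zero, e, S.form_pt]
      · rintro rfl
        apply hS (0 + 1)
        rw [← h.poly.closed 0, e, S.form_pt]
    exact h.val_ne_neg hs' (hall (π / √K)) (by rw [hanti, e])
  · obtain ⟨s, -, hs⟩ := S.exists_geod_notMem_of_nonpos (not_lt.1 hK) h.compact
    exact ⟨s, hs⟩

/-- A geodesic pointing into the polygon at an interior point of an edge leaves it at another
edge. -/
theorem exists_exit {σ : ℝ} (hσ : σ ≠ 0) (hf : ∀ i, ∀ p ∈ D, 0 ≤ σ * (a i).form p.1) {t : ℝ}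
    (ht : t ∈ Set.Ioo 0 (len i)) (hpt : T.pt = (a i).geod t) (hpos : 0 < σ * (a i).form T.vec) :
    ∃ s, T.geod s ∈ frontier D ∧ (a i).form (T.geod s).1 ≠ 0 := by
  have hform : ∀ s, (a i).form (T.geod s).1 = sinK K s * (a i).form T.vec := fun s => by
    have := UnitTangent.form_geod_other T ((a i).flow t) hpt.symm s
    rwa [(a i).flow_form] at this
  -- Just after the start, the geodesic is in the half-neighbourhood of the edge point contained in
  -- `D`.
  have hnear : ∀ᶠ r in 𝓝[>] (0 : ℝ), T.geod r ∈ D := by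
    obtain ⟨x, hx, y, hy, α, hα, β, hβ, e, k, hk, hdet⟩ := h.exists_split ht
    obtain ⟨c, hc, hc0⟩ := h.exists_form_ne i
    have h1 := h.convex.eventually_mem (p := T.pt) hα hβ hx hy (val_mem_cone hc) (by rw [hpt, e])
      (by rw [hdet]; exact mul_ne_zero hk hc0)
    have h2 := T.continuous_geod.tendsto 0
    rw [T.geod_zero] at h2
    have h3 := (h2.mono_left (nhdsWithin_le_nhds (s := Set.Ioi 0))).eventually h1
    filter_upwards [h3, eventually_sinK_pos K] with r hr hs
    apply hr
    rw [hdet, hdet, hform]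
    have g1 := mul_nonneg (mul_pos hs hpos).le (hf i c hc)
    have g2 : 0 < σ ^ 2 := by positivity
    have g3 : 0 ≤ k ^ 2 := sq_nonneg k
    refine nonneg_of_mul_nonneg_right (a := σ ^ 2) ?_ g2
    calc (0 : ℝ) ≤ k ^ 2 * (sinK K r * (σ * (a i).form T.vec) * (σ * (a i).form c.1)) :=
          mul_nonneg g3 g1
      _ = _ := by ring
  -- It leaves `D` before reaching the antipode, so `sinK` stays positive and the exit point is off
  -- the geodesic of edge `i`.
  have hfar : ∃ s > 0, (0 < K → s < π / √K) ∧ T.geod s ∉ D := by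
    by_cases hK : 0 < K
    · have hpi := pi_div_sqrt_pos hK
      have h1 : T.geod (π / √K) ∉ D := fun hm => h.val_ne_neg ht hm (by
        rw [T.geod_val, sinK_pi hK, cosK_pi hK, hpt]; module)
      have h2 : ∀ᶠ s in 𝓝[<] (π / √K), T.geod s ∉ D := nhdsWithin_le_nhds
        (T.continuous_geod.continuousAt.eventually (h.closed.isOpen_compl.mem_nhds h1))
      have h3 : ∀ᶠ s in 𝓝[<] (π / √K), 0 < s := nhdsWithin_le_nhds (lt_mem_nhds hpi)
      obtain ⟨s, ⟨h4, h5⟩, h6⟩ := ((h2.and h3).and self_mem_nhdsWithin).exists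
      exact ⟨s, h5, fun _ => h6, h4⟩
    · obtain ⟨s, h1, h2⟩ := T.exists_geod_notMem_of_nonpos (not_lt.1 hK) h.compact
      exact ⟨s, h1, fun hK' => absurd hK' hK, h2⟩
  obtain ⟨s, hs0, hsK, hs⟩ := hfar
  have hlt : ∀ᶠ r in 𝓝[>] (0 : ℝ), r < s := nhdsWithin_le_nhds (Iio_mem_nhds hs0)
  obtain ⟨r, ⟨hr, hrs⟩, hr0⟩ := ((hnear.and hlt).and self_mem_nhdsWithin).exists
  have hr0 : 0 < r := hr0
  have hpre : IsPreconnected (T.geod '' Set.Icc r s) :=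
    isPreconnected_Icc.image _ T.continuous_geod.continuousOn
  obtain ⟨_, ⟨u, hu, rfl⟩, hfr⟩ : (T.geod '' Set.Icc r s ∩ frontier D).Nonempty := by
    rw [Set.nonempty_iff_ne_empty]
    intro he
    have hsub : T.geod '' Set.Icc r s ⊆ interior D ∪ Dᶜ := by
      intro z hz
      by_cases hzD : z ∈ D
      · refine Or.inl (by_contra fun hzi => ?_)
        exact Set.eq_empty_iff_forall_notMem.1 he z ⟨hz, subset_closure hzD, hzi⟩
      · exact Or.inr hzD
    have hrm : T.geod r ∈ T.geod '' Set.Icc r s := ⟨r, ⟨le_rfl, hrs.le⟩, rfl⟩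
    obtain ⟨z, -, hz1, hz2⟩ := hpre _ _ isOpen_interior h.closed.isOpen_compl hsub
      ⟨_, hrm, (hsub hrm).resolve_right fun hc => hc hr⟩ ⟨_, ⟨s, ⟨hrs.le, le_rfl⟩, rfl⟩, hs⟩
    exact hz2 (interior_subset hz1)
  refine ⟨u, hfr, ?_⟩
  rw [hform]
  exact mul_ne_zero (sinK_pos (by linarith [hu.1]) fun hK => by linarith [hu.2, hsK hK]).ne'
    (right_ne_zero_of_mul hpos.ne')

/-- A geodesic that meets the polygon and passes through no vertex crosses two edges. -/
theorem exists_crossings {S : UnitTangent K} (hS : ∀ i, S.form (a i).pt.1 ≠ 0) {s₀ : ℝ}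
    (hs₀ : S.geod s₀ ∈ D) : ∃ i j, i ≠ j ∧ ∃ l : ℝ × ℝ, l.1 ∈ Set.Ioo 0 (len i) ∧
      l.2 ∈ Set.Ioo 0 (len j) ∧ S.form ((a i).geod l.1).1 = 0 ∧
      S.form ((a j).geod l.2).1 = 0 := by
  obtain ⟨s₁, hs₁⟩ := h.exists_geod_notMem hS
  obtain ⟨s, hs⟩ := (nonempty_frontier_iff (s := S.geod ⁻¹' D)).2
    ⟨⟨s₀, hs₀⟩, fun e => hs₁ (by
      have : s₁ ∈ S.geod ⁻¹' D := by rw [e]; trivial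
      exact this)⟩
  have hs : S.geod s ∈ frontier D := S.continuous_geod.frontier_preimage_subset D hs
  obtain ⟨i, t, ht, e⟩ := h.exists_edge_of_mem_frontier hs hS (S.form_geod s)
  obtain ⟨σ, hσ, hf⟩ := h.exists_orientation
  have hpt : ((a i).flow t).pt = (S.flow s).pt := e
  -- Tangency to the edge would force the geodesic through its initial vertex.
  have hB : (a i).form (S.flow s).vec ≠ 0 := by
    intro h0
    apply hS i
    have e1 := UnitTangent.form_swap (S.flow s) ((a i).flow t) hpt
    rw [(a i).flow_form, S.flow_form, h0] at e1
    have e2 := UnitTangent.form_geod_other ((a i).flow t) (S.flow s) hpt.symm (-t)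
    rw [(a i).flow_geod, add_neg_cancel, (a i).geod_zero, S.flow_form] at e2
    rw [e2, show S.form ((a i).flow t).vec = 0 by linarith, mul_zero]
  -- Choose the orientation pointing into `D`.
  obtain ⟨T, hT, hpos, hST⟩ : ∃ T : UnitTangent K, T.pt = (a i).geod t ∧
      0 < σ * (a i).form T.vec ∧ ∀ u, S.form (T.geod u).1 = 0 := by
    rcases lt_or_gt_of_ne (mul_ne_zero hσ hB) with hneg | hpos
    · refine ⟨(S.flow s).rotate π, hpt.symm, ?_, fun u => ?_⟩
      · rw [UnitTangent.reverse_vec, UnitTangent.form, det3_neg]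
        change 0 < σ * -(a i).form (S.flow s).vec
        linarith
      · rw [UnitTangent.reverse_geod, S.flow_geod, S.form_geod]
    · exact ⟨S.flow s, hpt.symm, hpos, fun u => by rw [S.flow_geod, S.form_geod]⟩
  obtain ⟨u, hu, hne⟩ := h.exists_exit hσ hf ht hT hpos
  obtain ⟨j, t', ht', e'⟩ := h.exists_edge_of_mem_frontier hu hS (hST u)
  refine ⟨i, j, ?_, (t, t'), ht, ht', ?_, ?_⟩
  · rintro rfl
    rw [← e', UnitTangent.form_geod] at hne
    exact hne rfl
  · rw [e, S.form_geod]
  · rw [e', hST]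

/-- Up to geodesics through vertices, the geodesics meeting the polygon are those crossing two
edges. -/
theorem mem_geodesicsMeeting_iff {q : ℝ × ℝ} (hq : q ∈ polarInterior K)
    (hv : ∀ i, (polarGeodesic K q).form (a i).pt.1 ≠ 0) :
    q ∈ geodesicsMeeting D ↔ ∃ i j, i < j ∧ q ∈ edgeCell a len i j := by
  constructor
  · rintro ⟨s, hs⟩
    obtain ⟨i, j, hij, l, h1, h2, h3, h4⟩ := h.exists_crossings hv hs
    have hm := (h.mem_edgeCell_iff hij).2 ⟨hq, l, h1, h2, h3, h4⟩
    rcases lt_or_gt_of_ne hij with hlt | hlt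
    · exact ⟨i, j, hlt, hm⟩
    · exact ⟨j, i, hlt, by rwa [h.edgeCell_swap hij.symm]⟩
  · rintro ⟨i, j, hij, hm⟩
    obtain ⟨-, l, h1, -, h3, -⟩ := (h.mem_edgeCell_iff hij.ne).1 hm
    obtain ⟨s, hs⟩ := UnitTangent.exists_geod_eq _ h3
    exact ⟨s, by rw [hs]; exact h.geod_mem ⟨h1.1.le, h1.2.le⟩⟩

end IsConvexPolygon

end ConstCurv

end

noncomputable section

namespace ConstCurv

open Real Filter Topology MeasureTheory

variable {K : ℝ}

/-! ### Integration with respect to the invariant measure -/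

theorem measurable_density : Measurable fun q : ℝ × ℝ => ENNReal.ofReal (cosK K q.1) :=
  ENNReal.measurable_ofReal.comp ((continuous_cosK K).measurable.comp measurable_fst)

theorem setIntegral_geodesicMeasure {E : Set (ℝ × ℝ)} (hE : MeasurableSet E)
    (hsub : E ⊆ polarInterior K) (g : ℝ × ℝ → ℝ) :
    (IntegrableOn g E (geodesicMeasure K) ↔ IntegrableOn (fun q => cosK K q.1 * g q) E) ∧
      ∫ q in E, g q ∂geodesicMeasure K = ∫ q in E, cosK K q.1 * g q := by
  have e : (geodesicMeasure K).restrict E =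
      (volume.restrict E).withDensity fun q : ℝ × ℝ => ENNReal.ofReal (cosK K q.1) := by
    rw [geodesicMeasure, restrict_withDensity hE, Measure.restrict_restrict hE,
      Set.inter_eq_left.2 (hsub.trans polarInterior_subset)]
  have hlt : ∀ᵐ q ∂volume.restrict E, ENNReal.ofReal (cosK K q.1) < ⊤ :=
    Eventually.of_forall fun _ => ENNReal.ofReal_lt_top
  have hcongr : Set.EqOn (fun q => (ENNReal.ofReal (cosK K q.1)).toReal • g q)
      (fun q => cosK K q.1 * g q) E := fun q hq => by
    simp only [ENNReal.toReal_ofReal (cosK_pos_of_mem (hsub hq)).le, smul_eq_mul]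
  constructor
  · rw [IntegrableOn, e, integrable_withDensity_iff_integrable_smul' measurable_density hlt]
    exact integrableOn_congr_fun hcongr hE
  · rw [e, integral_withDensity_eq_integral_toReal_smul measurable_density hlt]
    exact setIntegral_congr_fun hE hcongr

/-- The pairs of different edges. -/
def edgePairs (n : ℕ) : Finset (Fin n × Fin n) := Finset.univ.filter fun p => p.1 < p.2

/-- The mixed difference sums to zero over the whole discrete torus and is symmetric, so twice the
sum over `i < j` is minus the diagonal sum. -/
theorem sum_mixed_difference {n : ℕ} [NeZero n] {H : Fin n → Fin n → ℝ}
    (hsymm : ∀ i j, H i j = H j i) (hdiag : ∀ i, H i i = 0) :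
    ∑ p ∈ edgePairs n, ((H (p.1 + 1) (p.2 + 1) - H (p.1 + 1) p.2) -
      (H p.1 (p.2 + 1) - H p.1 p.2)) = ∑ i, H i (i + 1) := by
  set Δ : Fin n × Fin n → ℝ := fun p => (H (p.1 + 1) (p.2 + 1) - H (p.1 + 1) p.2) -
    (H p.1 (p.2 + 1) - H p.1 p.2) with hΔ
  have hshift : ∀ g : Fin n → ℝ, ∑ i, g (i + 1) = ∑ i, g i := fun g =>
    Equiv.sum_comp (Equiv.addRight (1 : Fin n)) g
  have htotal : ∑ p, Δ p = 0 := by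
    rw [Fintype.sum_prod_type]
    simp only [hΔ, Finset.sum_sub_distrib]
    have e1 := fun i => hshift (fun j => H i j)
    simp only [e1]
    ring
  have hswap : ∑ p ∈ Finset.univ.filter (fun p : Fin n × Fin n => p.2 < p.1), Δ p =
      ∑ p ∈ edgePairs n, Δ p := by
    refine Finset.sum_bij' (fun p _ => p.swap) (fun p _ => p.swap) ?_ ?_ ?_ ?_ ?_
    · intro p hp
      simpa [edgePairs] using hp
    · intro p hp
      simpa [edgePairs] using hp
    · intro p _
      exact p.swap_swap
    · intro p _
      exact p.swap_swap
    · intro p _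
      simp only [hΔ, Prod.fst_swap, Prod.snd_swap]
      rw [hsymm (p.2 + 1) (p.1 + 1), hsymm (p.2 + 1) p.1, hsymm p.2 (p.1 + 1), hsymm p.2 p.1]
      ring
  -- Since `H i i = 0`, only the two equal off-diagonal terms remain.
  have heq : ∑ p ∈ Finset.univ.filter (fun p : Fin n × Fin n => p.1 = p.2), Δ p =
      -2 * ∑ i, H i (i + 1) := by
    rw [Finset.mul_sum]
    refine Finset.sum_bij' (fun p _ => p.1) (fun i _ => (i, i)) ?_ ?_ ?_ ?_ ?_
    · intro p _
      exact Finset.mem_univ _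
    · intro i _
      simp
    · intro p hp
      exact Prod.ext rfl (Finset.mem_filter.1 hp).2
    · intro i _
      rfl
    · intro p hp
      have hp := (Finset.mem_filter.1 hp).2
      simp only [hΔ, ← hp, hdiag]
      rw [hsymm (p.1 + 1) p.1]
      ring
  have hsplit : ∀ p : Fin n × Fin n, Δ p = (if p.1 < p.2 then Δ p else 0) +
      (if p.2 < p.1 then Δ p else 0) + (if p.1 = p.2 then Δ p else 0) := fun p => by
    rcases lt_trichotomy p.1 p.2 with hp | hp | hp
    · simp [hp, hp.not_gt, hp.ne]
    · simp [hp]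
    · simp [hp, hp.not_gt, hp.ne']
  rw [Finset.sum_congr rfl fun p _ => hsplit p, Finset.sum_add_distrib, Finset.sum_add_distrib,
    ← Finset.sum_filter, ← Finset.sum_filter, ← Finset.sum_filter, hswap, heq] at htotal
  change ∑ p ∈ edgePairs n, Δ p + _ + _ = 0 at htotal
  linarith

/-! ### Assembly over pairs of edges -/

variable {D : Set (Plane K)}

namespace IsConvexPolygon

variable {n : ℕ} [NeZero n] {a : Fin n → UnitTangent K} {len : Fin n → ℝ}
  {i j : Fin n} {f : ℝ → ℝ}
  (h : IsConvexPolygon D a len)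

include h

theorem geodesicsMeeting_ae_eq : geodesicsMeeting D =ᵐ[geodesicMeasure K]
    ⋃ p ∈ edgePairs n, edgeCell a len p.1 p.2 := by
  have hac : geodesicMeasure K ≪ volume.restrict (polarDomain K) :=
    withDensity_absolutelyContinuous _ _
  have hvol : ∀ᵐ q : ℝ × ℝ, q ∈ polarDomain K → (q ∈ geodesicsMeeting D ↔
      q ∈ ⋃ p ∈ edgePairs n, edgeCell a len p.1 p.2) := by
    have hv : ∀ᵐ q : ℝ × ℝ, ∀ i, (polarGeodesic K q).form (a i).pt.1 ≠ 0 :=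
      ae_all_iff.2 fun i => measure_eq_zero_iff_ae_notMem.1 (volume_geodesics_through (a i).pt)
    filter_upwards [hv, ae_mem_polarInterior (K := K)] with q h1 h2 hq
    rw [h.mem_geodesicsMeeting_iff (h2 hq) h1]
    simp [edgePairs]
  refine eventuallyEq_set.2 (hac.ae_le ((ae_restrict_iff'₀ ?_).2 hvol))
  -- `polarDomain K` agrees with the measurable set `polarInterior K` up to a null set.
  refine (measurableSet_polarInterior (K := K)).nullMeasurableSet.congr (eventuallyEq_set.2 ?_)
  filter_upwards [ae_mem_polarInterior (K := K)] with q hq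
  exact ⟨fun h1 => polarInterior_subset h1, hq⟩

theorem integral_geodesicsMeeting {g : ℝ × ℝ → ℝ}
    (hg : ∀ i j, i ≠ j → IntegrableOn g (edgeCell a len i j) (geodesicMeasure K)) :
    IntegrableOn g (geodesicsMeeting D) (geodesicMeasure K) ∧
      ∫ q in geodesicsMeeting D, g q ∂geodesicMeasure K =
        ∑ p ∈ edgePairs n, ∫ q in edgeCell a len p.1 p.2, g q ∂geodesicMeasure K := by
  have hlt : ∀ p ∈ edgePairs n, p.1 < p.2 := fun p hp => (Finset.mem_filter.1 hp).2
  constructor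
  · rw [integrableOn_congr_set_ae h.geodesicsMeeting_ae_eq, integrableOn_finset_iUnion]
    exact fun p hp => hg _ _ (hlt p hp).ne
  · rw [setIntegral_congr_set h.geodesicsMeeting_ae_eq, integral_biUnion_finset]
    · exact fun p hp => h.measurableSet_edgeCell (hlt p hp).ne
    · exact fun p hp p' hp' hne => h.disjoint_edgeCell (hlt p hp) (hlt p' hp') hne
    · exact fun p hp => hg _ _ (hlt p hp).ne

/-- The integral of a function of the chord length over the geodesics crossing two given edges. -/
theorem chord_integral (hij : i ≠ j) (hf : Continuous f) :
    IntegrableOn (fun q => f (chordLength D (polarGeodesic K q))) (edgeCell a len i j)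
      (geodesicMeasure K) ∧
    ∫ q in edgeCell a len i j, f (chordLength D (polarGeodesic K q)) ∂geodesicMeasure K =
      ∫ l in Set.Ioo 0 (len i) ×ˢ Set.Ioo 0 (len j),
        f (pairDist (a i) (a j) l) * pairDist₁₂ (a i) (a j) l := by
  obtain ⟨e1, e2⟩ := setIntegral_geodesicMeasure (h.measurableSet_edgeCell hij)
    (fun _ hq => hq.1) fun q => f (chordLength D (polarGeodesic K q))
  obtain ⟨g1, g2⟩ := h.integral_edgeCell hij
    (g := fun q => f (chordLength D (polarGeodesic K q)))
    (g' := fun l => f (pairDist (a i) (a j) l)) fun q l h1 h2 h3 h4 => by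
      rw [(h.chord_of_form_eq_zero hij h1 h2 h3 h4).1]
  rw [e1, e2, g1, g2]
  simp only [mul_comm (pairDist₁₂ (a i) (a j) _)]
  exact ⟨h.integrableOn_comp_mul_pairDist₁₂ hij hf, trivial⟩

/-- The integral of the angular term over the geodesics crossing two given edges. -/
theorem cot_integral (hij : i ≠ j) (hf : Continuous f) :
    IntegrableOn (fun q => f (chordLength D (polarGeodesic K q)) *
      sinK K (chordLength D (polarGeodesic K q)) * Real.cot (startAngle D (polarGeodesic K q)) *
        Real.cot (endAngle D (polarGeodesic K q))) (edgeCell a len i j) (geodesicMeasure K) ∧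
    ∫ q in edgeCell a len i j, f (chordLength D (polarGeodesic K q)) *
      sinK K (chordLength D (polarGeodesic K q)) * Real.cot (startAngle D (polarGeodesic K q)) *
        Real.cot (endAngle D (polarGeodesic K q)) ∂geodesicMeasure K =
      -∫ l in Set.Ioo 0 (len i) ×ˢ Set.Ioo 0 (len j),
        f (pairDist (a i) (a j) l) * (pairDist₁ (a i) (a j) l * pairDist₂ (a i) (a j) l) := by
  set g : ℝ × ℝ → ℝ := fun q => f (chordLength D (polarGeodesic K q)) *
    sinK K (chordLength D (polarGeodesic K q)) * Real.cot (startAngle D (polarGeodesic K q)) *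
      Real.cot (endAngle D (polarGeodesic K q))
  obtain ⟨e1, e2⟩ := setIntegral_geodesicMeasure (h.measurableSet_edgeCell hij)
    (fun _ hq => hq.1) g
  obtain ⟨g1, g2⟩ := h.integral_edgeCell hij (g := g)
    (g' := fun l => f (pairDist (a i) (a j) l) *
      (-(pairDist₁ (a i) (a j) l * pairDist₂ (a i) (a j) l) / pairDist₁₂ (a i) (a j) l))
    fun q l h1 h2 h3 h4 => by
      obtain ⟨c1, c2⟩ := h.chord_of_form_eq_zero hij h1 h2 h3 h4
      rw [← c2]
      simp only [g, c1]
      ring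
  have hm : MeasurableSet (Set.Ioo 0 (len i) ×ˢ Set.Ioo 0 (len j)) :=
    measurableSet_Ioo.prod measurableSet_Ioo
  have hcongr : Set.EqOn (fun l => pairDist₁₂ (a i) (a j) l * (f (pairDist (a i) (a j) l) *
      (-(pairDist₁ (a i) (a j) l * pairDist₂ (a i) (a j) l) / pairDist₁₂ (a i) (a j) l)))
      (fun l => -(f (pairDist (a i) (a j) l) *
        (pairDist₁ (a i) (a j) l * pairDist₂ (a i) (a j) l)))
      (Set.Ioo 0 (len i) ×ˢ Set.Ioo 0 (len j)) := fun l hl => by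
    have := (h.pairDist₁₂_pos_of_mem hij hl).ne'
    field_simp
  rw [e1, e2, g1, g2, integrableOn_congr_fun hcongr hm, setIntegral_congr_fun hm hcongr,
    integral_neg]
  exact ⟨(h.integrableOn_comp_mul_pairDist₁_mul_pairDist₂ hij hf).neg, rfl⟩

theorem chord_integral_eq (hij : i ≠ j) (hf : ContDiff ℝ 1 f) :
    ∫ q in edgeCell a len i j, f (chordLength D (polarGeodesic K q)) ∂geodesicMeasure K =
      (∫ q in edgeCell a len i j, deriv f (chordLength D (polarGeodesic K q)) *
        sinK K (chordLength D (polarGeodesic K q)) * Real.cot (startAngle D (polarGeodesic K q)) *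
          Real.cot (endAngle D (polarGeodesic K q)) ∂geodesicMeasure K) +
      (((∫ x in (0 : ℝ)..rho K (a (i + 1)).pt.1 (a (j + 1)).pt.1, f x) -
          ∫ x in (0 : ℝ)..rho K (a (i + 1)).pt.1 (a j).pt.1, f x) -
        ((∫ x in (0 : ℝ)..rho K (a i).pt.1 (a (j + 1)).pt.1, f x) -
          ∫ x in (0 : ℝ)..rho K (a i).pt.1 (a j).pt.1, f x)) := by
  have hf' := hf.continuous_deriv le_rfl
  have key := h.integral_mixed_derivative hij hf
  rw [integral_add (h.integrableOn_comp_mul_pairDist₁_mul_pairDist₂ hij hf')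
    (h.integrableOn_comp_mul_pairDist₁₂ hij hf.continuous), ← (h.chord_integral hij
    hf.continuous).2, ← neg_eq_iff_eq_neg.2 (h.cot_integral hij hf').2] at key
  simp only [pairDist, UnitTangent.geod_zero, h.poly.closed] at key
  linarith

theorem integral_formula (hf : ContDiff ℝ 1 f) :
    ∫ q in geodesicsMeeting D, f (chordLength D (polarGeodesic K q)) ∂geodesicMeasure K =
      (∫ q in geodesicsMeeting D, deriv f (chordLength D (polarGeodesic K q)) *
        sinK K (chordLength D (polarGeodesic K q)) * Real.cot (startAngle D (polarGeodesic K q)) *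
          Real.cot (endAngle D (polarGeodesic K q)) ∂geodesicMeasure K) +
      ∑ i, ∫ x in (0 : ℝ)..len i, f x := by
  have hf' := hf.continuous_deriv le_rfl
  rw [(h.integral_geodesicsMeeting fun i j hij => (h.chord_integral hij hf.continuous).1).2,
    (h.integral_geodesicsMeeting fun i j hij => (h.cot_integral hij hf').1).2,
    Finset.sum_congr rfl fun p hp => h.chord_integral_eq (Finset.mem_filter.1 hp).2.ne hf,
    Finset.sum_add_distrib]
  congr 1
  rw [sum_mixed_difference (H := fun i j => ∫ x in (0 : ℝ)..rho K (a i).pt.1 (a j).pt.1, f x)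
    (fun i j => by rw [rho_comm]) fun i => by rw [rho_self, intervalIntegral.integral_same]]
  refine Finset.sum_congr rfl fun i _ => ?_
  -- An edge is no longer than `π / √K` when `K > 0`, so the distance of consecutive vertices is the
  -- edge length.
  rw [← h.poly.closed i, rho_geod (a i) (h.poly.len_pos i).le (h.len_le_pi i)]

end IsConvexPolygon

end ConstCurv

end

theorem mainTheorem7 (K : ℝ) (D : Set (ConstCurv.Plane K))
    (hcompact : IsCompact D) (hint : (interior D).Nonempty)
    (hconvex : ConstCurv.GeodesicallyConvex D)
    (n : ℕ) [NeZero n] (a : Fin n → ConstCurv.UnitTangent K) (len : Fin n → ℝ)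
    (hpoly : ConstCurv.HasPolygonBoundary D a len)
    (f : ℝ → ℝ) (hf : ContDiff ℝ 1 f) :
    let μ := ConstCurv.geodesicMeasure K
    let G := ConstCurv.geodesicsMeeting D
    let ρ := fun q : ℝ × ℝ => ConstCurv.chordLength D (ConstCurv.polarGeodesic K q)
    let α₁ := fun q : ℝ × ℝ => ConstCurv.startAngle D (ConstCurv.polarGeodesic K q)
    let α₂ := fun q : ℝ × ℝ => ConstCurv.endAngle D (ConstCurv.polarGeodesic K q)
    MeasureTheory.IntegrableOn (fun q => f (ρ q)) G μ ∧
    MeasureTheory.IntegrableOn (fun q => deriv f (ρ q) * ConstCurv.sinK K (ρ q) *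
      Real.cot (α₁ q) * Real.cot (α₂ q)) G μ ∧
    ∫ q in G, f (ρ q) ∂μ =
      (∫ q in G, deriv f (ρ q) * ConstCurv.sinK K (ρ q) *
        Real.cot (α₁ q) * Real.cot (α₂ q) ∂μ) +
      ∑ i, ∫ x in (0 : ℝ)..len i, f x := by
  intro μ G ρ α₁ α₂
  have h : ConstCurv.IsConvexPolygon D a len := ⟨hcompact, hconvex, hpoly⟩
  exact ⟨(h.integral_geodesicsMeeting fun i j hij => (h.chord_integral hij hf.continuous).1).1,
    (h.integral_geodesicsMeeting fun i j hij =>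
      (h.cot_integral hij (hf.continuous_deriv le_rfl)).1).1, h.integral_formula hf⟩
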